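/- Let $p$ be a prime, $K$ a finite unramified extension of $\mathbb{Q}_p$ with residue field $\mathbb{F}_q$, $q=p^f$, and $E$ a finite extension of $K$ with residue field $\mathbb{F}$. Fix embeddings $W(\mathbb{F})\hookrightarrow\mathcal{O}_E$ and $\sigma_0:\mathcal{O}_K\hookrightarrow W(\mathbb{F})$, and let $\bar\sigma_0:\mathcal{O}_K\to\mathbb{F}$ be the reduction of $\sigma_0$. For $(R,\tau)=(W(\mathbb{F}),\sigma_0)$ or $(\mathbb{F},\bar\sigma_0)$ let $R[[\mathcal{O}_K]]=\varprojlim_n R[\mathcal{O}_K/p^n]$ be the Iwasawa algebra of the additive group $\mathcal{O}_K$, and for $0\le i\le f-1$ let $T_i=\sum_{\lambda\in\mathbb{F}_q^\times}\tau([\lambda])^{-p^i}\,[[\lambda]]$, where the inner $[\lambda]\in\mathcal{O}_K^\times$ is the Teichmüller lift (and $T_0=[1]-1$ if $q=2$). Let $\widehat{A}_R$ be the completion of $R[[\mathcal{O}_K]][1/\prod_iT_i]$ for the filtration $\{P/(\prod_i T_i)^k : \mathrm{ord}\,P-kf\ge m\}_{m\in\mathbb{Z}}$, where $\mathrm{ord}\,P$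 is the largest $j$ with $P\in(T_0,\dots,T_{f-1})^j$. Put $A_{\mathrm{mv},E_0}=\varprojlim_n \widehat{A}_{W(\mathbb{F})}/p^n$, and for $n\ge1$ and $P\in A_{\mathrm{mv},E_0}$ let $v_n(P)\in\mathbb{Z}\cup\{+\infty\}$ be the supremum of the $k$ such that $P$ is congruent mod $p^n$ to an element of $\widehat A_{W(\mathbb{F})}$ of filtration $\geq k$; give $A_{\mathrm{mv},E_0}$ the topology in which the subgroups $\{v_n\ge k\}$ are a basis of neighbourhoods of $0$. Put $A=\widehat A_{\mathbb{F}}$ $(\cong\mathbb{F}((T_0))\langle (T_i/T_0)^{\pm1}\rangle)$ and let $A_\infty$ be the completed perfection of $A$ $(\cong\mathbb{F}((T_0^{p^{-\infty}}))\langle (T_i/T_0)^{\pm p^{-\infty}}\rangle)$. Multiplication by $q$ and by $a\in\mathcal{O}_K^\times$ on $\mathcal{O}_K$ induces endomorphisms of $W(\mathbb{F})[[\mathcal{O}_K]]$ and $\mathbb{F}[[\mathcal{O}_K]]$; these extend uniquely to continuous $W(\mathbb{F})$-linear endomorphisms $\varphi_q$, $a$ of $A_{\mathrm{mv},E_0}$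 and to continuous $\mathbb{F}$-linear endomorphisms $\varphi_q$, $a$ of $A_\infty$. By functoriality of Witt vectors they act on $W(A_\infty)$. Let $\varinjlim_{\varphi_q}A_{\mathrm{mv},E_0}$ be the colimit of copies of $A_{\mathrm{mv},E_0}$ indexed by $\mathbb{Z}_{\ge0}$ with all transition maps equal to $\varphi_q$. For $x$ represented by $P$ in the $N$-th copy put $w_n(x)=\liminf_{m\to\infty}v_n(\varphi_q^m(P))/q^{m+N}$, and $$d(x,y)=\sum_{n\ge1}2^{-n}\frac{p^{-w_n(x-y)}}{1+p^{-w_n(x-y)}}.$$ Then $\varinjlim_{\varphi_q}A_{\mathrm{mv},E_0}$ with the distance $d$ is a Hausdorff topological ring, the maps induced by $\varphi_q$ and by $a\in\mathcal{O}_K^\times$ on it extend to continuous $W(\mathbb{F})$-algebra endomorphisms of its completion, and there is an isomorphism of $W(\mathbb{F})$-algebras $$h:\Bigl(\varinjlim_{\varphi_q}A_{\mathrm{mv},E_0}\Bigr)^{\wedge}\xrightarrow{\ \sim\ }W(A_\infty)$$ which commutes with $\varphi_q$ and with every $a\in\mathcal{O}_K^\times$. The composition $$A_{\mathrm{mv},E_0}\to\varinjlim_{\varphi_q}A_{\mathrm{mv},E_0}\to\Bigl(\varinjlim_{\varphi_q}A_{\mathrm{mv},E_0}\Bigr)^{\wedge}\xrightarrow{h}W(A_\infty)$$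 (the first map being that of the $0$-th copy) is injective and commutes with $\varphi_q$ and $\mathcal{O}_K^\times$, and so is and does its base change $$A_{\mathrm{mv},E}:=\mathcal{O}_E\otimes_{W(\mathbb{F})}A_{\mathrm{mv},E_0}\hookrightarrow W_E(A_\infty):=\mathcal{O}_E\otimes_{W(\mathbb{F})}W(A_\infty),$$ where $\varphi_q$ and $\mathcal{O}_K^\times$ act $\mathcal{O}_E$-linearly. -/

import Mathlib

noncomputable section
namespace MvIwasawa

/-! ## Rings with a `ℤ`-indexed filtration -/

/-- A decreasing exhaustive filtration of a commutative ring by additive subgroups, compatible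
with multiplication: the sets `{x | m ≤ v x}` attached to a (semi-)valuation `v`. -/
structure IsRingFil {A : Type*} [CommRing A] (F : ℤ → AddSubgroup A) : Prop where
  anti : Antitone F
  one_mem : (1 : A) ∈ F 0
  mul_mem : ∀ {m n : ℤ} {x y : A}, x ∈ F m → y ∈ F n → x * y ∈ F (m + n)
  exists_mem : ∀ x : A, ∃ m : ℤ, x ∈ F m

theorem IsRingFil.basis {A : Type*} [CommRing A] {F : ℤ → AddSubgroup A} (h : IsRingFil F) :
    RingSubgroupsBasis F := by
  refine RingSubgroupsBasis.of_comm _ (fun i j => ⟨max i j, ?_⟩) (fun i => ⟨max i 0, ?_⟩) ?_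
  · exact le_inf (h.anti (le_max_left i j)) (h.anti (le_max_right i j))
  · rintro _ ⟨x, hx, y, hy, rfl⟩
    exact h.anti (by omega) (h.mul_mem hx hy)
  · intro x i
    obtain ⟨l, hl⟩ := h.exists_mem x
    refine ⟨i - l, fun y hy => ?_⟩
    have := h.mul_mem hl hy
    simpa using this

theorem IsRingFil.pow_mem {A : Type*} [CommRing A] {F : ℤ → AddSubgroup A} (h : IsRingFil F)
    {m : ℤ} {x : A} (hx : x ∈ F m) (n : ℕ) : x ^ n ∈ F (n * m) := by
  induction n with
  | zero => simpa using h.one_mem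
  | succ n ih =>
    rw [pow_succ]
    have := h.mul_mem ih hx
    convert this using 2
    push_cast; ring

/-! ## The Iwasawa algebra -/

section Iwasawa

variable (p : ℕ) (G R : Type*) [CommRing G] [CommRing R]

/-- The group ring `R[G/p^n G]` of the additive group `G/p^n G`. -/
abbrev FinLevel (n : ℕ) : Type _ := AddMonoidAlgebra R (G ⧸ Ideal.span {(p : G) ^ n})

/-- The transition map `R[G/p^(n+1) G] → R[G/p^n G]`. -/
def finLevelMap (n : ℕ) : FinLevel p G R (n + 1) →ₐ[R] FinLevel p G R n :=
  AddMonoidAlgebra.mapDomainAlgHom R R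
    (Ideal.Quotient.factor (S := Ideal.span {(p : G) ^ (n + 1)}) (T := Ideal.span {(p : G) ^ n})
      (by
        rw [Ideal.span_singleton_le_span_singleton]
        exact pow_dvd_pow _ n.le_succ)).toAddMonoidHom

/-- The Iwasawa algebra `R⟦G⟧ = lim_n R[G/p^n G]` of the additive group of `G`. -/
def iwasawa : Subalgebra R (∀ n : ℕ, FinLevel p G R n) where
  carrier := {x | ∀ n, finLevelMap p G R n (x (n + 1)) = x n}
  mul_mem' hx hy n := by simp [hx n, hy n]
  add_mem' hx hy n := by simp [hx n, hy n]
  algebraMap_mem' r n := by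
    simp only [Pi.algebraMap_apply]
    exact AlgHom.commutes _ r

/-- The endomorphism of `R[G/p^n G]` induced by multiplication by `c` on `G`. -/
def finLevelScale (c : G) (n : ℕ) : FinLevel p G R n →ₐ[R] FinLevel p G R n :=
  AddMonoidAlgebra.mapDomainAlgHom R R (AddMonoidHom.mulLeft (Ideal.Quotient.mk _ c))

theorem finLevelMap_scale (c : G) (n : ℕ) :
    (finLevelMap p G R n).comp (finLevelScale p G R c (n + 1)) =
      (finLevelScale p G R c n).comp (finLevelMap p G R n) := by
  rw [finLevelMap, finLevelScale, finLevelScale, ← AddMonoidAlgebra.mapDomainAlgHom_comp,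
    ← AddMonoidAlgebra.mapDomainAlgHom_comp]
  congr 1
  ext x
  simp

/-- The endomorphism of `R⟦G⟧` induced by multiplication by `c` on `G`; on group elements it is
`[x] ↦ [c x]`. -/
def scale (c : G) : iwasawa p G R →ₐ[R] iwasawa p G R :=
  AlgHom.codRestrict
    (AlgHom.comp
      (AlgHom.pi fun n => (finLevelScale p G R c n).comp (Pi.evalAlgHom R _ n))
      (iwasawa p G R).val) _
    (fun x n => by
      have := DFunLike.congr_fun (finLevelMap_scale p G R c n) (x.1 (n + 1))
      simp only [AlgHom.comp_apply] at this
      have h2 : finLevelMap p G R n (x.1 (n + 1)) = x.1 n := x.2 n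
      rw [h2] at this
      exact this)

variable {G}

/-- The group element `[x] ∈ R⟦G⟧`. -/
def grp (x : G) : iwasawa p G R :=
  ⟨fun n => AddMonoidAlgebra.single (Ideal.Quotient.mk _ x) 1, fun n => by
    simp [finLevelMap]⟩

end Iwasawa

/-! ## The first completion: `R⟦G⟧[1/T_0, …, 1/T_(f-1)]` completed for the `(T_0, …, T_(f-1))`-adic
valuation -/

section Coeff

variable (p f : ℕ) {G R : Type*} [CommRing G] [CommRing R] (τ : G →+* R)

open Classical in
/-- The variable `T_i = ∑_λ τ([λ])^(-p^i) · [[λ]]`, the sum being over the Teichmüller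
representatives `[λ]` of the nonzero elements of the residue field with `q = p^f` elements, that is,
over the `(q-1)`-st roots of unity of `G`; for `q = 2` it is `[1] - 1`. -/
def T (i : Fin f) : iwasawa p G R :=
  if p ^ f = 2 then grp p R (1 : G) - 1
  else ∑ᶠ ζ : rootsOfUnity (p ^ f - 1) G,
    τ ((ζ⁻¹ : rootsOfUnity (p ^ f - 1) G) : Gˣ) ^ p ^ (i : ℕ) • grp p R ((ζ : Gˣ) : G)

/-- The product of the variables. -/
def prodT : iwasawa p G R := ∏ i, T p f τ i

/-- The ideal generated by the variables. -/
def idealT : Ideal (iwasawa p G R) := Ideal.span (Set.range (T p f τ))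

/-- The localization of `R⟦G⟧` at the powers of `∏ T_i`. -/
def Loc : Type _ := Localization.Away (prodT p f τ)

instance : CommRing (Loc p f τ) := inferInstanceAs (CommRing (Localization.Away (prodT p f τ)))

/-- The localization map. -/
def toLoc : iwasawa p G R →+* Loc p f τ :=
  algebraMap (iwasawa p G R) (Localization.Away (prodT p f τ))

theorem isUnit_toLoc : IsUnit (toLoc p f τ (prodT p f τ)) :=
  IsLocalization.Away.algebraMap_isUnit (S := Localization.Away (prodT p f τ)) (prodT p f τ)

theorem prodT_mem : prodT p f τ ∈ idealT p f τ ^ f := by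
  have := Ideal.prod_mem_prod (s := Finset.univ) (I := fun _ : Fin f => idealT p f τ)
    (x := T p f τ) (fun i _ => Ideal.subset_span ⟨i, rfl⟩)
  simpa [prodT] using this

/-- The elements `x = P / (∏ T_i)^k` with `ord P - k f ≥ m`, where `ord P` is the largest `j` with
`P ∈ (T_0, …, T_(f-1))^j`. -/
def locFil (m : ℤ) : AddSubgroup (Loc p f τ) where
  carrier := {x | ∃ (k : ℕ) (P : iwasawa p G R), P ∈ idealT p f τ ^ (m + k * f).toNat ∧
    x * toLoc p f τ (prodT p f τ) ^ k = toLoc p f τ P}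
  zero_mem' := ⟨0, 0, Ideal.zero_mem _, by simp⟩
  neg_mem' := by
    rintro x ⟨k, P, hP, hx⟩
    exact ⟨k, -P, neg_mem hP, by rw [map_neg, ← hx, neg_mul]⟩
  add_mem' := by
    rintro x y ⟨k, P, hP, hx⟩ ⟨l, Q, hQ, hy⟩
    have key : ∀ (a b : ℕ) (S : iwasawa p G R), S ∈ idealT p f τ ^ (m + a * f).toNat →
        S * prodT p f τ ^ b ∈ idealT p f τ ^ (m + (a + b : ℕ) * f).toNat := by
      intro a b S hS
      have h1 := Ideal.mul_mem_mul hS (Ideal.pow_mem_pow (prodT_mem p f τ) b)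
      rw [← pow_mul, ← pow_add] at h1
      refine Ideal.pow_le_pow_right ?_ h1
      have : ((a + b : ℕ) : ℤ) * f = a * f + (f * b : ℕ) := by push_cast; ring
      rw [this]
      omega
    refine ⟨k + l, P * prodT p f τ ^ l + Q * prodT p f τ ^ k, add_mem (key _ _ _ hP) ?_, ?_⟩
    · rw [add_comm k l]; exact key _ _ _ hQ
    · simp only [map_add, map_mul, map_pow, ← hx, ← hy]; ring

theorem locFil_isRingFil : IsRingFil (locFil p f τ) where
  anti := by
    rintro m n h x ⟨k, P, hP, hx⟩
    exact ⟨k, P, Ideal.pow_le_pow_right (by omega) hP, hx⟩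
  one_mem := ⟨0, 1, by simp, by simp⟩
  mul_mem := by
    rintro m n x y ⟨k, P, hP, hx⟩ ⟨l, Q, hQ, hy⟩
    refine ⟨k + l, P * Q, ?_, ?_⟩
    · have h1 := Ideal.mul_mem_mul hP hQ
      rw [← pow_add] at h1
      refine Ideal.pow_le_pow_right ?_ h1
      have : m + n + ((k + l : ℕ) : ℤ) * f = (m + k * f) + (n + l * f) := by push_cast; ring
      rw [this]
      omega
    · simp only [map_mul, ← hx, ← hy]; ring
  exists_mem := by
    intro x
    obtain ⟨k, P, hP⟩ := IsLocalization.Away.surj (S := Localization.Away (prodT p f τ))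
      (prodT p f τ) x
    refine ⟨-(k * f : ℕ), k, P, ?_, hP⟩
    have : (-((k * f : ℕ) : ℤ) + k * f).toNat = 0 := by push_cast; simp
    rw [this]
    simp

instance : TopologicalSpace (Loc p f τ) := (locFil_isRingFil p f τ).basis.topology
instance : IsTopologicalRing (Loc p f τ) :=
  (locFil_isRingFil p f τ).basis.toRingFilterBasis.isTopologicalRing
instance : UniformSpace (Loc p f τ) := IsTopologicalAddGroup.rightUniformSpace _
instance : IsUniformAddGroup (Loc p f τ) := isUniformAddGroup_of_addCommGroup

/-- The completion of the localization for the topology defined by `locFil`. -/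
def Hat : Type _ := UniformSpace.Completion (Loc p f τ)

instance : CommRing (Hat p f τ) := inferInstanceAs (CommRing (UniformSpace.Completion (Loc p f τ)))
instance : TopologicalSpace (Hat p f τ) :=
  inferInstanceAs (TopologicalSpace (UniformSpace.Completion (Loc p f τ)))
instance : IsTopologicalRing (Hat p f τ) :=
  inferInstanceAs (IsTopologicalRing (UniformSpace.Completion (Loc p f τ)))

/-- The completion map. -/
def locToHat : Loc p f τ →+* Hat p f τ :=
  UniformSpace.Completion.coeRingHom (α := Loc p f τ)

theorem denseRange_locToHat : DenseRange (locToHat p f τ) :=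
  UniformSpace.Completion.denseRange_coe

instance : Algebra R (Hat p f τ) :=
  ((locToHat p f τ).comp ((toLoc p f τ).comp (algebraMap R (iwasawa p G R)))).toAlgebra

/-- The natural map from the Iwasawa algebra to the completion. -/
def toHat : iwasawa p G R →ₐ[R] Hat p f τ :=
  { (locToHat p f τ).comp (toLoc p f τ) with commutes' := fun _ => rfl }

/-- The elements of valuation at least `m` in the completion: the closure of `locFil m`. -/
def hatFil (m : ℤ) : AddSubgroup (Hat p f τ) :=
  ((locFil p f τ m).map (locToHat p f τ).toAddMonoidHom).topologicalClosure

theorem hatFil_isRingFil : IsRingFil (hatFil p f τ) where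
  anti := fun m n h => AddSubgroup.topologicalClosure_mono
    (AddSubgroup.map_mono ((locFil_isRingFil p f τ).anti h))
  one_mem := subset_closure ⟨1, (locFil_isRingFil p f τ).one_mem, (locToHat p f τ).map_one⟩
  mul_mem := by
    intro m n x y hx hy
    refine map_mem_closure₂ (f := fun a b : Hat p f τ => a * b) continuous_mul hx hy ?_
    rintro _ ⟨a, ha, rfl⟩ _ ⟨b, hb, rfl⟩
    exact ⟨a * b, (locFil_isRingFil p f τ).mul_mem ha hb, (locToHat p f τ).map_mul _ _⟩
  exists_mem := by
    intro x
    have hopen : IsOpen ((hatFil p f τ 0 : AddSubgroup (Hat p f τ)) : Set (Hat p f τ)) := by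
      refine AddSubgroup.isOpen_of_mem_nhds _ (g := 0) ?_
      have h0 : ((locFil p f τ 0 : AddSubgroup (Loc p f τ)) : Set (Loc p f τ)) ∈
          nhds (0 : Loc p f τ) :=
        (locFil_isRingFil p f τ).basis.hasBasis_nhds_zero.mem_of_mem trivial
      have h1 := (UniformSpace.Completion.isDenseInducing_coe
        (α := Loc p f τ)).closure_image_mem_nhds h0
      exact h1
    obtain ⟨y, hy⟩ := (denseRange_locToHat p f τ).exists_mem_open
      (hopen.preimage (continuous_id.sub continuous_const : Continuous fun z => z - x))
      ⟨x, by simp [(hatFil p f τ 0).zero_mem]⟩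
    obtain ⟨m, hm⟩ := (locFil_isRingFil p f τ).exists_mem y
    have ha := AddSubgroup.topologicalClosure_mono
      (AddSubgroup.map_mono ((locFil_isRingFil p f τ).anti (min_le_left m 0) :
        locFil p f τ m ≤ locFil p f τ (min m 0)) :
        (locFil p f τ m).map (locToHat p f τ).toAddMonoidHom ≤ _)
    have hb := AddSubgroup.topologicalClosure_mono
      (AddSubgroup.map_mono ((locFil_isRingFil p f τ).anti (min_le_right m 0) :
        locFil p f τ 0 ≤ locFil p f τ (min m 0)) :
        (locFil p f τ 0).map (locToHat p f τ).toAddMonoidHom ≤ _)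
    refine ⟨min m 0, ?_⟩
    have h2 : locToHat p f τ y ∈ hatFil p f τ (min m 0) :=
      ha (subset_closure ⟨y, hm, rfl⟩)
    have h3 : locToHat p f τ y - x ∈ hatFil p f τ (min m 0) := hb hy
    have := sub_mem h2 h3
    simpa using this

/-! ## The ring `A_mv`, its semi-valuations and its topology -/

/-- `A_mv`: the `p`-adic completion of `Hat`. -/
def Amv : Type _ := AdicCompletion (Ideal.span {(p : Hat p f τ)}) (Hat p f τ)

instance : CommRing (Amv p f τ) :=
  inferInstanceAs (CommRing (AdicCompletion (Ideal.span {(p : Hat p f τ)}) (Hat p f τ)))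
instance : Algebra R (Amv p f τ) :=
  inferInstanceAs (Algebra R (AdicCompletion (Ideal.span {(p : Hat p f τ)}) (Hat p f τ)))

/-- The `p`-adic completion map. -/
def hatToAmv : Hat p f τ →ₐ[R] Amv p f τ :=
  IsScalarTower.toAlgHom R (Hat p f τ) (AdicCompletion (Ideal.span {(p : Hat p f τ)}) (Hat p f τ))

/-- The natural map from the Iwasawa algebra to `A_mv`. -/
def toAmv : iwasawa p G R →ₐ[R] Amv p f τ := (hatToAmv p f τ).comp (toHat p f τ)

/-- `U_{n,k} = {P | v_n P ≥ k}`: the elements of `A_mv` that are congruent modulo `p^n` to an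
element of `Hat` of valuation at least `k`. In terms of the expansions
`P ≡ ∑ a_{j,l} T_0^l ∏ (T_i/T_0)^(j_i) mod p^n` with `a_{j,l} ∈ R/p^n`, this says that all the
coefficients `a_{j,l}` with `l < k` vanish. -/
def amvNhd (n : ℕ) (k : ℤ) : AddSubgroup (Amv p f τ) :=
  (hatFil p f τ k).map (hatToAmv p f τ).toRingHom.toAddMonoidHom ⊔
    (Ideal.span {(p : Amv p f τ) ^ n}).toAddSubgroup

/-- The semi-valuation `v_n` on `A_mv`. -/
def vmv (n : ℕ) (P : Amv p f τ) : EReal := ⨆ (k : ℤ) (_ : P ∈ amvNhd p f τ n k), ((k : ℝ) : EReal)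

theorem amvNhd_anti {n n' : ℕ} (hn : n ≤ n') {k k' : ℤ} (hk : k ≤ k') :
    amvNhd p f τ n' k' ≤ amvNhd p f τ n k := by
  refine sup_le_sup (AddSubgroup.map_mono ((hatFil_isRingFil p f τ).anti hk)) ?_
  have h : Ideal.span {(p : Amv p f τ) ^ n'} ≤ Ideal.span {(p : Amv p f τ) ^ n} := by
    rw [Ideal.span_singleton_le_span_singleton]
    exact pow_dvd_pow _ hn
  exact h

theorem amvNhd_mul {n : ℕ} {k l : ℤ} {x y : Amv p f τ} (hx : x ∈ amvNhd p f τ n k)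
    (hy : y ∈ amvNhd p f τ n l) : x * y ∈ amvNhd p f τ n (k + l) := by
  obtain ⟨_, ⟨a, ha, rfl⟩, b, hb, rfl⟩ := AddSubgroup.mem_sup.1 hx
  obtain ⟨_, ⟨c, hc, rfl⟩, d, hd, rfl⟩ := AddSubgroup.mem_sup.1 hy
  refine AddSubgroup.mem_sup.2 ⟨hatToAmv p f τ (a * c),
    ⟨a * c, (hatFil_isRingFil p f τ).mul_mem ha hc, rfl⟩,
    hatToAmv p f τ a * d + b * (hatToAmv p f τ c + d), ?_, ?_⟩
  · exact Ideal.add_mem _ (Ideal.mul_mem_left _ _ hd) (Ideal.mul_mem_right _ _ hb)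
  · rw [map_mul]
    change _ = (hatToAmv p f τ a + b) * (hatToAmv p f τ c + d)
    ring

theorem exists_mem_amvNhd (n : ℕ) (x : Amv p f τ) : ∃ k, x ∈ amvNhd p f τ n k := by
  obtain ⟨a, ha⟩ : ∃ a : Hat p f τ, x - hatToAmv p f τ a ∈ Ideal.span {(p : Amv p f τ) ^ n} := by
    let I : Ideal (Hat p f τ) := Ideal.span {(p : Hat p f τ)}
    let x' : AdicCompletion I (Hat p f τ) := x
    obtain ⟨a, ha⟩ := Submodule.Quotient.mk_surjective _ (AdicCompletion.eval I (Hat p f τ) n x')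
    refine ⟨a, ?_⟩
    have hk : x' - AdicCompletion.of I (Hat p f τ) a ∈
        (AdicCompletion.eval I (Hat p f τ) n).ker := by
      rw [LinearMap.mem_ker, map_sub, ← ha]
      exact sub_self _
    rw [← AdicCompletion.pow_smul_top_eq_ker_eval ⟨{(p : Hat p f τ)}, by simp [I]⟩,
      Ideal.span_singleton_pow, Submodule.ideal_span_singleton_smul] at hk
    obtain ⟨z, -, hz⟩ := hk
    have hz' : (p : Hat p f τ) ^ n • z = x' - AdicCompletion.of I (Hat p f τ) a := hz
    have hz2 : (p : AdicCompletion I (Hat p f τ)) ^ n * z =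
        x' - AdicCompletion.of I (Hat p f τ) a := by
      rw [← hz', Algebra.smul_def, map_pow, map_natCast]
    exact Ideal.mem_span_singleton'.2 ⟨z, (mul_comm _ _).trans hz2⟩
  obtain ⟨k, hk⟩ := (hatFil_isRingFil p f τ).exists_mem a
  exact ⟨k, AddSubgroup.mem_sup.2 ⟨hatToAmv p f τ a, ⟨a, hk, rfl⟩, _, ha, by ring⟩⟩

theorem amvNhd_basis : RingSubgroupsBasis fun i : ℕ × ℤ => amvNhd p f τ i.1 i.2 := by
  refine RingSubgroupsBasis.of_comm _ (fun i j => ⟨(max i.1 j.1, max i.2 j.2), ?_⟩)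
    (fun i => ⟨(i.1, max i.2 0), ?_⟩) ?_
  · exact le_inf (amvNhd_anti p f τ (le_max_left _ _) (le_max_left _ _))
      (amvNhd_anti p f τ (le_max_right _ _) (le_max_right _ _))
  · rintro _ ⟨x, hx, y, hy, rfl⟩
    exact amvNhd_anti p f τ le_rfl (by dsimp; omega) (amvNhd_mul p f τ hx hy)
  · rintro x ⟨n, k⟩
    obtain ⟨l, hl⟩ := exists_mem_amvNhd p f τ n x
    refine ⟨(n, k - l), fun y hy => ?_⟩
    have := amvNhd_mul p f τ hl hy
    simpa using this

instance : TopologicalSpace (Amv p f τ) := (amvNhd_basis p f τ).topology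
instance : IsTopologicalRing (Amv p f τ) :=
  (amvNhd_basis p f τ).toRingFilterBasis.isTopologicalRing

end Coeff

/-! ## Extension of endomorphisms by continuity -/

section Ext

variable {R Λ B : Type*} [CommRing R] [CommRing Λ] [CommRing B] [Algebra R Λ] [Algebra R B]
  [TopologicalSpace B]

/-- `g` is a continuous endomorphism of `B` that extends the endomorphism `ψ` of `Λ` along
`j : Λ → B`. -/
def IsContExt (j : Λ →ₐ[R] B) (ψ : Λ →ₐ[R] Λ) (g : B →ₐ[R] B) : Prop :=
  Continuous g ∧ g.comp j = j.comp ψ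

open Classical in
/-- The continuous extension of the endomorphism `ψ` of `Λ` to `B` (the identity if there is none).
-/
def contExt (j : Λ →ₐ[R] B) (ψ : Λ →ₐ[R] Λ) : B →ₐ[R] B :=
  if h : ∃ g, IsContExt j ψ g then h.choose else AlgHom.id R B

end Ext

section Act

variable (p f : ℕ) {G R : Type*} [CommRing G] [CommRing R] (τ : G →+* R)

/-- The continuous endomorphism of `A_mv` induced by multiplication by `c` on `G`: this is `φ_q` for
`c = q`, and the action of `c` for `c` a unit. -/
def actMv (c : G) : Amv p f τ →ₐ[R] Amv p f τ := contExt (toAmv p f τ) (scale p G R c)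

/-- The endomorphism `φ_q` of `A_mv`, induced by multiplication by `q = p^f`. -/
def phiq : Amv p f τ →ₐ[R] Amv p f τ := actMv p f τ ((p : G) ^ f)

/-! ## The colimit of `A_mv` along `φ_q` and its metric -/

/-- The transition map from the `i`-th to the `j`-th copy of `A_mv`. -/
def colimMap (i j : ℕ) (_ : i ≤ j) : Amv p f τ →ₐ[R] Amv p f τ := phiq p f τ ^ (j - i)

instance : DirectedSystem (fun _ : ℕ => Amv p f τ) (colimMap p f τ · · ·) where
  map_self i x := by simp [colimMap]
  map_map k j i hij hjk x := by
    simp only [colimMap]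
    rw [← AlgHom.mul_apply, ← pow_add]
    congr 2
    omega

/-- The colimit of `A_mv → A_mv → ⋯` with all the transition maps equal to `φ_q`. -/
def Colim : Type _ := DirectLimit (fun _ : ℕ => Amv p f τ) (colimMap p f τ)

instance : CommRing (Colim p f τ) :=
  inferInstanceAs (CommRing (DirectLimit (fun _ : ℕ => Amv p f τ) (colimMap p f τ)))
instance : Algebra R (Colim p f τ) :=
  inferInstanceAs (Algebra R (DirectLimit (fun _ : ℕ => Amv p f τ) (colimMap p f τ)))

/-- The map of the `N`-th copy of `A_mv` to the colimit. -/
def toColim (N : ℕ) : Amv p f τ →ₐ[R] Colim p f τ :=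
  DirectLimit.Algebra.of (fun _ : ℕ => Amv p f τ) (colimMap p f τ) N

/-- The semi-valuation `w_n` of the image in the colimit of an element `P` of the `N`-th copy of
`A_mv`: the lower limit of `v_n (φ_q^m P) / q^(m + N)` for `m → ∞`. -/
def wLevel (n N : ℕ) (P : Amv p f τ) : EReal :=
  Filter.liminf (fun m : ℕ => vmv p f τ n ((phiq p f τ ^ m) P) / (((p ^ f : ℝ) ^ (m + N) : ℝ) : EReal))
    Filter.atTop

theorem wLevel_map (n i j : ℕ) (h : i ≤ j) (P : Amv p f τ) :
    wLevel p f τ n i P = wLevel p f τ n j (colimMap p f τ i j h P) := by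
  unfold wLevel colimMap
  rw [← Filter.liminf_nat_add _ (j - i)]
  congr 1
  ext m
  rw [← AlgHom.mul_apply, ← pow_add]
  congr 3
  omega

/-- The semi-valuation `w_n` on the colimit. -/
def w (n : ℕ) (x : Colim p f τ) : EReal :=
  DirectLimit.lift (colimMap p f τ) (fun N P => wLevel p f τ n N P)
    (fun i j h P => wLevel_map p f τ n i j h P) x

/-- `p^(-w) / (1 + p^(-w))`, extended by continuity to `w = ±∞`. -/
def gauge (a : EReal) : ℝ :=
  if a = ⊤ then 0 else if a = ⊥ then 1 else
    (p : ℝ) ^ (-a.toReal) / (1 + (p : ℝ) ^ (-a.toReal))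

/-- The distance `d(x, y) = ∑_{n ≥ 1} 2^(-n) p^(-w_n (x - y)) / (1 + p^(-w_n (x - y)))`. -/
def colimDist (x y : Colim p f τ) : ℝ :=
  ∑' n : ℕ, (1 / 2 : ℝ) ^ (n + 1) * gauge p (w p f τ (n + 1) (x - y))

theorem gauge_nonneg (a : EReal) : 0 ≤ gauge p a := by
  unfold gauge; split_ifs <;> positivity

theorem gauge_le_one (a : EReal) : gauge p a ≤ 1 := by
  unfold gauge; split_ifs
  · norm_num
  · norm_num
  · rw [div_le_one (by positivity)]
    linarith

theorem gauge_anti [Fact p.Prime] {a b : EReal} (h : a ≤ b) : gauge p b ≤ gauge p a := by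
  by_cases hb : b = ⊤
  · subst hb; simpa [gauge] using gauge_nonneg p a
  by_cases ha : a = ⊥
  · subst ha; simpa [gauge] using gauge_le_one p b
  have hb' : b ≠ ⊥ := fun h' => ha (by simpa [h'] using h)
  have ha' : a ≠ ⊤ := fun h' => hb (by simpa [h'] using h)
  simp only [gauge, if_neg hb, if_neg ha, if_neg hb', if_neg ha']
  have h1 : (1 : ℝ) ≤ p := by exact_mod_cast (Fact.out : p.Prime).one_le
  have h2 : (p : ℝ) ^ (-b.toReal) ≤ (p : ℝ) ^ (-a.toReal) :=
    Real.rpow_le_rpow_of_exponent_le h1 (neg_le_neg (EReal.toReal_le_toReal h ha hb))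
  have h3 : (0 : ℝ) ≤ (p : ℝ) ^ (-b.toReal) := by positivity
  rw [div_le_div_iff₀ (by positivity) (by positivity)]
  nlinarith

theorem vmv_add (n : ℕ) (P Q : Amv p f τ) :
    min (vmv p f τ n P) (vmv p f τ n Q) ≤ vmv p f τ n (P + Q) := by
  refine le_of_forall_lt fun c hc => ?_
  obtain ⟨h1, h2⟩ := lt_min_iff.1 hc
  unfold vmv at h1 h2
  simp only [lt_iSup_iff] at h1 h2
  obtain ⟨k, hk, hck⟩ := h1
  obtain ⟨l, hl, hcl⟩ := h2
  have hm : P + Q ∈ amvNhd p f τ n (min k l) :=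
    add_mem (amvNhd_anti p f τ le_rfl (min_le_left k l) hk)
      (amvNhd_anti p f τ le_rfl (min_le_right k l) hl)
  refine lt_of_lt_of_le ?_ (le_iSup₂_of_le (min k l) hm le_rfl)
  rcases min_choice k l with h | h <;> rw [h] <;> assumption

theorem vmv_neg (n : ℕ) (P : Amv p f τ) : vmv p f τ n (-P) = vmv p f τ n P := by
  simp [vmv]

theorem vmv_zero (n : ℕ) : vmv p f τ n 0 = ⊤ := by
  refine EReal.eq_top_iff_forall_lt _ |>.2 fun y => ?_
  obtain ⟨k, hk⟩ := exists_int_gt y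
  refine lt_of_lt_of_le ?_ (le_iSup₂_of_le k (zero_mem _) le_rfl)
  exact_mod_cast hk

theorem w_zero [Fact p.Prime] (n : ℕ) : w p f τ n 0 = ⊤ := by
  rw [← map_zero (toColim p f τ 0)]
  change wLevel p f τ n 0 0 = ⊤
  have hp : (0 : ℝ) < p := by exact_mod_cast (Fact.out : p.Prime).pos
  have : ∀ m : ℕ, (⊤ : EReal) / (((p ^ f : ℝ) ^ (m + 0) : ℝ) : EReal) = ⊤ := fun m =>
    EReal.top_div_of_pos_ne_top (EReal.coe_pos.2 (by positivity)) (EReal.coe_ne_top _)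
  simp only [wLevel, map_zero, vmv_zero, this]
  simp

theorem w_neg (n : ℕ) (x : Colim p f τ) : w p f τ n (-x) = w p f τ n x := by
  induction x using DirectLimit.induction with
  | ih N P =>
    change w p f τ n (-toColim p f τ N P) = wLevel p f τ n N P
    rw [← map_neg]
    change wLevel p f τ n N (-P) = _
    simp [wLevel, vmv_neg]

theorem w_add [Fact p.Prime] (n : ℕ) (x y : Colim p f τ) :
    min (w p f τ n x) (w p f τ n y) ≤ w p f τ n (x + y) := by
  induction x, y using DirectLimit.induction₂ with
  | ih N P Q =>
    change min (wLevel p f τ n N P) (wLevel p f τ n N Q) ≤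
      w p f τ n (toColim p f τ N P + toColim p f τ N Q)
    rw [← map_add]
    change _ ≤ wLevel p f τ n N (P + Q)
    have hp : (0 : ℝ) < p := by exact_mod_cast (Fact.out : p.Prime).pos
    refine le_of_forall_lt fun c hc => ?_
    obtain ⟨c', hcc', hc'⟩ := exists_between hc
    obtain ⟨h1, h2⟩ := lt_min_iff.1 hc'
    refine hcc'.trans_le (Filter.le_liminf_of_le (by isBoundedDefault) ?_)
    filter_upwards [Filter.eventually_lt_of_lt_liminf h1, Filter.eventually_lt_of_lt_liminf h2]
      with m hm1 hm2
    have hpos : (0 : EReal) ≤ (((p ^ f : ℝ) ^ (m + N) : ℝ) : EReal) :=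
      EReal.coe_nonneg.2 (by positivity)
    refine (lt_min hm1 hm2).le.trans ?_
    rw [← (EReal.monotone_div_right_of_nonneg hpos).map_min]
    refine EReal.monotone_div_right_of_nonneg hpos ?_
    rw [map_add]
    exact vmv_add ..

theorem colimDist_summable (x : Colim p f τ) :
    Summable fun n : ℕ => (1 / 2 : ℝ) ^ (n + 1) * gauge p (w p f τ (n + 1) x) := by
  refine Summable.of_nonneg_of_le (fun n => mul_nonneg (by positivity) (gauge_nonneg p _))
    (fun n => mul_le_of_le_one_right (by positivity) (gauge_le_one p _)) ?_
  exact (summable_nat_add_iff 1).2 (summable_geometric_of_lt_one (by norm_num) (by norm_num))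

theorem colimDist_add [Fact p.Prime] (x y : Colim p f τ) :
    colimDist p f τ (x + y) 0 ≤ colimDist p f τ x 0 + colimDist p f τ y 0 := by
  unfold colimDist
  simp only [sub_zero]
  rw [← (colimDist_summable p f τ x).tsum_add (colimDist_summable p f τ y)]
  refine (colimDist_summable p f τ (x + y)).tsum_le_tsum (fun n => ?_)
    ((colimDist_summable p f τ x).add (colimDist_summable p f τ y))
  rw [← mul_add]
  refine mul_le_mul_of_nonneg_left ?_ (by positivity)
  refine (gauge_anti p (w_add p f τ (n + 1) x y)).trans ?_
  rcases min_choice (w p f τ (n + 1) x) (w p f τ (n + 1) y) with h | h <;> rw [h]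
  · linarith [gauge_nonneg p (w p f τ (n + 1) y)]
  · linarith [gauge_nonneg p (w p f τ (n + 1) x)]

theorem colimDist_eq (x y : Colim p f τ) : colimDist p f τ x y = colimDist p f τ (x - y) 0 := by
  simp [colimDist]

instance [Fact p.Prime] : PseudoMetricSpace (Colim p f τ) where
  dist := colimDist p f τ
  dist_self x := by simp [colimDist, w_zero, gauge]
  dist_comm x y := by
    unfold colimDist
    simp only [← neg_sub x y, w_neg]
  dist_triangle x y z := by
    rw [colimDist_eq p f τ x z, colimDist_eq p f τ x y, colimDist_eq p f τ y z,
      ← sub_add_sub_cancel x y z]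
    exact colimDist_add ..

instance [Fact p.Prime] : IsUniformAddGroup (Colim p f τ) := by
  have hneg : ∀ x y : Colim p f τ, dist (-x) (-y) = dist x y := by
    intro x y
    change colimDist p f τ (-x) (-y) = colimDist p f τ x y
    unfold colimDist
    have : ∀ n, w p f τ n (-x - -y) = w p f τ n (x - y) := fun n => by
      rw [← w_neg p f τ n (x - y)]
      congr 1
      ring
    simp only [this]
  have hadd : ∀ x y x' y' : Colim p f τ, dist (x + y) (x' + y') ≤ dist x x' + dist y y' := by
    intro x y x' y'
    change colimDist p f τ _ _ ≤ colimDist p f τ _ _ + colimDist p f τ _ _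
    rw [colimDist_eq p f τ (x + y), colimDist_eq p f τ x, colimDist_eq p f τ y,
      add_sub_add_comm]
    exact colimDist_add ..
  refine IsUniformAddGroup.mk' ?_ ?_
  · refine Metric.uniformContinuous_iff.2 fun ε hε => ⟨ε / 2, by positivity, fun {a b} hab => ?_⟩
    rw [Prod.dist_eq] at hab
    refine (hadd _ _ _ _).trans_lt ?_
    have h1 := (le_max_left (dist a.1 b.1) (dist a.2 b.2)).trans_lt hab
    have h2 := (le_max_right (dist a.1 b.1) (dist a.2 b.2)).trans_lt hab
    linarith
  · exact Metric.uniformContinuous_iff.2 fun ε hε => ⟨ε, hε, fun {a b} hab => by rwa [hneg]⟩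

instance [Fact p.Prime] [IsTopologicalRing (Colim p f τ)] :
    UniformContinuousConstSMul R (Colim p f τ) where
  uniformContinuous_const_smul r := by
    have h : Continuous (AddMonoidHom.mulLeft (algebraMap R (Colim p f τ) r)) :=
      continuous_const_mul (algebraMap R (Colim p f τ) r)
    have h2 := uniformContinuous_addMonoidHom_of_continuous h
    simpa [Algebra.smul_def] using h2

end Act

/-! ## The ring `A_∞` -/

section Perfect

variable (p : ℕ) [Fact p.Prime] (R B : Type*) [CommRing R] [CharP R p] [CommRing B] [Algebra R B]

/-- The Frobenius endomorphism of an algebra over a ring of characteristic `p`. -/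
def frobHom : B →+* B where
  toFun x := x ^ p
  map_one' := one_pow p
  map_mul' x y := mul_pow x y p
  map_zero' := zero_pow (Fact.out : p.Prime).ne_zero
  map_add' x y := by
    have hp : (p : B) = 0 := by
      rw [← map_natCast (algebraMap R B), CharP.cast_eq_zero, map_zero]
    obtain ⟨r, hr⟩ := exists_add_pow_prime_eq (Fact.out : p.Prime) x y
    rw [hr, hp]
    ring

end Perfect

section AInf

variable (p : ℕ) [Fact p.Prime] (f : ℕ) {G F : Type*} [CommRing G] [CommRing F] [CharP F p]
  (τ : G →+* F)

/-- The transition map from the `i`-th to the `j`-th copy of `A`. -/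
def perfMap (i j : ℕ) (_ : i ≤ j) : Hat p f τ →+* Hat p f τ := frobHom p F (Hat p f τ) ^ (j - i)

theorem perfMap_apply (i j : ℕ) (h : i ≤ j) (x : Hat p f τ) :
    perfMap p f τ i j h x = x ^ p ^ (j - i) := by
  unfold perfMap
  generalize j - i = n
  induction n with
  | zero => simp
  | succ n ih =>
    rw [pow_succ', RingHom.mul_def, RingHom.comp_apply, ih, pow_succ, pow_mul]
    rfl

instance : DirectedSystem (fun _ : ℕ => Hat p f τ) (perfMap p f τ · · ·) where
  map_self i x := by simp [perfMap]
  map_map k j i hij hjk x := by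
    simp only [perfMap_apply]
    rw [← pow_mul, ← pow_add]
    congr 2
    omega

/-- The perfection of the ring `A = Hat`, as the colimit of `A → A → ⋯` along the Frobenius; the
element `x` of the `N`-th copy is `x^(1/p^N)`. -/
def Perf : Type _ := DirectLimit (fun _ : ℕ => Hat p f τ) (perfMap p f τ)

instance : CommRing (Perf p f τ) :=
  inferInstanceAs (CommRing (DirectLimit (fun _ : ℕ => Hat p f τ) (perfMap p f τ)))

/-- The map `x ↦ x^(1/p^N)` from `A` to its perfection. -/
def toPerf (N : ℕ) : Hat p f τ →+* Perf p f τ :=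
  DirectLimit.Ring.of (fun _ : ℕ => Hat p f τ) (perfMap p f τ) N

theorem toPerf_pow (N M : ℕ) (x : Hat p f τ) :
    toPerf p f τ (N + M) (x ^ p ^ M) = toPerf p f τ N x := by
  have := DirectLimit.Ring.of_f (f := perfMap p f τ) (Nat.le_add_right N M) x
  rw [perfMap_apply, Nat.add_sub_cancel_left] at this
  exact this

/-- The elements of valuation at least `m` in the perfection: the `x^(1/p^N)` with `x` of valuation
at least `p^N m`. -/
def perfFil (m : ℤ) : AddSubgroup (Perf p f τ) where
  carrier := {y | ∃ (N : ℕ) (x : Hat p f τ), x ∈ hatFil p f τ (p ^ N * m) ∧ y = toPerf p f τ N x}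
  zero_mem' := ⟨0, 0, zero_mem _, by simp⟩
  neg_mem' := by
    rintro _ ⟨N, x, hx, rfl⟩
    exact ⟨N, -x, neg_mem hx, by simp⟩
  add_mem' := by
    rintro _ _ ⟨N, x, hx, rfl⟩ ⟨M, y, hy, rfl⟩
    refine ⟨N + M, x ^ p ^ M + y ^ p ^ N, add_mem ?_ ?_, ?_⟩
    · have := (hatFil_isRingFil p f τ).pow_mem hx (p ^ M)
      convert this using 2
      push_cast; ring
    · have := (hatFil_isRingFil p f τ).pow_mem hy (p ^ N)
      convert this using 2
      push_cast; ring
    · rw [map_add, toPerf_pow, add_comm N M, toPerf_pow]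

theorem perfFil_isRingFil : IsRingFil (perfFil p f τ) where
  anti := by
    rintro m n h _ ⟨N, x, hx, rfl⟩
    exact ⟨N, x, (hatFil_isRingFil p f τ).anti (by gcongr) hx, rfl⟩
  one_mem := ⟨0, 1, by simpa using (hatFil_isRingFil p f τ).one_mem, by simp⟩
  mul_mem := by
    rintro m n _ _ ⟨N, x, hx, rfl⟩ ⟨M, y, hy, rfl⟩
    refine ⟨N + M, x ^ p ^ M * y ^ p ^ N, ?_, ?_⟩
    · have := (hatFil_isRingFil p f τ).mul_mem ((hatFil_isRingFil p f τ).pow_mem hx (p ^ M))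
        ((hatFil_isRingFil p f τ).pow_mem hy (p ^ N))
      convert this using 2
      push_cast; ring
    · rw [map_mul, toPerf_pow, add_comm N M, toPerf_pow]
  exists_mem := by
    intro y
    obtain ⟨N, x, rfl⟩ := DirectLimit.exists_eq_mk (perfMap p f τ) y
    obtain ⟨l, hl⟩ := (hatFil_isRingFil p f τ).exists_mem x
    refine ⟨-|l|, N, x, (hatFil_isRingFil p f τ).anti ?_ hl, rfl⟩
    have h1 : (1 : ℤ) ≤ (p : ℤ) ^ N := by
      exact_mod_cast Nat.one_le_pow _ _ (Fact.out : p.Prime).pos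
    have h2 := neg_abs_le l
    have h3 := abs_nonneg l
    nlinarith

instance : TopologicalSpace (Perf p f τ) := (perfFil_isRingFil p f τ).basis.topology
instance : IsTopologicalRing (Perf p f τ) :=
  (perfFil_isRingFil p f τ).basis.toRingFilterBasis.isTopologicalRing
instance : UniformSpace (Perf p f τ) := IsTopologicalAddGroup.rightUniformSpace _
instance : IsUniformAddGroup (Perf p f τ) := isUniformAddGroup_of_addCommGroup

/-- `A_∞ = F((T_0^(p^(-∞))))⟨(T_i/T_0)^(± p^(-∞))⟩`: the completion of the perfection of
`A = F((T_0))⟨(T_i/T_0)^(± 1)⟩`. -/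
def Ainf : Type _ := UniformSpace.Completion (Perf p f τ)

instance : CommRing (Ainf p f τ) :=
  inferInstanceAs (CommRing (UniformSpace.Completion (Perf p f τ)))
instance : TopologicalSpace (Ainf p f τ) :=
  inferInstanceAs (TopologicalSpace (UniformSpace.Completion (Perf p f τ)))

/-- The natural map `A → A_∞`. -/
def hatToAinf : Hat p f τ →+* Ainf p f τ :=
  (UniformSpace.Completion.coeRingHom (α := Perf p f τ)).comp (toPerf p f τ 0)

instance : Algebra F (Ainf p f τ) :=
  ((hatToAinf p f τ).comp (algebraMap F (Hat p f τ))).toAlgebra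

/-- The natural map from the Iwasawa algebra `F⟦G⟧` to `A_∞`. -/
def toAinf : iwasawa p G F →ₐ[F] Ainf p f τ :=
  { (hatToAinf p f τ).comp (toHat p f τ).toRingHom with
    commutes' := fun r => congrArg (hatToAinf p f τ) ((toHat p f τ).commutes r) }

/-- The continuous endomorphism of `A_∞` induced by multiplication by `c` on `G`: this is `φ_q` for
`c = q`, and the action of `c` for `c` a unit. -/
def actInf (c : G) : Ainf p f τ →ₐ[F] Ainf p f τ := contExt (toAinf p f τ) (scale p G F c)

/-! ## Witt vectors of `A_∞` -/

instance : Algebra (WittVector p F) (WittVector p (Ainf p f τ)) :=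
  (WittVector.map (algebraMap F (Ainf p f τ))).toAlgebra

/-- The endomorphism `∑ [x_i] p^i ↦ ∑ [c(x_i)] p^i` of `W(A_∞)`. -/
def actW (c : G) : WittVector p (Ainf p f τ) →ₐ[WittVector p F] WittVector p (Ainf p f τ) :=
  { WittVector.map (actInf p f τ c).toRingHom with
    commutes' := fun r => by
      ext n
      change (actInf p f τ c) (algebraMap F (Ainf p f τ) (r.coeff n)) = _
      exact (actInf p f τ c).commutes _ }

end AInf

end MvIwasawa
end

open MvIwasawa ValuativeRel TensorProduct UniformSpace

/-!
Write `G` for the additive group `𝒪_K`, `Λ_F` and `Λ_W` for its Iwasawa algebras over `F` and over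
`W(F)`, and `I` for the ideal of the variables `T_i`. The completions are taken
for filtrations derived from the powers of `I`. The theorem holds because `W(A_∞)`, with its weak
topology, is complete and contains a dense copy of the colimit whose induced topology is the one
defined by the distance.

*The graded rings.* Modulo the square of the augmentation ideal, `g ↦ [g] - 1` is additive, so the
orthogonality of the characters of the roots of unity and Nakayama's lemma show that the `T_i`
generate the augmentation ideals of the group rings `F[G / p ^ n]`. Counting monomials, every
element of `Λ_F` has a unique expansion as a power series in the `T_i`. Hence the `T_i` are regular
on the graded ring of `Λ_F` (`IsUnramified.mem_of_T_mul_mem`), which is moreover reduced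
(`IsUnramified.mem_of_pow_mem`). Lifting along `Λ_W → Λ_F`, whose kernel is generated by `p`, the
quotients `Λ_W / I ^ a` are `p`-torsion free (`IsCoeffRing.mem_of_p_mul_mem`) and the `T_i` are
regular on the graded ring of `Λ_W`. Therefore the filtration of a fraction `Q / (∏ T_i) ^ k` can be
read off `Q` (`mem_locFil_iff`), the reduction from the completed localization over `W(F)` to `A` is
surjective with kernel generated by `p`, without any loss of valuation
(`IsCoeffRing.exists_redHat_eq`, `IsCoeffRing.exists_eq_p_mul_of_redHat`), and `A` embeds in the
perfect ring `A_∞` with the induced valuation (`IsUnramified.hatToAinf_mem`).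

*The embedding of `A_mv`.* Sending group elements to their Teichmüller representatives defines a
ring homomorphism from `Λ_W` to `W(Λ_F)`, and from there to `W(A_∞)`. The image of `T_i` is
`[T_i] + p y` with `y` integral, hence a unit. For the filtration of `W(A_∞) / p ^ n` in which `p`
counts as having the valuation of `T_i` this unit has valuation exactly one
(`IsPerfFil.exists_inv_of_coeff_zero`), and this filtration differs from the natural one by at most
`n` (`IsPerfFil.zFil_le_wFil`). So the homomorphism extends to `j : A_mv → W(A_∞)`, which lowers the
valuation at level `n` by a bounded amount (`IsAmvLift.mem`). Since `j` lifts the strict embedding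
of `A` in `A_∞`, induction on `n` gives a bound in the other direction
(`IsAmvLift.exists_mem_amvNhd`), and successive division by `p` shows that `j` is injective and has
closed range (`IsAmvLift.isClosed_range`). As the Teichmüller map commutes with the multiplications
on `G`, the endomorphisms of `W(A_∞)` that they induce preserve this closed range, which yields the
endomorphisms of `A_mv` (`IsAmvLift.exists_act`).

*The colimit.* Over the finite field `F`, a power of `φ_q` is a power of the Frobenius of `A_∞`
(`IsUnramified.exists_actInf_pow`). Consequently `φ_q` is bijective on `A_∞` and multiplies
valuations by exactly `q`, and the elements `φ_q ^ (-N) a` with `a ∈ A` are dense in `A_∞`. The map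
that sends the class of `P` in the `N`-th copy of `A_mv` to `φ_q ^ (-N) (j P)` is an injection of the
colimit in `W(A_∞)`, with dense range. The bounded errors in the comparison of valuations along `j`
become negligible after division by `q ^ m`, so the semi-valuations `w_n` of the colimit agree with
those of `W(A_∞)` up to `1` (`IsPhiLift.mem_of_lt_w`, `IsPhiLift.le_w_of_mem`). Thus the distance
induces the topology of `W(A_∞)`, and the completion of the colimit is `W(A_∞)`. The base change is
injective because `𝒪_E` is torsion free, hence flat, over the discrete valuation ring `W(F)`.
-/

noncomputable section

namespace MvIwasawa

set_option linter.unusedSectionVars false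

/-! ### The coefficient ring `G` and its roots of unity -/

/-- The properties of the ring of integers `G` of an unramified extension of `ℚ_p` of degree `f`
on which the structure of its Iwasawa algebra depends: the quotients by `p ^ n` have `p ^ (n f)`
elements, `p` generates a maximal ideal, and the nonzero residue classes have Teichmüller
representatives. -/
structure IsUnramified (p f : ℕ) (G : Type*) [CommRing G] : Prop where
  pos : 0 < f
  card_quot : ∀ n, Nat.card (G ⧸ Ideal.span {(p : G) ^ n}) = p ^ (n * f)
  isMaximal : (Ideal.span {(p : G)}).IsMaximal
  exists_root : ∀ g : G, g ∉ Ideal.span {(p : G)} →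
    ∃ ζ : rootsOfUnity (p ^ f - 1) G, ((ζ : Gˣ) : G) - g ∈ Ideal.span {(p : G)}

section Roots

variable {p f : ℕ} [hp : Fact p.Prime] {G : Type*} [CommRing G] [IsDomain G]

theorem IsUnramified.two_le (hG : IsUnramified p f G) : 2 ≤ p ^ f :=
  hp.out.two_le.trans (Nat.le_self_pow hG.pos.ne' p)

theorem IsUnramified.neZero (hG : IsUnramified p f G) : NeZero (p ^ f - 1) :=
  ⟨by have := hG.two_le; omega⟩

theorem IsUnramified.finite_rootsOfUnity (hG : IsUnramified p f G) :
    Finite (rootsOfUnity (p ^ f - 1) G) := by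
  have := hG.neZero
  infer_instance

/-- Reduction modulo `p` identifies the `(q - 1)`-st roots of unity with the units of the residue
field. -/
theorem IsUnramified.card_roots_and_injective (hG : IsUnramified p f G) :
    Nat.card (rootsOfUnity (p ^ f - 1) G) = p ^ f - 1 ∧
      ∀ ζ : rootsOfUnity (p ^ f - 1) G, ((ζ : Gˣ) : G) - 1 ∈ Ideal.span {(p : G)} → ζ = 1 := by
  have := hG.neZero
  have := hG.finite_rootsOfUnity
  have := hG.isMaximal
  let κ := G ⧸ Ideal.span {(p : G)}
  let _ : Field κ := Ideal.Quotient.field _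
  have hcard : Nat.card κ = p ^ f := by
    have := hG.card_quot 1
    rwa [pow_one, one_mul] at this
  have : Finite κ := Nat.finite_of_card_ne_zero (by rw [hcard]; have := hG.two_le; omega)
  let r : rootsOfUnity (p ^ f - 1) G →* κˣ :=
    (Units.map (Ideal.Quotient.mk (Ideal.span {(p : G)})).toMonoidHom).comp
      (rootsOfUnity (p ^ f - 1) G).subtype
  have hr : Function.Surjective r := by
    intro u
    obtain ⟨g, hg⟩ := Ideal.Quotient.mk_surjective (u : κ)
    have hg' : g ∉ Ideal.span {(p : G)} := by
      rw [← Ideal.Quotient.eq_zero_iff_mem, hg]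
      exact u.ne_zero
    obtain ⟨ζ, hζ⟩ := hG.exists_root g hg'
    refine ⟨ζ, Units.ext ?_⟩
    rw [← hg]
    exact (Ideal.Quotient.mk_eq_mk_iff_sub_mem _ _).2 hζ
  have hu : Nat.card κˣ = p ^ f - 1 := by rw [Nat.card_units, hcard]
  have h1 : Nat.card κˣ ≤ Nat.card (rootsOfUnity (p ^ f - 1) G) :=
    Nat.card_le_card_of_surjective r hr
  have h2 : Nat.card (rootsOfUnity (p ^ f - 1) G) = p ^ f - 1 :=
    le_antisymm (card_rootsOfUnity G _) (hu ▸ h1)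
  refine ⟨h2, fun ζ hζ => ?_⟩
  have hinj : Function.Injective r :=
    ((Nat.bijective_iff_surjective_and_card r).2 ⟨hr, h2.trans hu.symm⟩).1
  refine hinj (Units.ext ?_)
  rw [map_one]
  exact (Ideal.Quotient.mk_eq_mk_iff_sub_mem _ _).2 hζ

theorem IsUnramified.card_roots (hG : IsUnramified p f G) :
    Nat.card (rootsOfUnity (p ^ f - 1) G) = p ^ f - 1 := hG.card_roots_and_injective.1

theorem IsUnramified.dvd_of_pow_eq_one (hG : IsUnramified p f G) {k : ℕ}
    (h : ∀ ζ : rootsOfUnity (p ^ f - 1) G, ζ ^ k = 1) : p ^ f - 1 ∣ k := by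
  have := hG.neZero
  have := hG.finite_rootsOfUnity
  obtain ⟨g, hg⟩ := IsCyclic.exists_generator (α := rootsOfUnity (p ^ f - 1) G)
  have := orderOf_eq_card_of_forall_mem_zpowers hg
  rw [← hG.card_roots, ← this]
  exact orderOf_dvd_of_pow_eq_one (h g)

theorem natCast_eq_zero_of_mem {F : Type*} [CommRing F] [CharP F p] (τ : G →+* F) {g : G}
    (hg : g ∈ Ideal.span {(p : G)}) : τ g = 0 := by
  obtain ⟨a, rfl⟩ := Ideal.mem_span_singleton'.1 hg
  simp

theorem IsUnramified.mem_span_of_map_eq_zero (hG : IsUnramified p f G) {F : Type*} [CommRing F]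
    [Nontrivial F] [CharP F p] (τ : G →+* F) {g : G} (hg : τ g = 0) :
    g ∈ Ideal.span {(p : G)} := by
  by_contra h
  obtain ⟨a, ha⟩ := Ideal.mem_span_singleton_sup.1 ((Ideal.eq_top_iff_one _).1
    (Ideal.isMaximal_def.1 hG.isMaximal |>.2 (Ideal.span {(p : G)} ⊔ Ideal.span {g})
      (lt_of_le_of_ne le_sup_left (fun e => h (e ▸ Ideal.mem_sup_right
        (Ideal.mem_span_singleton_self g))))))
  obtain ⟨b, hb, h1⟩ := ha
  obtain ⟨c, rfl⟩ := Ideal.mem_span_singleton'.1 hb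
  have := congrArg τ h1
  simp [hg] at this

/-- The trace of a residue class is represented by a natural number. -/
theorem IsUnramified.exists_trace (hG : IsUnramified p f G) (u : G) :
    ∃ n : ℕ, (n : G) - ∑ i : Fin f, u ^ p ^ (i : ℕ) ∈ Ideal.span {(p : G)} := by
  have := hG.isMaximal
  let κ := G ⧸ Ideal.span {(p : G)}
  let _ : Field κ := Ideal.Quotient.field _
  have hcard : Nat.card κ = p ^ f := by
    have := hG.card_quot 1
    rwa [pow_one, one_mul] at this
  have : Finite κ := Nat.finite_of_card_ne_zero (by rw [hcard]; have := hG.two_le; omega)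
  have : CharP κ p := by
    refine (CharP.charP_iff_prime_eq_zero hp.out).2 ?_
    have : ((p : G) : κ) = 0 := Ideal.Quotient.eq_zero_iff_mem.2 (Ideal.mem_span_singleton_self _)
    simpa using this
  let _ : Algebra (ZMod p) κ := ZMod.algebra κ p
  have hrank : Module.finrank (ZMod p) κ = f := by
    have h := Module.natCard_eq_pow_finrank (K := ZMod p) (V := κ)
    rw [hcard, Nat.card_zmod] at h
    exact (Nat.pow_right_injective hp.out.two_le h).symm
  have h := FiniteField.algebraMap_trace_eq_sum_pow (ZMod p) κ (Ideal.Quotient.mk _ u)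
  rw [hrank, Nat.card_zmod] at h
  refine ⟨(Algebra.trace (ZMod p) κ (Ideal.Quotient.mk _ u)).val, ?_⟩
  rw [← Ideal.Quotient.eq_zero_iff_mem, map_sub, sub_eq_zero, map_sum, map_natCast]
  simp only [map_pow]
  rw [Fin.sum_univ_eq_sum_range (fun i => (Ideal.Quotient.mk (Ideal.span {(p : G)})) u ^ p ^ i),
    ← h, ← map_natCast (algebraMap (ZMod p) κ), ZMod.natCast_zmod_val]

/-- Orthogonality of characters: `ζ ↦ ζ ^ (1 - p ^ i)` is not trivial for `0 < i < f`. -/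
theorem IsUnramified.sum_char_eq_zero (hG : IsUnramified p f G)
    [Fintype (rootsOfUnity (p ^ f - 1) G)] {i : ℕ} (hi0 : 0 < i) (hi : i < f) :
    ∑ ζ : rootsOfUnity (p ^ f - 1) G,
      (((ζ⁻¹ : rootsOfUnity (p ^ f - 1) G) : Gˣ) : G) ^ p ^ i * ((ζ : Gˣ) : G) = 0 := by
  let χ : rootsOfUnity (p ^ f - 1) G →* G :=
    { toFun := fun ζ => (((ζ⁻¹ : rootsOfUnity (p ^ f - 1) G) : Gˣ) : G) ^ p ^ i * ((ζ : Gˣ) : G)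
      map_one' := by simp
      map_mul' := fun x y => by simp only [mul_inv, Subgroup.coe_mul, Units.val_mul, mul_pow]; ring }
  refine sum_hom_units_eq_zero χ fun h => ?_
  have h2 : 1 ≤ p ^ i := Nat.one_le_pow _ _ hp.out.pos
  have h1 : p ^ f - 1 ∣ p ^ i - 1 := by
    refine hG.dvd_of_pow_eq_one fun ζ => ?_
    have h1 := DFunLike.congr_fun h ζ
    have h3 : (ζ⁻¹) ^ p ^ i * ζ = 1 := by
      refine Subtype.ext (Units.ext ?_)
      simpa [χ] using h1
    rw [inv_pow, inv_mul_eq_one] at h3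
    rw [← mul_left_inj ζ, ← pow_succ, Nat.sub_add_cancel h2, h3, one_mul]
  have h3 : p ^ i < p ^ f := Nat.pow_lt_pow_right hp.out.one_lt hi
  have h4 : 1 < p ^ i := Nat.one_lt_pow hi0.ne' hp.out.one_lt
  have := Nat.le_of_dvd (by omega) h1
  omega

/-- An additive map `δ` from `G` to an `F`-algebra that kills `p G` vanishes as soon as the `f`
sums `∑ τ(ζ) ^ (-p ^ i) δ(ζ)` vanish: by the trace form, `δ(ζ)` is a linear combination of them. -/
theorem IsUnramified.additive_eq_zero (hG : IsUnramified p f G)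
    [Fintype (rootsOfUnity (p ^ f - 1) G)] {F Q : Type*} [Field F] [CharP F p] (τ : G →+* F)
    [CommRing Q] [Algebra F Q] (δ : G →+ Q) (hδ : ∀ g, δ (p * g) = 0)
    (hT : ∀ i : Fin f, ∑ ζ : rootsOfUnity (p ^ f - 1) G,
      τ ((ζ⁻¹ : rootsOfUnity (p ^ f - 1) G) : Gˣ) ^ p ^ (i : ℕ) • δ ((ζ : Gˣ) : G) = 0) (g : G) :
    δ g = 0 := by
  have hδ' : ∀ {x y : G}, x - y ∈ Ideal.span {(p : G)} → δ x = δ y := by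
    intro x y h
    obtain ⟨a, ha⟩ := Ideal.mem_span_singleton'.1 h
    rw [← sub_eq_zero, ← map_sub, ← ha, mul_comm, hδ]
  -- `δ` only depends on classes modulo `p`, and every nonzero class is that of a root of unity `z`
  by_cases hg : g ∈ Ideal.span {(p : G)}
  · rw [hδ' (y := 0) (by simpa using hg), map_zero]
  obtain ⟨z, hz⟩ := hG.exists_root g hg
  rw [← hδ' hz]
  choose n hn using fun u : rootsOfUnity (p ^ f - 1) G => hG.exists_trace ((u : Gˣ) : G)
  -- the trace of `z ζ⁻¹` is `∑ z ^ (p ^ i) ζ ^ (-p ^ i)`, so that the sum of the `tr (z ζ⁻¹) δ(ζ)`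
  -- is a combination of the given sums
  have h1 : ∑ ζ : rootsOfUnity (p ^ f - 1) G, (n (z * ζ⁻¹) : F) • δ ((ζ : Gˣ) : G) = 0 := by
    have h2 : ∀ ζ : rootsOfUnity (p ^ f - 1) G, (n (z * ζ⁻¹) : F) = ∑ i : Fin f,
        τ ((z : Gˣ) : G) ^ p ^ (i : ℕ) *
          τ ((ζ⁻¹ : rootsOfUnity (p ^ f - 1) G) : Gˣ) ^ p ^ (i : ℕ) := by
      intro ζ
      have := natCast_eq_zero_of_mem τ (hn (z * ζ⁻¹))
      rw [map_sub, sub_eq_zero, map_natCast, map_sum] at this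
      rw [this]
      refine Finset.sum_congr rfl fun i _ => ?_
      rw [map_pow, ← mul_pow, ← map_mul]
      rfl
    simp only [h2, Finset.sum_smul]
    rw [Finset.sum_comm]
    refine Finset.sum_eq_zero fun i _ => ?_
    simp only [mul_smul]
    rw [← Finset.smul_sum, hT i, smul_zero]
  have h3 : δ (∑ ζ : rootsOfUnity (p ^ f - 1) G, (n (z * ζ⁻¹) : G) * ((ζ : Gˣ) : G)) = 0 := by
    rw [map_sum, ← h1]
    refine Finset.sum_congr rfl fun ζ _ => ?_
    rw [← nsmul_eq_mul, map_nsmul, Nat.cast_smul_eq_nsmul]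
  -- by orthogonality `∑ tr (z ζ⁻¹) ζ` is `(q - 1) z`, which is `-z` modulo `p`
  have h4 : ∑ ζ : rootsOfUnity (p ^ f - 1) G, (n (z * ζ⁻¹) : G) * ((ζ : Gˣ) : G) -
      (-((z : Gˣ) : G)) ∈ Ideal.span {(p : G)} := by
    have h5 : ∑ ζ : rootsOfUnity (p ^ f - 1) G, (n (z * ζ⁻¹) : G) * ((ζ : Gˣ) : G) -
        ∑ ζ : rootsOfUnity (p ^ f - 1) G,
          (∑ i : Fin f, (((z * ζ⁻¹ : rootsOfUnity (p ^ f - 1) G) : Gˣ) : G) ^ p ^ (i : ℕ)) *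
            ((ζ : Gˣ) : G) ∈ Ideal.span {(p : G)} := by
      rw [← Finset.sum_sub_distrib]
      refine Ideal.sum_mem _ fun ζ _ => ?_
      rw [← sub_mul]
      exact Ideal.mul_mem_right _ _ (hn _)
    have h6 : ∑ ζ : rootsOfUnity (p ^ f - 1) G,
          (∑ i : Fin f, (((z * ζ⁻¹ : rootsOfUnity (p ^ f - 1) G) : Gˣ) : G) ^ p ^ (i : ℕ)) *
            ((ζ : Gˣ) : G) = (p : G) ^ f * ((z : Gˣ) : G) - ((z : Gˣ) : G) := by
      simp only [Finset.sum_mul]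
      rw [Finset.sum_comm, Finset.sum_eq_single (⟨0, hG.pos⟩ : Fin f)]
      · have h7 : ∀ ζ : rootsOfUnity (p ^ f - 1) G,
            (((z * ζ⁻¹ : rootsOfUnity (p ^ f - 1) G) : Gˣ) : G) ^ p ^ 0 * ((ζ : Gˣ) : G) =
              ((z : Gˣ) : G) := by
          intro ζ
          simp [mul_assoc]
        simp only [h7, Finset.sum_const, Finset.card_univ]
        rw [← Nat.card_eq_fintype_card, hG.card_roots, nsmul_eq_mul,
          Nat.cast_sub (by have := hG.two_le; omega)]
        push_cast
        ring
      · intro i _ hi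
        have h8 : ∀ ζ : rootsOfUnity (p ^ f - 1) G,
            (((z * ζ⁻¹ : rootsOfUnity (p ^ f - 1) G) : Gˣ) : G) ^ p ^ (i : ℕ) * ((ζ : Gˣ) : G) =
              ((z : Gˣ) : G) ^ p ^ (i : ℕ) *
              ((((ζ⁻¹ : rootsOfUnity (p ^ f - 1) G) : Gˣ) : G) ^ p ^ (i : ℕ) * ((ζ : Gˣ) : G)) := by
          intro ζ
          rw [← mul_assoc, ← mul_pow]
          rfl
        simp only [h8, ← Finset.mul_sum]
        rw [hG.sum_char_eq_zero (Nat.pos_of_ne_zero fun h => hi (Fin.ext h)) i.2, mul_zero]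
      · simp
    rw [h6] at h5
    have h9 : (p : G) ^ f * ((z : Gˣ) : G) ∈ Ideal.span {(p : G)} :=
      Ideal.mul_mem_right _ _ (Ideal.pow_mem_of_mem _ (Ideal.mem_span_singleton_self _) _ hG.pos)
    have := add_mem h5 h9
    convert this using 1
    ring
  rw [hδ' h4, map_neg, neg_eq_zero] at h3
  exact h3

end Roots

/-! ### The variables at finite level in characteristic `p` -/

section Level

variable (p : ℕ) {f : ℕ} {G : Type*} [CommRing G] (R : Type*) [CommRing R]

/-- The projection of the Iwasawa algebra to the group ring of `G / p ^ n`. -/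
def lev (n : ℕ) : iwasawa p G R →ₐ[R] FinLevel p G R n :=
  (Pi.evalAlgHom R _ n).comp (iwasawa p G R).val

variable {R} in
theorem lev_apply (n : ℕ) (x : iwasawa p G R) : lev p R n x = x.1 n := rfl

variable {R} in
theorem iwasawa_ext {x y : iwasawa p G R} (h : ∀ n, lev p R n x = lev p R n y) : x = y :=
  Subtype.ext (funext h)

variable {R} in
theorem finLevelMap_lev (n : ℕ) (x : iwasawa p G R) :
    finLevelMap p G R n (lev p R (n + 1) x) = lev p R n x := x.2 n

/-- The group element of `G / p ^ n` attached to `g`. -/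
def levGrp (n : ℕ) (g : G) : FinLevel p G R n :=
  AddMonoidAlgebra.single (Ideal.Quotient.mk _ g) 1

theorem lev_grp (n : ℕ) (g : G) : lev p R n (grp p R g) = levGrp p R n g := rfl

theorem levGrp_add (n : ℕ) (g h : G) :
    levGrp p R n (g + h) = levGrp p R n g * levGrp p R n h := by
  simp [levGrp, AddMonoidAlgebra.single_mul_single]

theorem levGrp_zero (n : ℕ) : levGrp p R n (0 : G) = 1 := by
  simp [levGrp, AddMonoidAlgebra.one_def]

theorem levGrp_nsmul (n k : ℕ) (g : G) : levGrp p R n (k • g) = levGrp p R n g ^ k := by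
  induction k with
  | zero => simp [levGrp_zero]
  | succ k ih => rw [succ_nsmul, levGrp_add, ih, pow_succ]

theorem levGrp_pow_mul (n : ℕ) (g : G) : levGrp p R n ((p : G) ^ n * g) = 1 := by
  rw [← levGrp_zero p R n (G := G), levGrp, levGrp]
  congr 1
  rw [map_zero]
  exact Ideal.Quotient.eq_zero_iff_mem.2 (Ideal.mul_mem_right _ _ (Ideal.mem_span_singleton_self _))

theorem grp_add (g h : G) : grp p R (g + h) = grp p R g * grp p R h :=
  iwasawa_ext p fun n => by rw [map_mul, lev_grp, lev_grp, lev_grp, levGrp_add]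

theorem grp_nsmul (k : ℕ) (g : G) : grp p R (k • g) = grp p R g ^ k :=
  iwasawa_ext p fun n => by rw [map_pow, lev_grp, lev_grp, levGrp_nsmul]

end Level

section TFormula

variable {p f : ℕ} [hp : Fact p.Prime] {G : Type*} [CommRing G] [IsDomain G]
  {R : Type*} [CommRing R]

/-- A uniform expression of the variables: they lie in the augmentation ideal, because the sum of
the values of the character `ζ ↦ τ(ζ) ^ (-p ^ i)` vanishes unless `q = 2`. -/
theorem IsUnramified.T_eq (hG : IsUnramified p f G) [Fintype (rootsOfUnity (p ^ f - 1) G)]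
    [IsDomain R] (τ : G →+* R)
    (hτ : ∀ ζ : rootsOfUnity (p ^ f - 1) G, τ ((ζ : Gˣ) : G) = 1 → ζ = 1) (i : Fin f) :
    T p f τ i = ∑ ζ : rootsOfUnity (p ^ f - 1) G,
      τ ((ζ⁻¹ : rootsOfUnity (p ^ f - 1) G) : Gˣ) ^ p ^ (i : ℕ) •
        (grp p R ((ζ : Gˣ) : G) - 1) := by
  unfold T
  split_ifs with h
  · have h1 : ∀ ζ : rootsOfUnity (p ^ f - 1) G, ζ = 1 := by
      rintro ⟨ζ, hζ⟩
      have := (mem_rootsOfUnity _ _).1 hζ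
      rw [show p ^ f - 1 = 1 by omega, pow_one] at this
      exact Subtype.ext this
    rw [Fintype.sum_eq_single 1 (fun ζ hζ => absurd (h1 ζ) hζ)]
    simp
  · rw [finsum_eq_sum_of_fintype]
    simp only [smul_sub, Finset.sum_sub_distrib, ← Finset.sum_smul]
    have h0 : ∑ ζ : rootsOfUnity (p ^ f - 1) G,
        τ ((ζ⁻¹ : rootsOfUnity (p ^ f - 1) G) : Gˣ) ^ p ^ (i : ℕ) = 0 := by
      let χ : rootsOfUnity (p ^ f - 1) G →* R :=
        { toFun := fun ζ => τ ((ζ⁻¹ : rootsOfUnity (p ^ f - 1) G) : Gˣ) ^ p ^ (i : ℕ)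
          map_one' := by simp
          map_mul' := fun x y => by
            simp only [mul_inv, Subgroup.coe_mul, Units.val_mul, mul_pow, map_mul] }
      refine sum_hom_units_eq_zero χ fun h' => h ?_
      -- a trivial character would force `q - 1` to divide a power of `p`
      have h1 : p ^ f - 1 ∣ p ^ (i : ℕ) := by
        refine hG.dvd_of_pow_eq_one fun ζ => ?_
        refine hτ _ ?_
        have := DFunLike.congr_fun h' ζ⁻¹
        simpa [χ] using this
      have h2 : p ^ f - 1 ∣ p ^ f := h1.trans (pow_dvd_pow _ i.2.le)
      have h3 : p ^ f - 1 ∣ 1 := by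
        have := Nat.dvd_sub h2 (dvd_refl (p ^ f - 1))
        rwa [Nat.sub_sub_self (by have := hG.two_le; omega)] at this
      have := Nat.dvd_one.1 h3
      omega
    rw [h0, zero_smul, sub_zero]

end TFormula

section CharP

variable {p f : ℕ} [hp : Fact p.Prime] {G : Type*} [CommRing G] [IsDomain G]
  {F : Type*} [Field F] [CharP F p]

instance finLevel_expChar (n : ℕ) : ExpChar (FinLevel p G F n) p :=
  have : CharP (FinLevel p G F n) p :=
    charP_of_injective_algebraMap (algebraMap F (FinLevel p G F n)).injective p
  ExpChar.prime hp.out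

theorem IsUnramified.eq_one_of_map_eq_one (hG : IsUnramified p f G) (τ : G →+* F)
    (ζ : rootsOfUnity (p ^ f - 1) G) (h : τ ((ζ : Gˣ) : G) = 1) : ζ = 1 :=
  hG.card_roots_and_injective.2 ζ (hG.mem_span_of_map_eq_zero τ (by simp [h]))

theorem levGrp_sub_one_pow (n k : ℕ) (g : G) :
    (levGrp p F n g - 1) ^ p ^ k = levGrp p F n ((p : G) ^ k * g) - 1 := by
  rw [sub_pow_expChar_pow, one_pow, ← levGrp_nsmul, nsmul_eq_mul]
  push_cast
  rfl

/-- The variables satisfy `T_i ^ (p ^ n) = 0` in the group ring of `G / p ^ n`. -/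
theorem IsUnramified.lev_T_pow (hG : IsUnramified p f G) (τ : G →+* F) (n : ℕ) (i : Fin f) :
    lev p F n (T p f τ i) ^ p ^ n = 0 := by
  have := hG.finite_rootsOfUnity
  let _ := Fintype.ofFinite (rootsOfUnity (p ^ f - 1) G)
  rw [hG.T_eq τ (hG.eq_one_of_map_eq_one τ), map_sum, sum_pow_char_pow]
  refine Finset.sum_eq_zero fun ζ _ => ?_
  rw [map_smul, smul_pow, map_sub, map_one, lev_grp, levGrp_sub_one_pow, levGrp_pow_mul, sub_self,
    smul_zero]

theorem IsUnramified.finite_quot (hG : IsUnramified p f G) (n : ℕ) :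
    Finite (G ⧸ Ideal.span {(p : G) ^ n}) :=
  Nat.finite_of_card_ne_zero (by rw [hG.card_quot]; exact (pow_pos hp.out.pos _).ne')

variable (p G F) in
/-- The augmentation ideal at finite level. -/
def augLev (n : ℕ) : Ideal (FinLevel p G F n) :=
  Ideal.span (Set.range fun g : G => levGrp p F n g - 1)

theorem exists_sub_algebraMap_mem_augLev (n : ℕ) (x : FinLevel p G F n) :
    ∃ c : F, x - algebraMap F _ c ∈ augLev p G F n := by
  induction x using AddMonoidAlgebra.induction_linear with
  | zero => exact ⟨0, by simp⟩
  | add x y hx hy =>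
    obtain ⟨c, hc⟩ := hx
    obtain ⟨d, hd⟩ := hy
    refine ⟨c + d, ?_⟩
    rw [map_add, add_sub_add_comm]
    exact add_mem hc hd
  | single g r =>
    obtain ⟨g, rfl⟩ := Ideal.Quotient.mk_surjective g
    refine ⟨r, ?_⟩
    have : (AddMonoidAlgebra.single (Ideal.Quotient.mk _ g) r : FinLevel p G F n) =
        algebraMap F _ r * levGrp p F n g := by
      rw [← Algebra.smul_def, levGrp, AddMonoidAlgebra.smul_single, smul_eq_mul, mul_one]
    rw [this, ← mul_sub_one]
    exact Ideal.mul_mem_left _ _ (Ideal.subset_span ⟨g, rfl⟩)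

theorem IsUnramified.augLev_fg (hG : IsUnramified p f G) (n : ℕ) : (augLev p G F n).FG := by
  have := hG.finite_quot n
  have : (Set.range fun g : G => levGrp p F n g - 1) =
      Set.range fun g : G ⧸ Ideal.span {(p : G) ^ n} =>
        (AddMonoidAlgebra.single g 1 - 1 : FinLevel p G F n) := by
    ext x
    constructor
    · rintro ⟨g, rfl⟩; exact ⟨Ideal.Quotient.mk _ g, rfl⟩
    · rintro ⟨g, rfl⟩
      obtain ⟨g, rfl⟩ := Ideal.Quotient.mk_surjective g
      exact ⟨g, rfl⟩
  rw [augLev, this]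
  exact Submodule.fg_span (Set.finite_range _)

theorem augLev_le_nilradical (n : ℕ) : augLev p G F n ≤ nilradical (FinLevel p G F n) := by
  refine Ideal.span_le.2 ?_
  rintro _ ⟨g, rfl⟩
  refine mem_nilradical.2 ⟨p ^ n, ?_⟩
  change (levGrp p F n g - 1) ^ p ^ n = 0
  rw [levGrp_sub_one_pow, levGrp_pow_mul, sub_self]

theorem IsUnramified.lev_T_mem (hG : IsUnramified p f G) (τ : G →+* F) (n : ℕ) (i : Fin f) :
    lev p F n (T p f τ i) ∈ augLev p G F n := by
  have := hG.finite_rootsOfUnity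
  let _ := Fintype.ofFinite (rootsOfUnity (p ^ f - 1) G)
  rw [hG.T_eq τ (hG.eq_one_of_map_eq_one τ), map_sum]
  refine Ideal.sum_mem _ fun ζ _ => ?_
  rw [map_smul, map_sub, map_one, lev_grp, Algebra.smul_def]
  exact Ideal.mul_mem_left _ _ (Ideal.subset_span ⟨_, rfl⟩)

/-- The variables generate the augmentation ideal: modulo its square, `g ↦ [g] - 1` is additive and
kills `p G`, so that Nakayama's lemma applies. -/
theorem IsUnramified.augLev_eq (hG : IsUnramified p f G) (τ : G →+* F) (n : ℕ) :
    augLev p G F n = Ideal.span (Set.range fun i => lev p F n (T p f τ i)) := by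
  have := hG.finite_rootsOfUnity
  let _ := Fintype.ofFinite (rootsOfUnity (p ^ f - 1) G)
  set J := augLev p G F n with hJ
  set 𝔱 := Ideal.span (Set.range fun i => lev p F n (T p f τ i)) with ht
  have hE : ∀ g : G, levGrp p F n g - 1 ∈ J := fun g => Ideal.subset_span ⟨g, rfl⟩
  refine le_antisymm ?_ (Ideal.span_le.2 ?_)
  · refine Submodule.le_of_le_smul_of_le_jacobson_bot (I := J) (hG.augLev_fg n)
      ((augLev_le_nilradical n).trans (Ideal.radical_le_jacobson)) ?_
    rw [smul_eq_mul]
    -- `([g] - 1) ([h] - 1)` measures the defect of additivity of `g ↦ [g] - 1`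
    let δ : G →+ FinLevel p G F n ⧸ (𝔱 ⊔ J * J) :=
      { toFun := fun g => Ideal.Quotient.mk _ (levGrp p F n g - 1)
        map_zero' := by rw [levGrp_zero, sub_self, map_zero]
        map_add' := fun g h => by
          rw [← map_add, Ideal.Quotient.mk_eq_mk_iff_sub_mem, levGrp_add]
          have : levGrp p F n g * levGrp p F n h - 1 - (levGrp p F n g - 1 + (levGrp p F n h - 1)) =
            (levGrp p F n g - 1) * (levGrp p F n h - 1) := by ring
          rw [this]
          exact Ideal.mem_sup_right (Ideal.mul_mem_mul (hE g) (hE h)) }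
    refine Ideal.span_le.2 ?_
    rintro _ ⟨g, rfl⟩
    have h0 : δ g = 0 := by
      refine hG.additive_eq_zero τ δ (fun g => ?_) (fun i => ?_) g
      -- `[p g] - 1` is the `p`-th power of `[g] - 1`, and `p ≥ 2`
      · change Ideal.Quotient.mk _ (levGrp p F n (p * g) - 1) = 0
        have := levGrp_sub_one_pow (F := F) n 1 g
        rw [pow_one, pow_one] at this
        rw [← this, Ideal.Quotient.eq_zero_iff_mem]
        refine Ideal.mem_sup_right ?_
        rw [← pow_two]
        exact Ideal.pow_le_pow_right hp.out.two_le (Ideal.pow_mem_pow (hE g) p)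
      · have h1 : Ideal.Quotient.mk (𝔱 ⊔ J * J) (lev p F n (T p f τ i)) = 0 :=
          Ideal.Quotient.eq_zero_iff_mem.2 (Ideal.mem_sup_left (Ideal.subset_span ⟨i, rfl⟩))
        rw [hG.T_eq τ (hG.eq_one_of_map_eq_one τ), map_sum, map_sum] at h1
        rw [← h1]
        refine Finset.sum_congr rfl fun ζ _ => ?_
        rw [map_smul, map_sub, map_one, lev_grp]
        exact (map_smul (Ideal.Quotient.mkₐ F (𝔱 ⊔ J * J)) _ _).symm
    exact Ideal.Quotient.eq_zero_iff_mem.1 h0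
  · rintro _ ⟨i, rfl⟩
    exact hG.lev_T_mem τ n i

/-- The variables generate the group ring of `G / p ^ n`, since they generate its nilpotent
augmentation ideal. -/
theorem IsUnramified.adjoin_lev_T (hG : IsUnramified p f G) (τ : G →+* F) (n : ℕ) :
    Algebra.adjoin F (Set.range fun i => lev p F n (T p f τ i)) = ⊤ := by
  set A := Algebra.adjoin F (Set.range fun i => lev p F n (T p f τ i))
  have h : ∀ (a : ℕ) (x : FinLevel p G F n), ∃ y ∈ A, x - y ∈ augLev p G F n ^ a := by
    intro a
    induction a with
    | zero => exact fun x => ⟨0, zero_mem _, by simp⟩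
    | succ a ih =>
      intro x
      obtain ⟨c, hc⟩ := exists_sub_algebraMap_mem_augLev n x
      rw [hG.augLev_eq τ] at hc
      obtain ⟨s, hs⟩ := (Ideal.mem_span_range_iff_exists_fun).1 hc
      choose y hy hy' using fun i => ih (s i)
      refine ⟨algebraMap F _ c + ∑ i, y i * lev p F n (T p f τ i),
        add_mem (A.algebraMap_mem c) (sum_mem fun i _ => mul_mem (hy i)
          (Algebra.subset_adjoin ⟨i, rfl⟩)), ?_⟩
      rw [← sub_sub, ← hs, ← Finset.sum_sub_distrib]
      refine Ideal.sum_mem _ fun i _ => ?_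
      rw [← sub_mul, pow_succ]
      exact Ideal.mul_mem_mul (hy' i) (hG.lev_T_mem τ n i)
  obtain ⟨N, hN⟩ := ((hG.augLev_fg n).isNilpotent_iff_le_nilradical).2
    (augLev_le_nilradical (F := F) n)
  refine eq_top_iff.2 fun x _ => ?_
  obtain ⟨y, hy, hxy⟩ := h N x
  rw [hN] at hxy
  rwa [sub_eq_zero.1 hxy]

/-- The monomials in the variables with exponents less than `p ^ n` span the group ring of
`G / p ^ n`, and there are as many of them as elements in the group. -/
theorem IsUnramified.span_monomials (hG : IsUnramified p f G) (τ : G →+* F) (n : ℕ) :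
    ⊤ ≤ Submodule.span F (Set.range fun α : Fin f → Fin (p ^ n) =>
      ∏ i, lev p F n (T p f τ i) ^ (α i : ℕ)) := by
  set B := Submodule.span F (Set.range fun α : Fin f → Fin (p ^ n) =>
      ∏ i, lev p F n (T p f τ i) ^ (α i : ℕ))
  have h1 : ∀ α : Fin f → ℕ, ∏ i, lev p F n (T p f τ i) ^ α i ∈ B := by
    intro α
    by_cases h : ∀ i, α i < p ^ n
    · exact Submodule.subset_span ⟨fun i => ⟨α i, h i⟩, rfl⟩
    · push Not at h
      obtain ⟨i, hi⟩ := h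
      rw [Finset.prod_eq_zero (Finset.mem_univ i)]
      · exact zero_mem _
      · rw [← Nat.sub_add_cancel hi, pow_add, hG.lev_T_pow, mul_zero]
  have h2 : ∀ x ∈ Algebra.adjoin F (Set.range fun i => lev p F n (T p f τ i)), ∀ b ∈ B,
      x * b ∈ B := by
    intro x hx
    induction hx using Algebra.adjoin_induction with
    | mem x hx =>
      obtain ⟨i, rfl⟩ := hx
      intro b hb
      induction hb using Submodule.span_induction with
      | mem b hb =>
        obtain ⟨α, rfl⟩ := hb
        have := h1 (fun j => (if j = i then 1 else 0) + α j)
        simp only [pow_add, Finset.prod_mul_distrib, pow_ite, pow_one, pow_zero,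
          Finset.prod_ite_eq', Finset.mem_univ, if_true] at this
        exact this
      | zero => rw [mul_zero]; exact zero_mem _
      | add a b _ _ ha hb => rw [mul_add]; exact add_mem ha hb
      | smul c b _ hb => rw [mul_smul_comm]; exact B.smul_mem _ hb
    | algebraMap r => intro b hb; rw [← Algebra.smul_def]; exact B.smul_mem _ hb
    | add x y _ _ hx hy => intro b hb; rw [add_mul]; exact add_mem (hx b hb) (hy b hb)
    | mul x y _ _ hx hy => intro b hb; rw [mul_assoc]; exact hx _ (hy b hb)
  intro x _
  have := h2 x (by rw [hG.adjoin_lev_T]; trivial) 1 (by simpa using h1 0)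
  rwa [mul_one] at this

/-- The monomials with exponents less than `p ^ n` are as many as the elements of `G / p ^ n`, so
that the spanning family they form is a basis. -/
theorem IsUnramified.linearIndependent_monomials (hG : IsUnramified p f G) (τ : G →+* F) (n : ℕ) :
    LinearIndependent F fun α : Fin f → Fin (p ^ n) =>
      ∏ i, lev p F n (T p f τ i) ^ (α i : ℕ) := by
  refine linearIndependent_of_top_le_span_of_card_eq_finrank (hG.span_monomials τ n) ?_
  have := hG.finite_quot n
  let _ := Fintype.ofFinite (G ⧸ Ideal.span {(p : G) ^ n})
  have e : FinLevel p G F n ≃ₗ[F] ((G ⧸ Ideal.span {(p : G) ^ n}) →₀ F) :=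
    { AddMonoidAlgebra.coeffAddEquiv with map_smul' := fun _ _ => rfl }
  rw [e.finrank_eq, Module.finrank_finsupp_self, Fintype.card_fun, Fintype.card_fin,
    Fintype.card_fin, ← Nat.card_eq_fintype_card, hG.card_quot, pow_mul]

end CharP

/-! ### Reduction modulo `p` and completeness of the Iwasawa algebra -/

section Red

variable (p : ℕ) {f : ℕ} {G : Type*} [CommRing G] {R F : Type*} [CommRing R] [CommRing F]
  (r : R →+* F)

/-- The map of group rings of `G / p ^ n` induced by a homomorphism of coefficient rings. -/
def redLev (n : ℕ) : FinLevel p G R n →+* FinLevel p G F n := AddMonoidAlgebra.mapRingHom _ r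

theorem finLevelMap_redLev (n : ℕ) (x : FinLevel p G R (n + 1)) :
    finLevelMap p G F n (redLev p r (n + 1) x) = redLev p r n (finLevelMap p G R n x) := by
  induction x using AddMonoidAlgebra.induction_linear with
  | zero => simp
  | add x y hx hy => simp only [map_add, hx, hy]
  | single g c => simp [redLev, finLevelMap]

/-- The map of Iwasawa algebras induced by a homomorphism of coefficient rings. -/
def red : iwasawa p G R →+* iwasawa p G F where
  toFun x := ⟨fun n => redLev p r n (lev p R n x), fun n => by
    rw [finLevelMap_redLev, finLevelMap_lev]⟩
  map_one' := iwasawa_ext p fun n => by rw [lev_apply]; simp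
  map_mul' x y := iwasawa_ext p fun n => by
    rw [map_mul, lev_apply, lev_apply, lev_apply]; simp
  map_zero' := iwasawa_ext p fun n => by rw [lev_apply]; simp
  map_add' x y := iwasawa_ext p fun n => by
    rw [map_add, lev_apply, lev_apply, lev_apply]; simp

theorem lev_red (n : ℕ) (x : iwasawa p G R) : lev p F n (red p r x) = redLev p r n (lev p R n x) :=
  rfl

theorem red_grp (g : G) : red p r (grp p R g) = grp p F g :=
  iwasawa_ext p fun n => by rw [lev_red, lev_grp, lev_grp]; simp [redLev, levGrp]

theorem red_smul (c : R) (x : iwasawa p G R) : red p r (c • x) = r c • red p r x := by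
  refine iwasawa_ext p fun n => ?_
  rw [lev_red, map_smul (lev p R n), map_smul (lev p F n), lev_red, Algebra.smul_def, map_mul,
    Algebra.smul_def]
  congr 1
  simp [redLev]

theorem red_T [Fact p.Prime] [IsDomain G] (hG : IsUnramified p f G) (τ : G →+* R) (i : Fin f) :
    red p r (T p f τ i) = T p f (r.comp τ) i := by
  have := hG.finite_rootsOfUnity
  let _ := Fintype.ofFinite (rootsOfUnity (p ^ f - 1) G)
  unfold T
  split_ifs with h
  · rw [map_sub, red_grp, map_one]
  · rw [finsum_eq_sum_of_fintype, finsum_eq_sum_of_fintype, map_sum]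
    refine Finset.sum_congr rfl fun ζ _ => ?_
    rw [red_smul, red_grp, map_pow]
    rfl

theorem mem_span_pow_finLevel [Finite (G ⧸ Ideal.span {(p : G) ^ n})] (k : ℕ)
    (x : FinLevel p G R n) :
    x ∈ Ideal.span {(p : FinLevel p G R n) ^ k} ↔ ∀ g, x.coeff g ∈ Ideal.span {(p : R) ^ k} := by
  have hp : ∀ z : FinLevel p G R n, (p : FinLevel p G R n) ^ k * z = (p : R) ^ k • z := by
    intro z
    rw [Algebra.smul_def, map_pow, map_natCast]
  simp only [Ideal.mem_span_singleton]
  constructor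
  · rintro ⟨z, rfl⟩ g
    rw [hp]
    exact ⟨z.coeff g, rfl⟩
  · intro h
    choose z hz using h
    refine ⟨AddMonoidAlgebra.ofCoeff (Finsupp.equivFunOnFinite.symm z), ?_⟩
    rw [hp]
    ext g
    exact hz g

theorem exists_limit_finLevel [Finite (G ⧸ Ideal.span {(p : G) ^ n})]
    [IsAdicComplete (Ideal.span {(p : R)}) R] (s : ℕ → FinLevel p G R n)
    (hs : ∀ k l, k ≤ l → s l - s k ∈ Ideal.span {(p : FinLevel p G R n) ^ k}) :
    ∃ x, ∀ k, s k - x ∈ Ideal.span {(p : FinLevel p G R n) ^ k} := by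
  simp only [mem_span_pow_finLevel] at hs
  have h : ∀ g, ∃ c : R, ∀ k, (s k).coeff g - c ∈ Ideal.span {(p : R) ^ k} := by
    intro g
    obtain ⟨c, hc⟩ := IsPrecomplete.prec
      (inferInstance : IsPrecomplete (Ideal.span {(p : R)}) R) (f := fun k => (s k).coeff g) (by
        intro k l hkl
        rw [SModEq.sub_mem, smul_eq_mul, Ideal.mul_top, Ideal.span_singleton_pow, ← neg_sub]
        exact neg_mem (hs k l hkl g))
    refine ⟨c, fun k => ?_⟩
    have := hc k
    rwa [SModEq.sub_mem, smul_eq_mul, Ideal.mul_top, Ideal.span_singleton_pow] at this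
  choose c hc using h
  refine ⟨AddMonoidAlgebra.ofCoeff (Finsupp.equivFunOnFinite.symm c), fun k => ?_⟩
  rw [mem_span_pow_finLevel]
  exact fun g => hc g k

theorem eq_zero_of_mem_span_pow_finLevel [Finite (G ⧸ Ideal.span {(p : G) ^ n})]
    [IsHausdorff (Ideal.span {(p : R)}) R] (x : FinLevel p G R n)
    (hx : ∀ k, x ∈ Ideal.span {(p : FinLevel p G R n) ^ k}) : x = 0 := by
  simp only [mem_span_pow_finLevel] at hx
  ext g
  refine IsHausdorff.haus (inferInstance : IsHausdorff (Ideal.span {(p : R)}) R) _ fun k => ?_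
  rw [SModEq.zero, smul_eq_mul, Ideal.mul_top, Ideal.span_singleton_pow]
  exact hx k g

theorem finLevelMap_mem_span_pow (k n : ℕ) {x : FinLevel p G R (n + 1)}
    (hx : x ∈ Ideal.span {(p : FinLevel p G R (n + 1)) ^ k}) :
    finLevelMap p G R n x ∈ Ideal.span {(p : FinLevel p G R n) ^ k} := by
  rw [Ideal.mem_span_singleton] at hx ⊢
  have := map_dvd (finLevelMap p G R n) hx
  simpa using this

variable {p} in
theorem redLev_eq_zero [Finite (G ⧸ Ideal.span {(p : G) ^ n})]
    (hr : ∀ c, r c = 0 → c ∈ Ideal.span {(p : R)}) {x : FinLevel p G R n}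
    (hx : redLev p r n x = 0) : x ∈ Ideal.span {(p : FinLevel p G R n)} := by
  rw [← pow_one (p : FinLevel p G R n), mem_span_pow_finLevel]
  intro g
  rw [pow_one]
  refine hr _ ?_
  have := congrArg (fun y => AddMonoidAlgebra.coeff y g) hx
  simpa [redLev] using this

theorem natCast_finLevel_eq_zero [CharP F p] (n : ℕ) : (p : FinLevel p G F n) = 0 := by
  rw [← map_natCast (algebraMap F _)]
  simp only [CharP.cast_eq_zero, map_zero]

/-- Reduction of coefficients is surjective on Iwasawa algebras, because the transition maps
between the finite levels are. -/
theorem red_surjective [CharP F p] [∀ n, Finite (G ⧸ Ideal.span {(p : G) ^ n})] (hsurj : Function.Surjective r)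
    (hr : ∀ c, r c = 0 → c ∈ Ideal.span {(p : R)}) :
    Function.Surjective (red p r : iwasawa p G R →+* iwasawa p G F) := by
  intro x
  have hL : ∀ n, Function.Surjective (redLev p r n : FinLevel p G R n →+* FinLevel p G F n) :=
    fun n => AddMonoidAlgebra.map_surjective _ hsurj
  have htr : ∀ n, Function.Surjective (finLevelMap p G R n) := by
    intro n z
    induction z using AddMonoidAlgebra.induction_linear with
    | zero => exact ⟨0, map_zero _⟩
    | add x y hx hy =>
      obtain ⟨a, rfl⟩ := hx
      obtain ⟨b, rfl⟩ := hy
      exact ⟨a + b, map_add _ _ _⟩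
    | single g c =>
      obtain ⟨g, rfl⟩ := Ideal.Quotient.mk_surjective g
      exact ⟨AddMonoidAlgebra.single (Ideal.Quotient.mk _ g) c, by simp [finLevelMap]⟩
  -- a lift at level `n` is corrected by `p v` at level `n + 1`, where `v` lifts the quotient by
  -- `p` of the discrepancy at level `n`
  have step : ∀ n (y : {y : FinLevel p G R n // redLev p r n y = lev p F n x}),
      ∃ z : {z : FinLevel p G R (n + 1) // redLev p r (n + 1) z = lev p F (n + 1) x},
        finLevelMap p G R n z = y := by
    rintro n ⟨y, hy⟩
    obtain ⟨z, hz⟩ := hL (n + 1) (lev p F (n + 1) x)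
    have h1 : redLev p r n (y - finLevelMap p G R n z) = 0 := by
      rw [map_sub, ← finLevelMap_redLev, hz, finLevelMap_lev, hy, sub_self]
    obtain ⟨u, hu⟩ := Ideal.mem_span_singleton.1 (redLev_eq_zero r hr h1)
    obtain ⟨v, rfl⟩ := htr n u
    refine ⟨⟨z + p * v, ?_⟩, ?_⟩
    · rw [map_add, hz, map_mul, map_natCast, natCast_finLevel_eq_zero, zero_mul, add_zero]
    · change finLevelMap p G R n (z + p * v) = y
      rw [map_add, map_mul, map_natCast, ← hu]
      ring
  choose next hnext using step
  have h0 : ∃ y : FinLevel p G R 0, redLev p r 0 y = lev p F 0 x := hL 0 _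
  let seq : ∀ n, {y : FinLevel p G R n // redLev p r n y = lev p F n x} := fun n =>
    Nat.rec ⟨h0.choose, h0.choose_spec⟩ (fun n y => next n y) n
  refine ⟨⟨fun n => (seq n).1, fun n => hnext n (seq n)⟩, iwasawa_ext p fun n => ?_⟩
  rw [lev_red]
  exact (seq n).2

variable {p} in
/-- The kernel of the reduction is generated by `p`. -/
theorem red_eq_zero [∀ n, Finite (G ⧸ Ideal.span {(p : G) ^ n})]
    (hr : ∀ c, r c = 0 → c ∈ Ideal.span {(p : R)}) (hp0 : ∀ c : R, (p : R) * c = 0 → c = 0)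
    {x : iwasawa p G R} (hx : red p r x = 0) : ∃ y, x = p * y := by
  have h : ∀ n, ∃ y : FinLevel p G R n, lev p R n x = p * y := fun n => by
    refine Ideal.mem_span_singleton.1 (redLev_eq_zero r hr ?_)
    rw [← lev_red, hx, map_zero]
  choose y hy using h
  -- the quotients by `p` at the finite levels are unique, hence compatible
  have hinj : ∀ n (z : FinLevel p G R n), (p : FinLevel p G R n) * z = 0 → z = 0 := by
    intro n z hz
    ext g
    refine hp0 _ ?_
    have h1 : (p : FinLevel p G R n) * z = (p : R) • z := by
      rw [Algebra.smul_def, map_natCast]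
    rw [h1] at hz
    exact congrArg (fun u => AddMonoidAlgebra.coeff u g) hz
  refine ⟨⟨y, fun n => ?_⟩, iwasawa_ext p fun n => ?_⟩
  · rw [← sub_eq_zero]
    refine hinj n _ ?_
    rw [mul_sub, ← hy, ← finLevelMap_lev, hy, map_mul, map_natCast, sub_self]
  · rw [hy, map_mul, map_natCast]
    rfl

end Red

section Conv

variable {p f : ℕ} [hp : Fact p.Prime] {G : Type*} [CommRing G] [IsDomain G]
  {F : Type*} [Field F] [CharP F p] {R : Type*} [CommRing R]

/-- Convergence of a sequence of the Iwasawa algebra, for the `p`-adic topology at each finite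
level. -/
def Conv (u : ℕ → iwasawa p G R) (x : iwasawa p G R) : Prop :=
  ∀ n k, ∃ B₀, ∀ B, B₀ ≤ B → lev p R n (u B - x) ∈ Ideal.span {(p : FinLevel p G R n) ^ k}

theorem Conv.unique (hG : IsUnramified p f G) [IsHausdorff (Ideal.span {(p : R)}) R]
    {u : ℕ → iwasawa p G R} {x y : iwasawa p G R} (hx : Conv u x) (hy : Conv u y) : x = y := by
  have := hG.finite_quot
  rw [← sub_eq_zero]
  refine iwasawa_ext p fun n => ?_
  rw [map_zero]
  refine eq_zero_of_mem_span_pow_finLevel p _ fun k => ?_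
  obtain ⟨B, hB⟩ := hx n k
  obtain ⟨C, hC⟩ := hy n k
  have := sub_mem (hC _ (le_max_right B C)) (hB _ (le_max_left B C))
  rw [← map_sub] at this
  convert this using 2
  ring

theorem Conv.const_mul {u : ℕ → iwasawa p G R} {x : iwasawa p G R} (hx : Conv u x)
    (c : iwasawa p G R) : Conv (fun B => c * u B) (c * x) := by
  intro n k
  obtain ⟨B, hB⟩ := hx n k
  refine ⟨B, fun C hC => ?_⟩
  rw [← mul_sub, map_mul]
  exact Ideal.mul_mem_left _ _ (hB C hC)

theorem Conv.sum {ι : Type*} (s : Finset ι) {u : ι → ℕ → iwasawa p G R} {x : ι → iwasawa p G R}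
    (h : ∀ i ∈ s, Conv (u i) (x i)) : Conv (fun B => ∑ i ∈ s, u i B) (∑ i ∈ s, x i) := by
  classical
  intro n k
  have : ∀ i : ι, ∃ B₀, i ∈ s → ∀ B, B₀ ≤ B →
      lev p R n (u i B - x i) ∈ Ideal.span {(p : FinLevel p G R n) ^ k} := by
    intro i
    by_cases hi : i ∈ s
    · obtain ⟨B, hB⟩ := h i hi n k
      exact ⟨B, fun _ => hB⟩
    · exact ⟨0, fun h => absurd h hi⟩
  choose B hB using this
  refine ⟨s.sup B, fun C hC => ?_⟩
  rw [← Finset.sum_sub_distrib, map_sum]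
  exact Ideal.sum_mem _ fun i hi => hB i hi C ((Finset.le_sup hi).trans hC)

/-- The ideal generated by `p` and the variables. -/
def maxT (p f : ℕ) {G R : Type*} [CommRing G] [CommRing R] (τ : G →+* R) :
    Ideal (iwasawa p G R) := idealT p f τ ⊔ Ideal.span {(p : iwasawa p G R)}

/-- At each finite level, the powers of the ideal generated by `p` and the variables tend to zero
for the `p`-adic topology. -/
theorem IsUnramified.exists_lev_maxT_pow (hG : IsUnramified p f G) (r : R →+* F)
    (hr : ∀ c, r c = 0 → c ∈ Ideal.span {(p : R)}) (τ : G →+* R) (n : ℕ) :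
    ∃ M, ∀ k, ∀ x ∈ maxT p f τ ^ (M * k),
      lev p R n x ∈ Ideal.span {(p : FinLevel p G R n) ^ k} := by
  have := hG.finite_quot
  -- `M` is the exponent of nilpotency of the augmentation ideal in characteristic `p`
  obtain ⟨M, hM⟩ := ((hG.augLev_fg n).isNilpotent_iff_le_nilradical).2
    (augLev_le_nilradical (F := F) n)
  have h1 : maxT p f τ ≤ (augLev p G F n).comap ((redLev p r n).comp (lev p R n).toRingHom) := by
    refine sup_le (Ideal.span_le.2 ?_) (Ideal.span_le.2 ?_)
    · rintro _ ⟨i, rfl⟩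
      change redLev p r n (lev p R n (T p f τ i)) ∈ augLev p G F n
      rw [← lev_red, red_T p r hG]
      exact hG.lev_T_mem _ n i
    · rintro _ rfl
      change redLev p r n (lev p R n (p : iwasawa p G R)) ∈ augLev p G F n
      rw [map_natCast, map_natCast, natCast_finLevel_eq_zero]
      exact zero_mem _
  have h2 : maxT p f τ ^ M ≤ (Ideal.span {(p : FinLevel p G R n)}).comap (lev p R n).toRingHom := by
    intro x hx
    have h3 := Ideal.le_comap_pow _ M (Ideal.pow_right_mono h1 M hx)
    rw [hM] at h3
    exact redLev_eq_zero r hr h3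
  refine ⟨M, fun k x hx => ?_⟩
  rw [pow_mul] at hx
  have h3 := Ideal.le_comap_pow _ k (Ideal.pow_right_mono h2 k hx)
  rw [Ideal.span_singleton_pow] at h3
  exact h3

/-- The Iwasawa algebra is complete for the powers of the ideal generated by `p` and the
variables. -/
theorem IsUnramified.exists_conv (hG : IsUnramified p f G) (r : R →+* F)
    (hr : ∀ c, r c = 0 → c ∈ Ideal.span {(p : R)}) [IsAdicComplete (Ideal.span {(p : R)}) R]
    (τ : G →+* R) (e : ℕ → iwasawa p G R) (he : ∀ b, e b ∈ maxT p f τ ^ b) :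
    ∃ x, Conv (fun B => ∑ b ∈ Finset.range B, e b) x := by
  have := hG.finite_quot
  choose M hM using hG.exists_lev_maxT_pow r hr τ
  have htail : ∀ n k B C, M n * k ≤ B → B ≤ C →
      lev p R n (∑ b ∈ Finset.range C, e b) - lev p R n (∑ b ∈ Finset.range B, e b) ∈
        Ideal.span {(p : FinLevel p G R n) ^ k} := by
    intro n k B C hB hC
    rw [← map_sub, ← Finset.sum_sdiff (Finset.range_subset_range.2 hC), add_sub_cancel_right]
    refine hM n k _ (Ideal.sum_mem _ fun b hb => Ideal.pow_le_pow_right ?_ (he b))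
    simp only [Finset.mem_sdiff, Finset.mem_range, not_lt] at hb
    omega
  have hlim : ∀ n, ∃ y : FinLevel p G R n, ∀ k,
      lev p R n (∑ b ∈ Finset.range (M n * k), e b) - y ∈
        Ideal.span {(p : FinLevel p G R n) ^ k} := fun n =>
    exists_limit_finLevel p (fun k => lev p R n (∑ b ∈ Finset.range (M n * k), e b))
      fun k l hkl => htail n k _ _ le_rfl (Nat.mul_le_mul_left _ hkl)
  choose y hy using hlim
  have hy' : ∀ n k B, M n * k ≤ B → lev p R n (∑ b ∈ Finset.range B, e b) - y n ∈
        Ideal.span {(p : FinLevel p G R n) ^ k} := by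
    intro n k B hB
    have := add_mem (htail n k _ B le_rfl hB) (hy n k)
    rwa [sub_add_sub_cancel] at this
  have hcomp : ∀ n, finLevelMap p G R n (y (n + 1)) = y n := by
    intro n
    rw [← sub_eq_zero]
    refine eq_zero_of_mem_span_pow_finLevel p _ fun k => ?_
    have h1 := hy' n k _ (le_max_left (M n * k) (M (n + 1) * k))
    have h2 := finLevelMap_mem_span_pow p k n (hy' (n + 1) k _ (le_max_right (M n * k) (M (n + 1) * k)))
    rw [map_sub, finLevelMap_lev] at h2
    have := sub_mem h1 h2
    rwa [sub_sub_sub_cancel_left] at this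
  refine ⟨⟨y, hcomp⟩, fun n k => ⟨M n * k, fun B hB => ?_⟩⟩
  rw [map_sub]
  exact hy' n k B hB

/-- The powers of the ideal of the variables are closed: a convergent series with terms in
`𝔪 ^ b * I ^ a` has its sum in `I ^ a`. -/
theorem IsUnramified.exists_conv_mem (hG : IsUnramified p f G) (r : R →+* F)
    (hr : ∀ c, r c = 0 → c ∈ Ideal.span {(p : R)}) [IsAdicComplete (Ideal.span {(p : R)}) R]
    (τ : G →+* R) (a : ℕ) (e : ℕ → iwasawa p G R)
    (he : ∀ b, e b ∈ maxT p f τ ^ b * idealT p f τ ^ a) :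
    ∃ x ∈ idealT p f τ ^ a, Conv (fun B => ∑ b ∈ Finset.range B, e b) x := by
  have hfg : (idealT p f τ ^ a).FG :=
    Ideal.FG.pow (Submodule.fg_span (Set.finite_range _))
  -- each term is expanded in a fixed finite system of generators of `I ^ a`; the coefficients form
  -- convergent series
  obtain ⟨s, hs⟩ := hfg
  have hs' : idealT p f τ ^ a = Ideal.span (Set.range fun i : s => (i : iwasawa p G R)) := by
    rw [Subtype.range_coe_subtype]; exact hs.symm
  have h1 : ∀ b, ∃ d : s → iwasawa p G R, (∀ i, d i ∈ maxT p f τ ^ b) ∧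
      e b = ∑ i : s, (i : iwasawa p G R) * d i := by
    intro b
    have h2 := he b
    rw [hs', ← smul_eq_mul, Ideal.span, Submodule.mem_ideal_smul_span_iff_exists_sum] at h2
    obtain ⟨d, hd, h3⟩ := h2
    refine ⟨d, hd, ?_⟩
    rw [← h3, Finsupp.sum_fintype _ _ (by simp)]
    simp [mul_comm]
  choose d hd hd' using h1
  choose x hx using fun i : s => hG.exists_conv r hr τ (fun b => d b i) fun b => hd b i
  refine ⟨∑ i : s, (i : iwasawa p G R) * x i, Ideal.sum_mem _ fun i _ => ?_, ?_⟩
  · rw [hs']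
    exact Ideal.mul_mem_right _ _ (Ideal.subset_span ⟨i, rfl⟩)
  · have h4 := Conv.sum Finset.univ fun i _ => (hx i).const_mul (i : iwasawa p G R)
    convert h4 using 2 with B
    simp only [hd', Finset.mul_sum]
    rw [Finset.sum_comm]

end Conv

/-! ### Power series expansions in characteristic `p` -/

theorem mem_piAntidiag_univ {f a : ℕ} {α : Fin f → ℕ} :
    α ∈ Finset.piAntidiag Finset.univ a ↔ ∑ i, α i = a := by
  simp [Finset.mem_piAntidiag]

section Mon

variable (p f : ℕ) {G R : Type*} [CommRing G] [CommRing R] (τ : G →+* R)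

/-- The monomial `∏ T_i ^ (α i)`. -/
def mon (α : Fin f → ℕ) : iwasawa p G R := ∏ i, T p f τ i ^ α i

theorem mon_add (α β : Fin f → ℕ) : mon p f τ (α + β) = mon p f τ α * mon p f τ β := by
  simp [mon, pow_add, Finset.prod_mul_distrib]

theorem mon_single (i : Fin f) : mon p f τ (Pi.single i 1) = T p f τ i := by
  rw [mon, Finset.prod_eq_single i]
  · simp
  · intro j _ hj; simp [hj]
  · simp

theorem T_mem (i : Fin f) : T p f τ i ∈ idealT p f τ := Ideal.subset_span ⟨i, rfl⟩

theorem mon_mem (α : Fin f → ℕ) : mon p f τ α ∈ idealT p f τ ^ ∑ i, α i := by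
  have := Ideal.prod_mem_prod (s := Finset.univ) (I := fun i : Fin f => idealT p f τ ^ α i)
    (x := fun i => T p f τ i ^ α i) fun i _ => Ideal.pow_mem_pow (T_mem p f τ i) _
  rwa [Finset.prod_pow_eq_pow_sum] at this

theorem idealT_pow_eq (a : ℕ) :
    idealT p f τ ^ a = Ideal.span (mon p f τ '' {α | ∑ i, α i = a}) := by
  refine le_antisymm ?_ (Ideal.span_le.2 ?_)
  · induction a with
    | zero =>
      rw [pow_zero, Ideal.one_eq_top, top_le_iff, Ideal.eq_top_iff_one]
      exact Ideal.subset_span ⟨0, by simp, by simp [mon]⟩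
    | succ a ih =>
      rw [pow_succ]
      refine (Ideal.mul_mono_left ih).trans ?_
      rw [idealT, Ideal.span_mul_span', Ideal.span_le]
      rintro _ ⟨_, ⟨α, hα, rfl⟩, _, ⟨i, rfl⟩, rfl⟩
      refine Ideal.subset_span ⟨α + Pi.single i 1, ?_, ?_⟩
      · have : ∑ j, (Pi.single i 1 : Fin f → ℕ) j = 1 := by simp
        simpa [Finset.sum_add_distrib, this] using hα
      · rw [mon_add, mon_single]
  · rintro _ ⟨α, rfl, rfl⟩
    exact mon_mem p f τ α

theorem mem_idealT_pow_iff_exists (a : ℕ) (x : iwasawa p G R) :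
    x ∈ idealT p f τ ^ a ↔ ∃ c : (Fin f → ℕ) → iwasawa p G R,
      x = ∑ α ∈ Finset.piAntidiag Finset.univ a, c α * mon p f τ α := by
  have hset : {α : Fin f → ℕ | ∑ i, α i = a} =
      ((Finset.piAntidiag Finset.univ a : Finset (Fin f → ℕ)) : Set (Fin f → ℕ)) := by
    ext α; simp
  classical
  rw [idealT_pow_eq, hset, Ideal.span, Submodule.mem_span_image_finset_iff_exists_fun]
  simp only [smul_eq_mul]
  constructor
  · rintro ⟨c, hc⟩
    refine ⟨fun α => if h : α ∈ Finset.piAntidiag Finset.univ a then c ⟨α, h⟩ else 0, ?_⟩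
    rw [← hc, ← Finset.sum_coe_sort (Finset.piAntidiag Finset.univ a)]
    exact Finset.sum_congr rfl fun α _ => by simp only [dif_pos α.2]
  · rintro ⟨c, hc⟩
    refine ⟨fun α => c α, ?_⟩
    rw [hc, ← Finset.sum_coe_sort (Finset.piAntidiag Finset.univ a)]

end Mon

instance isAdicComplete_of_charP (p : ℕ) (F : Type*) [Field F] [CharP F p] :
    IsAdicComplete (Ideal.span {(p : F)}) F := by
  have : Ideal.span {(p : F)} = ⊥ := by simp
  rw [this]
  infer_instance

section Coef

variable {p f : ℕ} [hp : Fact p.Prime] {G : Type*} [CommRing G] [IsDomain G]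
  {F : Type*} [Field F] [CharP F p]

theorem lev_mon (τ : G →+* F) (n : ℕ) (α : Fin f → ℕ) :
    lev p F n (mon p f τ α) = ∏ i, lev p F n (T p f τ i) ^ α i := by
  simp [mon]

theorem IsUnramified.span_lev_mon (hG : IsUnramified p f G) (τ : G →+* F) (n : ℕ) :
    Submodule.span F (Set.range fun α : Fin f → ℕ => lev p F n (mon p f τ α)) = ⊤ := by
  rw [eq_top_iff]
  refine (hG.span_monomials τ n).trans (Submodule.span_mono ?_)
  rintro _ ⟨α, rfl⟩
  exact ⟨fun i => α i, lev_mon τ n _⟩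

theorem IsUnramified.lev_mon_eq_zero (hG : IsUnramified p f G) (τ : G →+* F) {n : ℕ}
    {α : Fin f → ℕ} (h : ¬ ∀ i, α i < p ^ n) : lev p F n (mon p f τ α) = 0 := by
  push Not at h
  obtain ⟨i, hi⟩ := h
  rw [lev_mon, Finset.prod_eq_zero (Finset.mem_univ i)]
  rw [← Nat.sub_add_cancel hi, pow_add, hG.lev_T_pow, mul_zero]

open Classical in
/-- The coefficient of a monomial at finite level (zero if an exponent is at least `p ^ n`). -/
def IsUnramified.coefLev (hG : IsUnramified p f G) (τ : G →+* F) (n : ℕ) (β : Fin f → ℕ) :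
    FinLevel p G F n →ₗ[F] F :=
  if h : ∀ i, β i < p ^ n then
    (Module.Basis.mk (hG.linearIndependent_monomials τ n) (hG.span_monomials τ n)).coord
      fun i => ⟨β i, h i⟩
  else 0

open Classical in
theorem IsUnramified.coefLev_mon (hG : IsUnramified p f G) (τ : G →+* F) (n : ℕ)
    (α β : Fin f → ℕ) : hG.coefLev τ n β (lev p F n (mon p f τ α)) =
      if α = β ∧ ∀ i, β i < p ^ n then 1 else 0 := by
  unfold IsUnramified.coefLev
  by_cases hβ : ∀ i, β i < p ^ n
  · rw [dif_pos hβ]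
    by_cases hα : ∀ i, α i < p ^ n
    · have h1 := Module.Basis.mk_apply (hG.linearIndependent_monomials τ n)
        (hG.span_monomials τ n) (fun i => ⟨α i, hα i⟩)
      have h2 : lev p F n (mon p f τ α) = _ := (lev_mon τ n α).trans h1.symm
      rw [h2, Module.Basis.coord_apply, Module.Basis.repr_self, Finsupp.single_apply]
      refine if_congr ?_ rfl rfl
      constructor
      · intro h
        refine ⟨funext fun i => ?_, hβ⟩
        exact congrArg Fin.val (congrFun h i)
      · rintro ⟨rfl, _⟩; rfl
    · rw [hG.lev_mon_eq_zero τ hα, map_zero, if_neg]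
      rintro ⟨rfl, _⟩
      exact hα hβ
  · rw [dif_neg hβ, if_neg (fun h => hβ h.2)]
    rfl

theorem IsUnramified.eq_zero_of_coefLev (hG : IsUnramified p f G) (τ : G →+* F) (n : ℕ)
    {y : FinLevel p G F n} (hy : ∀ β, (∀ i, β i < p ^ n) → hG.coefLev τ n β y = 0) : y = 0 := by
  let b := Module.Basis.mk (hG.linearIndependent_monomials τ n) (hG.span_monomials τ n)
  refine b.ext_elem fun β => ?_
  have := hy (fun i => β i) fun i => (β i).2
  rw [IsUnramified.coefLev, dif_pos fun i => (β i).2] at this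
  rw [map_zero]
  exact this

theorem IsUnramified.coefLev_map (hG : IsUnramified p f G) (τ : G →+* F) (n : ℕ) {β : Fin f → ℕ}
    (hβ : ∀ i, β i < p ^ n) (y : FinLevel p G F (n + 1)) :
    hG.coefLev τ n β (finLevelMap p G F n y) = hG.coefLev τ (n + 1) β y := by
  classical
  have : (hG.coefLev τ n β).comp (finLevelMap p G F n).toLinearMap = hG.coefLev τ (n + 1) β := by
    refine LinearMap.ext_on_range (hG.span_lev_mon τ (n + 1)) fun α => ?_
    rw [LinearMap.comp_apply, AlgHom.toLinearMap_apply, finLevelMap_lev, hG.coefLev_mon,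
      hG.coefLev_mon]
    refine if_congr (and_congr_right fun _ => iff_of_true hβ fun i => ?_) rfl rfl
    exact (hβ i).trans_le (Nat.pow_le_pow_right hp.out.pos n.le_succ)
  exact LinearMap.congr_fun this y

/-- The coefficient of a monomial in the expansion of an element of `F⟦G⟧` as a power series in the
variables. -/
def IsUnramified.coef (hG : IsUnramified p f G) (τ : G →+* F) (β : Fin f → ℕ) :
    iwasawa p G F →ₗ[F] F :=
  (hG.coefLev τ (∑ i, β i) β).comp (lev p F (∑ i, β i)).toLinearMap

theorem lt_pow_sum (p : ℕ) [hp : Fact p.Prime] (β : Fin f → ℕ) (i : Fin f) :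
    β i < p ^ ∑ j, β j :=
  (Finset.single_le_sum (fun j _ => Nat.zero_le (β j)) (Finset.mem_univ i)).trans_lt
    (Nat.lt_pow_self hp.out.one_lt)

theorem IsUnramified.coefLev_lev (hG : IsUnramified p f G) (τ : G →+* F) {n : ℕ} {β : Fin f → ℕ}
    (hβ : ∀ i, β i < p ^ n) (x : iwasawa p G F) :
    hG.coefLev τ n β (lev p F n x) = hG.coef τ β x := by
  have key : ∀ n m, n ≤ m → (∀ i, β i < p ^ n) →
      hG.coefLev τ n β (lev p F n x) = hG.coefLev τ m β (lev p F m x) := by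
    intro n m hnm
    induction m, hnm using Nat.le_induction with
    | base => exact fun _ => rfl
    | succ m hm ih =>
      intro h
      rw [ih h, ← finLevelMap_lev, hG.coefLev_map]
      exact fun i => (h i).trans_le (Nat.pow_le_pow_right hp.out.pos hm)
  have h1 := key n _ (le_max_left n (∑ i, β i)) hβ
  have h2 := key _ _ (le_max_right n (∑ i, β i)) (lt_pow_sum p β)
  exact h1.trans h2.symm

open Classical in
theorem IsUnramified.coef_mon (hG : IsUnramified p f G) (τ : G →+* F) (α β : Fin f → ℕ) :
    hG.coef τ β (mon p f τ α) = if α = β then 1 else 0 := by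
  change hG.coefLev τ _ β (lev p F _ (mon p f τ α)) = _
  rw [hG.coefLev_mon]
  exact if_congr (and_iff_left (lt_pow_sum p β)) rfl rfl

theorem IsUnramified.coef_mon_mul (hG : IsUnramified p f G) (τ : G →+* F) {α β : Fin f → ℕ}
    (h : ∑ i, β i < ∑ i, α i) (x : iwasawa p G F) : hG.coef τ β (mon p f τ α * x) = 0 := by
  classical
  set n := ∑ i, β i with hn
  have : (hG.coefLev τ n β).comp (LinearMap.mulLeft F (lev p F n (mon p f τ α))) = 0 := by
    refine LinearMap.ext_on_range (hG.span_lev_mon τ n) fun γ => ?_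
    rw [LinearMap.comp_apply, LinearMap.mulLeft_apply, ← map_mul, ← mon_add, hG.coefLev_mon,
      if_neg, LinearMap.zero_apply]
    rintro ⟨rfl, _⟩
    simp only [Pi.add_apply, Finset.sum_add_distrib] at hn
    omega
  change hG.coefLev τ n β (lev p F n (mon p f τ α * x)) = 0
  rw [map_mul]
  exact LinearMap.congr_fun this _

theorem idealT_le_maxT {R : Type*} [CommRing R] (τ : G →+* R) : idealT p f τ ≤ maxT p f τ :=
  le_sup_left

/-- An element whose coefficients of degree less than `a` vanish is the sum of its expansion in
degrees at least `a`. -/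
theorem IsUnramified.conv_expansion (hG : IsUnramified p f G) (τ : G →+* F) (x : iwasawa p G F)
    (a : ℕ) (hx : ∀ β, ∑ i, β i < a → hG.coef τ β x = 0) :
    Conv (fun B => ∑ b ∈ Finset.range B, ∑ α ∈ Finset.piAntidiag Finset.univ (a + b),
      hG.coef τ α x • mon p f τ α) x := by
  classical
  intro n k
  -- at level `n` only the exponents less than `p ^ n`, of total degree less than `f * p ^ n`, are
  -- visible
  refine ⟨f * p ^ n, fun B hB => ?_⟩
  have : lev p F n (∑ b ∈ Finset.range B, ∑ α ∈ Finset.piAntidiag Finset.univ (a + b),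
      hG.coef τ α x • mon p f τ α - x) = 0 := by
    refine hG.eq_zero_of_coefLev τ n fun β hβ => ?_
    have hβ' : ∑ i, β i ≤ f * p ^ n := by
      refine (Finset.sum_le_card_nsmul _ _ (p ^ n) fun i _ => (hβ i).le).trans ?_
      simp
    rw [hG.coefLev_lev τ hβ, map_sub, map_sum, sub_eq_zero]
    simp only [map_sum, map_smul, hG.coef_mon, smul_eq_mul, mul_ite, mul_one, mul_zero,
      Finset.sum_ite_eq', mem_piAntidiag_univ]
    by_cases h : ∑ i, β i < a
    · rw [hx β h]; simp
    · push Not at h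
      rcases hβ'.eq_or_lt with h' | h'
      · exfalso
        have hlt : ∑ i, β i < ∑ _i : Fin f, p ^ n :=
          Finset.sum_lt_sum_of_nonempty ⟨⟨0, hG.pos⟩, Finset.mem_univ _⟩ fun i _ => hβ i
        simp at hlt
        omega
      rw [Finset.sum_eq_single (∑ i, β i - a)]
      · rw [if_pos (by omega)]
      · intro b _ hb
        rw [if_neg (by omega)]
      · intro hb
        simp only [Finset.mem_range, not_lt] at hb
        omega
  rw [this]
  exact zero_mem _

/-- The powers of the ideal of the variables are determined by the coefficients. -/
theorem IsUnramified.mem_idealT_pow_iff (hG : IsUnramified p f G) (τ : G →+* F) (a : ℕ)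
    (x : iwasawa p G F) :
    x ∈ idealT p f τ ^ a ↔ ∀ β, ∑ i, β i < a → hG.coef τ β x = 0 := by
  constructor
  · intro hx β hβ
    rw [mem_idealT_pow_iff_exists] at hx
    obtain ⟨c, rfl⟩ := hx
    rw [map_sum]
    refine Finset.sum_eq_zero fun α hα => ?_
    rw [mem_piAntidiag_univ] at hα
    rw [mul_comm]
    exact hG.coef_mon_mul τ (by omega) _
  · intro hx
    obtain ⟨y, hy, hy'⟩ := hG.exists_conv_mem (RingHom.id F) (fun c hc => by
        rw [RingHom.id_apply] at hc; rw [hc]; exact zero_mem _) τ a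
      (fun b => ∑ α ∈ Finset.piAntidiag Finset.univ (a + b), hG.coef τ α x • mon p f τ α) (by
        intro b
        refine Ideal.sum_mem _ fun α hα => ?_
        have h1 := mon_mem p f τ α
        rw [mem_piAntidiag_univ.1 hα, add_comm, pow_add] at h1
        rw [Algebra.smul_def]
        exact Ideal.mul_mem_left _ _
          (Ideal.mul_mono_left (Ideal.pow_right_mono (idealT_le_maxT τ) b) h1))
    rwa [(hG.conv_expansion τ x a hx).unique hG hy']

/-- The initial form of an element of `I ^ a`. -/
theorem IsUnramified.sub_initial_mem (hG : IsUnramified p f G) (τ : G →+* F) {a : ℕ}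
    {x : iwasawa p G F} (hx : x ∈ idealT p f τ ^ a) :
    x - ∑ α ∈ Finset.piAntidiag Finset.univ a, hG.coef τ α x • mon p f τ α ∈
      idealT p f τ ^ (a + 1) := by
  classical
  rw [hG.mem_idealT_pow_iff] at hx ⊢
  intro β hβ
  rw [map_sub, map_sum]
  simp only [map_smul, hG.coef_mon, smul_eq_mul, mul_ite, mul_one, mul_zero,
      Finset.sum_ite_eq', mem_piAntidiag_univ]
  split_ifs with h
  · exact sub_self _
  · rw [hx β (by omega), sub_zero]

/-- A linear combination of distinct monomials of degree less than `k` that lies in `I ^ k` is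
trivial. -/
theorem IsUnramified.coeff_eq_zero_of_sum_mem (hG : IsUnramified p f G) (τ : G →+* F) {k : ℕ}
    (s : Finset (Fin f → ℕ)) (φ : (Fin f → ℕ) → Fin f → ℕ) (hφ : Function.Injective φ)
    (hs : ∀ α ∈ s, ∑ i, φ α i < k) (c : (Fin f → ℕ) → F)
    (h : ∑ α ∈ s, c α • mon p f τ (φ α) ∈ idealT p f τ ^ k) : ∀ α ∈ s, c α = 0 := by
  classical
  intro α hα
  have := (hG.mem_idealT_pow_iff τ k _).1 h (φ α) (hs α hα)
  simpa [map_sum, hG.coef_mon, hφ.eq_iff, hα] using this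

/-- The variables are regular on the graded ring: multiplication by `T_i` shifts the exponents of
the initial form. -/
theorem IsUnramified.mem_of_T_mul_mem (hG : IsUnramified p f G) (τ : G →+* F) {i : Fin f}
    {a : ℕ} {x : iwasawa p G F} (hx : T p f τ i * x ∈ idealT p f τ ^ (a + 1)) :
    x ∈ idealT p f τ ^ a := by
  have key : ∀ d ≤ a, x ∈ idealT p f τ ^ d := by
    intro d
    induction d with
    | zero => intro _; simp
    | succ d ih =>
      intro hd
      have h1 := ih (by omega)
      have h2 := hG.sub_initial_mem τ h1
      have h3 : ∑ α ∈ Finset.piAntidiag Finset.univ d,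
          hG.coef τ α x • mon p f τ (α + Pi.single i 1) ∈ idealT p f τ ^ (d + 2) := by
        have h4 := Ideal.mul_mem_mul (T_mem p f τ i) h2
        rw [← pow_succ', mul_sub] at h4
        have h5 := sub_mem (Ideal.pow_le_pow_right (by omega) hx) h4
        rw [sub_sub_cancel, Finset.mul_sum] at h5
        convert h5 using 2 with α
        rw [mon_add, mon_single, mul_smul_comm, mul_comm]
      have h6 := hG.coeff_eq_zero_of_sum_mem τ _ _ (add_left_injective _) (by
        intro α hα
        have h7 : ∑ j, (Pi.single i 1 : Fin f → ℕ) j = 1 := by simp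
        simp only [Pi.add_apply, Finset.sum_add_distrib, h7]
        have := mem_piAntidiag_univ.1 hα
        omega) _ h3
      rw [Finset.sum_eq_zero fun α hα => by rw [h6 α hα, zero_smul], sub_zero] at h2
      exact h2
  exact key a le_rfl

/-- The graded ring is reduced: the `p`-th power of the initial form has coefficients `c_α ^ p` at
the distinct monomials with exponents `p α`. -/
theorem IsUnramified.mem_of_pow_mem (hG : IsUnramified p f G) (τ : G →+* F)
    {a : ℕ} {x : iwasawa p G F} (hx : x ^ p ∈ idealT p f τ ^ (p * a)) :
    x ∈ idealT p f τ ^ a := by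
  have hpF : ∀ y z : iwasawa p G F, (y + z) ^ p = y ^ p + z ^ p :=
    fun y z => (frobHom p F (iwasawa p G F)).map_add y z
  have hps : ∀ (s : Finset (Fin f → ℕ)) (y : (Fin f → ℕ) → iwasawa p G F),
      (∑ α ∈ s, y α) ^ p = ∑ α ∈ s, y α ^ p :=
    fun s y => map_sum (frobHom p F (iwasawa p G F)) y s
  have key : ∀ d ≤ a, x ∈ idealT p f τ ^ d := by
    intro d
    induction d with
    | zero => intro _; simp
    | succ d ih =>
      intro hd
      have h1 := ih (by omega)
      have h2 := hG.sub_initial_mem τ h1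
      have h3 : ∑ α ∈ Finset.piAntidiag Finset.univ d,
          hG.coef τ α x ^ p • mon p f τ (p • α) ∈ idealT p f τ ^ (p * d + 1) := by
        have h4 := Ideal.pow_mem_pow h2 p
        rw [← pow_mul] at h4
        have h5 := hpF (x - ∑ α ∈ Finset.piAntidiag Finset.univ d,
          hG.coef τ α x • mon p f τ α) (∑ α ∈ Finset.piAntidiag Finset.univ d,
          hG.coef τ α x • mon p f τ α)
        rw [sub_add_cancel] at h5
        have h6 := sub_mem (Ideal.pow_le_pow_right (m := p * d + 1)
            (by have := hp.out.pos; nlinarith) hx)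
          (Ideal.pow_le_pow_right (m := p * d + 1) (by have := hp.out.pos; nlinarith) h4)
        rw [h5, add_sub_cancel_left, hps] at h6
        convert h6 using 2 with α
        rw [smul_pow, mon, mon, ← Finset.prod_pow]
        congr 1
        refine Finset.prod_congr rfl fun i _ => ?_
        rw [← pow_mul, Pi.smul_apply, smul_eq_mul, mul_comm]
      have h6 := hG.coeff_eq_zero_of_sum_mem τ _ (fun α => p • α)
        (fun α β h => funext fun i => by
          have := congrFun h i
          simpa [hp.out.ne_zero] using this) (by
        intro α hα
        simp only [Pi.smul_apply, smul_eq_mul, ← Finset.mul_sum]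
        have := mem_piAntidiag_univ.1 hα
        rw [this]
        omega) _ h3
      rw [Finset.sum_eq_zero fun α hα => by
        rw [(pow_eq_zero_iff hp.out.ne_zero).1 (h6 α hα), zero_smul], sub_zero] at h2
      exact h2
  exact key a le_rfl

theorem IsUnramified.one_notMem_idealT (hG : IsUnramified p f G) (τ : G →+* F) :
    (1 : iwasawa p G F) ∉ idealT p f τ := by
  classical
  intro h
  rw [← pow_one (idealT p f τ), hG.mem_idealT_pow_iff] at h
  have h1 := h 0 (by simp)
  have h2 : mon p f τ 0 = 1 := by simp [mon]
  rw [← h2, hG.coef_mon, if_pos rfl] at h1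
  exact one_ne_zero h1

end Coef

/-! ### The graded ring of the Iwasawa algebra in mixed characteristic -/

/-- Construction of a sequence by successive choices. -/
theorem exists_seq_of_step {α : Type*} (P : ℕ → α → Prop) (S : ℕ → α → α → Prop) (x : α)
    (hx : P 0 x) (h : ∀ n x, P n x → ∃ y, P (n + 1) y ∧ S n x y) :
    ∃ s : ℕ → α, s 0 = x ∧ ∀ n, P n (s n) ∧ S n (s n) (s (n + 1)) := by
  choose next h1 h2 using h
  let seq : ∀ n, {y // P n y} :=
    fun n => Nat.rec ⟨x, hx⟩ (fun n y => ⟨next n y.1 y.2, h1 n y.1 y.2⟩) n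
  exact ⟨fun n => (seq n).1, rfl, fun n => ⟨(seq n).2, h2 n (seq n).1 (seq n).2⟩⟩

/-- A `p`-torsion free `p`-adically complete coefficient ring `R` with residue field `F`. -/
structure IsCoeffRing (p : ℕ) {R F : Type*} [CommRing R] [CommRing F] (r : R →+* F) : Prop where
  complete : IsAdicComplete (Ideal.span {(p : R)}) R
  surjective : Function.Surjective r
  ker : ∀ c, r c = 0 → c ∈ Ideal.span {(p : R)}
  torsion_free : ∀ c : R, (p : R) * c = 0 → c = 0

section

variable {p f : ℕ} [hp : Fact p.Prime] {G : Type*} [CommRing G] [IsDomain G]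
  {F : Type*} [Field F] [CharP F p] {R : Type*} [CommRing R] {r : R →+* F}

theorem IsCoeffRing.p_mul_eq_zero (hr : IsCoeffRing p r) {x : iwasawa p G R}
    (hx : (p : iwasawa p G R) * x = 0) : x = 0 := by
  refine iwasawa_ext p fun n => ?_
  have h1 : (p : R) • lev p R n x = 0 := by
    rw [Algebra.smul_def, map_natCast, ← map_natCast (lev p R n), ← map_mul, hx, map_zero]
  rw [map_zero]
  ext g
  exact hr.torsion_free _ (congrArg (fun u => AddMonoidAlgebra.coeff u g) h1)

theorem red_natCast_p (x : iwasawa p G R) : red p r ((p : iwasawa p G R) * x) = 0 := by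
  refine iwasawa_ext p fun n => ?_
  rw [map_mul, map_natCast, map_mul, map_natCast, natCast_finLevel_eq_zero, zero_mul, map_zero]

theorem IsUnramified.red_mon (hG : IsUnramified p f G) (τ : G →+* R) (α : Fin f → ℕ) :
    red p r (mon p f τ α) = mon p f (r.comp τ) α := by
  simp [mon, red_T p r hG]

theorem IsUnramified.red_mem (hG : IsUnramified p f G) (τ : G →+* R) {a : ℕ} {x : iwasawa p G R}
    (hx : x ∈ idealT p f τ ^ a) : red p r x ∈ idealT p f (r.comp τ) ^ a := by
  have h : idealT p f τ ≤ (idealT p f (r.comp τ)).comap (red p r) := by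
    refine Ideal.span_le.2 ?_
    rintro _ ⟨i, rfl⟩
    change red p r (T p f τ i) ∈ idealT p f (r.comp τ)
    rw [red_T p r hG]
    exact T_mem p f _ i
  exact Ideal.le_comap_pow _ a (Ideal.pow_right_mono h a hx)

theorem IsCoeffRing.red_surjective (hr : IsCoeffRing p r) (hG : IsUnramified p f G) :
    Function.Surjective (red p r : iwasawa p G R →+* iwasawa p G F) :=
  have := hG.finite_quot
  MvIwasawa.red_surjective p r hr.surjective hr.ker

theorem IsCoeffRing.red_eq_zero (hr : IsCoeffRing p r) (hG : IsUnramified p f G)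
    {x : iwasawa p G R} (hx : red p r x = 0) : ∃ y, x = p * y :=
  have := hG.finite_quot
  MvIwasawa.red_eq_zero r hr.ker hr.torsion_free hx

theorem IsCoeffRing.exists_red_eq (hr : IsCoeffRing p r) (hG : IsUnramified p f G) (τ : G →+* R)
    {a : ℕ} {x : iwasawa p G F} (hx : x ∈ idealT p f (r.comp τ) ^ a) :
    ∃ y ∈ idealT p f τ ^ a, red p r y = x := by
  rw [mem_idealT_pow_iff_exists] at hx
  obtain ⟨c, rfl⟩ := hx
  choose d hd using fun α => hr.red_surjective hG (c α)
  refine ⟨∑ α ∈ Finset.piAntidiag Finset.univ a, d α * mon p f τ α,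
    (mem_idealT_pow_iff_exists p f τ a _).2 ⟨d, rfl⟩, ?_⟩
  simp [hd, hG.red_mon]

/-- If `p Q` lies in `I ^ a`, then so does `Q` up to an error `Q'` such that `p Q'` lies in
`I ^ (a + 1)`. -/
theorem IsCoeffRing.exists_approx (hr : IsCoeffRing p r) (hG : IsUnramified p f G) (τ : G →+* R)
    (a : ℕ) (Q : iwasawa p G R) (hQ : (p : iwasawa p G R) * Q ∈ idealT p f τ ^ a) :
    ∃ Q' : iwasawa p G R, (p : iwasawa p G R) * Q' ∈ idealT p f τ ^ (a + 1) ∧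
      Q - Q' ∈ idealT p f τ ^ a := by
  obtain ⟨c, hc⟩ := (mem_idealT_pow_iff_exists p f τ a _).1 hQ
  have h0 : ∀ y : iwasawa p G F, y - hG.coef (r.comp τ) 0 y • 1 ∈ idealT p f (r.comp τ) := by
    intro y
    have h := hG.sub_initial_mem (r.comp τ) (a := 0) (x := y) (by simp)
    have h1 : mon p f (r.comp τ) 0 = 1 := by simp [mon]
    simpa [h1] using h
  -- the reduction of `p Q = ∑ c_α T ^ α` is zero, so that the `c_α` have zero constant term modulo
  -- `p`
  have h1 : ∀ α ∈ Finset.piAntidiag Finset.univ a, hG.coef (r.comp τ) 0 (red p r (c α)) = 0 := by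
    refine hG.coeff_eq_zero_of_sum_mem (r.comp τ) (k := a + 1) _ id Function.injective_id
      (fun α hα => by rw [id, mem_piAntidiag_univ.1 hα]; omega) _ ?_
    have h2 : ∑ α ∈ Finset.piAntidiag Finset.univ a, red p r (c α) * mon p f (r.comp τ) α = 0 := by
      have := congrArg (red p r) hc
      rw [red_natCast_p, map_sum] at this
      rw [this]
      exact Finset.sum_congr rfl fun α _ => by rw [map_mul, hG.red_mon]
    have h3 : ∑ α ∈ Finset.piAntidiag Finset.univ a,
        (red p r (c α) - hG.coef (r.comp τ) 0 (red p r (c α)) • 1) * mon p f (r.comp τ) α ∈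
          idealT p f (r.comp τ) ^ (a + 1) := by
      refine Ideal.sum_mem _ fun α hα => ?_
      rw [pow_succ']
      have h4 := mon_mem p f (r.comp τ) α
      rw [mem_piAntidiag_univ.1 hα] at h4
      exact Ideal.mul_mem_mul (h0 _) h4
    simp only [sub_mul, Finset.sum_sub_distrib, h2, zero_sub, smul_mul_assoc, one_mul] at h3
    exact neg_mem_iff.1 h3
  -- hence `c_α = e_α + p d_α` with `e_α ∈ I`, and `Q - ∑ d_α T ^ α` is the required error
  have h2 : ∀ α, ∃ e d : iwasawa p G R, α ∈ Finset.piAntidiag Finset.univ a →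
      e ∈ idealT p f τ ∧ c α = e + p * d := by
    intro α
    by_cases hα : α ∈ Finset.piAntidiag Finset.univ a
    · have h3 := h0 (red p r (c α))
      rw [h1 α hα, zero_smul, sub_zero, ← pow_one (idealT p f (r.comp τ))] at h3
      obtain ⟨e, he, he'⟩ := hr.exists_red_eq hG τ h3
      obtain ⟨d, hd⟩ := hr.red_eq_zero hG (x := c α - e) (by rw [map_sub, he', sub_self])
      exact ⟨e, d, fun _ => ⟨by simpa using he, by rw [← hd]; ring⟩⟩
    · exact ⟨0, 0, fun h => absurd h hα⟩
  choose e d hed using h2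
  refine ⟨Q - ∑ α ∈ Finset.piAntidiag Finset.univ a, d α * mon p f τ α, ?_, ?_⟩
  · have h3 : (p : iwasawa p G R) *
        (Q - ∑ α ∈ Finset.piAntidiag Finset.univ a, d α * mon p f τ α) =
        ∑ α ∈ Finset.piAntidiag Finset.univ a, e α * mon p f τ α := by
      rw [mul_sub, hc, Finset.mul_sum, ← Finset.sum_sub_distrib]
      refine Finset.sum_congr rfl fun α hα => ?_
      rw [(hed α hα).2]
      ring
    rw [h3]
    refine Ideal.sum_mem _ fun α hα => ?_
    have h4 := mon_mem p f τ α
    rw [mem_piAntidiag_univ.1 hα] at h4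
    rw [pow_succ']
    exact Ideal.mul_mem_mul (hed α hα).1 h4
  · rw [sub_sub_cancel]
    exact (mem_idealT_pow_iff_exists p f τ a _).2 ⟨d, rfl⟩

/-- The quotients by the powers of the ideal of the variables are `p`-torsion free. -/
theorem IsCoeffRing.mem_of_p_mul_mem (hr : IsCoeffRing p r) (hG : IsUnramified p f G)
    (τ : G →+* R) {a : ℕ} {Q : iwasawa p G R}
    (hQ : (p : iwasawa p G R) * Q ∈ idealT p f τ ^ a) : Q ∈ idealT p f τ ^ a := by
  have := hr.complete
  obtain ⟨s, hs0, hs⟩ := exists_seq_of_step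
    (fun b (y : iwasawa p G R) => (p : iwasawa p G R) * y ∈ idealT p f τ ^ (a + b))
    (fun b y z => y - z ∈ idealT p f τ ^ (a + b)) Q hQ
    (fun b y hy => hr.exists_approx hG τ (a + b) y hy)
  have hle : ∀ b, idealT p f τ ^ (a + b) ≤ maxT p f τ ^ b * idealT p f τ ^ a := fun b => by
    rw [add_comm, pow_add]
    exact Ideal.mul_mono_left (Ideal.pow_right_mono (idealT_le_maxT τ) b)
  obtain ⟨x, hx, hx'⟩ := hG.exists_conv_mem r hr.ker τ a (fun b => s b - s (b + 1))
    fun b => hle b (hs b).2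
  -- iterating, `p Q` is `p` times the convergent series of the corrections, which lies in `I ^ a`
  have h1 : Conv (fun B => (p : iwasawa p G R) *
      ∑ b ∈ Finset.range B, (s b - s (b + 1))) (p * Q) := by
    intro n k
    obtain ⟨M, hM⟩ := hG.exists_lev_maxT_pow r hr.ker τ n
    refine ⟨M * k, fun B hB => hM k _ ?_⟩
    have h3 : (p : iwasawa p G R) * ∑ b ∈ Finset.range B, (s b - s (b + 1)) - p * Q =
        -((p : iwasawa p G R) * s B) := by
      rw [Finset.sum_range_sub' s, hs0]
      ring
    rw [h3]
    exact (Ideal.neg_mem_iff _).2 (Ideal.pow_le_pow_right (hB.trans (Nat.le_add_left B a))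
      (Ideal.pow_right_mono (idealT_le_maxT τ) _ (hs B).1))
  have h2 := h1.unique hG (hx'.const_mul _)
  rw [← sub_eq_zero, ← mul_sub] at h2
  rwa [sub_eq_zero.1 (hr.p_mul_eq_zero h2)]

/-- The variables are regular on the graded ring: modulo `p` this is the case of a field of
coefficients, and the remainder, divisible by `p`, satisfies the same hypothesis after division by
`p`. -/
theorem IsCoeffRing.mem_of_T_mul_mem (hr : IsCoeffRing p r) (hG : IsUnramified p f G)
    (τ : G →+* R) {i : Fin f} {a : ℕ} {Q : iwasawa p G R}
    (hQ : T p f τ i * Q ∈ idealT p f τ ^ (a + 1)) : Q ∈ idealT p f τ ^ a := by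
  have := hr.complete
  have step : ∀ Q : iwasawa p G R, T p f τ i * Q ∈ idealT p f τ ^ (a + 1) →
      ∃ Q' : iwasawa p G R, T p f τ i * Q' ∈ idealT p f τ ^ (a + 1) ∧
        Q - (p : iwasawa p G R) * Q' ∈ idealT p f τ ^ a := by
    intro Q hQ
    have h1 : red p r Q ∈ idealT p f (r.comp τ) ^ a := by
      refine hG.mem_of_T_mul_mem (r.comp τ) (i := i) ?_
      rw [← red_T p r hG, ← map_mul]
      exact hG.red_mem τ hQ
    obtain ⟨Q₁, h2, h3⟩ := hr.exists_red_eq hG τ h1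
    obtain ⟨Q', h4⟩ := hr.red_eq_zero hG (x := Q - Q₁) (by rw [map_sub, h3, sub_self])
    refine ⟨Q', hr.mem_of_p_mul_mem hG τ ?_, ?_⟩
    · rw [mul_left_comm, ← h4, mul_sub]
      refine sub_mem hQ ?_
      rw [pow_succ']
      exact Ideal.mul_mem_mul (T_mem p f τ i) h2
    · rwa [← h4, sub_sub_cancel]
  obtain ⟨s, hs0, hs⟩ := exists_seq_of_step
    (fun _ (y : iwasawa p G R) => T p f τ i * y ∈ idealT p f τ ^ (a + 1))
    (fun _ y z => y - (p : iwasawa p G R) * z ∈ idealT p f τ ^ a) Q hQ (fun _ y hy => step y hy)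
  have hpm : (p : iwasawa p G R) ∈ maxT p f τ :=
    Ideal.mem_sup_right (Ideal.mem_span_singleton_self _)
  obtain ⟨x, hx, hx'⟩ := hG.exists_conv_mem r hr.ker τ a
    (fun b => (p : iwasawa p G R) ^ b * (s b - (p : iwasawa p G R) * s (b + 1)))
    fun b => Ideal.mul_mem_mul (Ideal.pow_mem_pow hpm b) (hs b).2
  have h1 : Conv (fun B => ∑ b ∈ Finset.range B,
      (p : iwasawa p G R) ^ b * (s b - (p : iwasawa p G R) * s (b + 1))) Q := by
    intro n k
    refine ⟨k, fun B hB => ?_⟩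
    have h2 : ∀ b, (p : iwasawa p G R) ^ b * (s b - (p : iwasawa p G R) * s (b + 1)) =
        (p : iwasawa p G R) ^ b * s b - (p : iwasawa p G R) ^ (b + 1) * s (b + 1) :=
      fun b => by ring
    simp only [h2]
    rw [Finset.sum_range_sub' fun b => (p : iwasawa p G R) ^ b * s b, pow_zero, one_mul, hs0,
      sub_sub_cancel_left, map_neg, map_mul, map_pow, map_natCast]
    exact neg_mem (Ideal.mul_mem_right _ _
      (Ideal.mem_span_singleton.2 (pow_dvd_pow _ hB)))
  rwa [h1.unique hG hx']

end

/-! ### Completions for topologies given by subgroups -/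

open Filter Topology UniformSpace

/-- The decreasing subgroups `U k` form a basis of neighbourhoods of `0` for which the group is
separated and complete. -/
structure IsComplSeq {B : Type*} [AddCommGroup B] [TopologicalSpace B] (U : ℕ → AddSubgroup B) :
    Prop where
  anti : Antitone U
  mem_nhds : ∀ s : Set B, s ∈ 𝓝 (0 : B) ↔ ∃ k, (U k : Set B) ⊆ s
  sep : ∀ x, (∀ k, x ∈ U k) → x = 0
  compl : ∀ s : ℕ → B, (∀ k, s (k + 1) - s k ∈ U k) → ∃ x, ∀ k, x - s k ∈ U k

namespace IsComplSeq

variable {B : Type*} [TopologicalSpace B]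

section Add

variable [AddCommGroup B] [IsTopologicalAddGroup B] {U : ℕ → AddSubgroup B}

theorem isOpen (h : IsComplSeq U) (k : ℕ) : IsOpen (U k : Set B) :=
  AddSubgroup.isOpen_of_mem_nhds _ (g := 0) ((h.mem_nhds _).2 ⟨k, subset_rfl⟩)

theorem t2Space (h : IsComplSeq U) : T2Space B := by
  refine IsTopologicalAddGroup.t2Space_of_zero_sep fun x hx => ?_
  by_contra hcon
  refine hx (h.sep x fun k => ?_)
  by_contra hk
  exact hcon ⟨U k, (h.mem_nhds _).2 ⟨k, subset_rfl⟩, hk⟩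

theorem tendsto_iff (h : IsComplSeq U) {α : Type*} {l : Filter α} {s : α → B} {x : B} :
    Tendsto s l (𝓝 x) ↔ ∀ k, ∀ᶠ a in l, s a - x ∈ U k := by
  rw [← tendsto_sub_nhds_zero_iff]
  constructor
  · exact fun H k => H ((h.mem_nhds _).2 ⟨k, subset_rfl⟩)
  · intro H s hs
    obtain ⟨k, hk⟩ := (h.mem_nhds _).1 hs
    exact (H k).mono fun a ha => hk ha

theorem mem_closure_iff (h : IsComplSeq U) {S : Set B} {x : B} :
    x ∈ closure S ↔ ∀ k, ∃ y ∈ S, x - y ∈ U k := by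
  rw [mem_closure_iff_nhds]
  constructor
  · intro H k
    have h1 : (fun y => x - y) ⁻¹' (U k : Set B) ∈ 𝓝 x := by
      refine ContinuousAt.preimage_mem_nhds (by fun_prop) ?_
      rw [sub_self]
      exact (h.mem_nhds _).2 ⟨k, subset_rfl⟩
    obtain ⟨y, hy, hy'⟩ := H _ h1
    exact ⟨y, hy', hy⟩
  · intro H s hs
    have h1 : (fun y => x - y) ⁻¹' s ∈ 𝓝 (0 : B) := by
      refine ContinuousAt.preimage_mem_nhds (by fun_prop) ?_
      rwa [sub_zero]
    obtain ⟨k, hk⟩ := (h.mem_nhds _).1 h1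
    obtain ⟨y, hy, hy'⟩ := H k
    exact ⟨y, by simpa using hk hy', hy⟩

theorem completeSpace (h : IsComplSeq U) :
    let _ := IsTopologicalAddGroup.rightUniformSpace B
    CompleteSpace B := by
  let _ := IsTopologicalAddGroup.rightUniformSpace B
  have : IsUniformAddGroup B := isUniformAddGroup_of_addCommGroup
  have hu : uniformity B = comap (fun x : B × B => x.2 - x.1) (𝓝 0) :=
    uniformity_eq_comap_nhds_zero B
  have hn : (𝓝 (0 : B)).HasBasis (fun _ : ℕ => True) fun k => (U k : Set B) :=
    ⟨fun s => by simpa using h.mem_nhds s⟩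
  have : (uniformity B).IsCountablyGenerated := by
    have := hn.isCountablyGenerated
    rw [hu]
    infer_instance
  refine UniformSpace.complete_of_convergent_controlled_sequences
    (fun k => (fun x : B × B => x.2 - x.1) ⁻¹' (U k : Set B)) (fun k => ?_) fun s hs => ?_
  · rw [hu]
    exact preimage_mem_comap (hn.mem_of_mem trivial)
  · obtain ⟨x, hx⟩ := h.compl s fun k => hs k k (k + 1) le_rfl k.le_succ
    refine ⟨x, h.tendsto_iff.2 fun k => ?_⟩
    filter_upwards [eventually_ge_atTop k] with a ha
    exact h.anti ha (by simpa using neg_mem (hx a))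

end Add

theorem exists_completion_extension [CommRing B] [IsTopologicalRing B] {U : ℕ → AddSubgroup B}
    (h : IsComplSeq U) {L : Type*} [CommRing L] [UniformSpace L] [IsUniformAddGroup L]
    [IsTopologicalRing L] (φ : L →+* B) (hφ : Continuous φ) :
    ∃ Φ : Completion L →+* B, Continuous Φ ∧ ∀ x : L, Φ x = φ x := by
  let _ := IsTopologicalAddGroup.rightUniformSpace B
  have : IsUniformAddGroup B := isUniformAddGroup_of_addCommGroup
  have := h.completeSpace
  have := h.t2Space
  exact ⟨Completion.extensionHom φ hφ, Completion.continuous_extension,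
    Completion.extensionHom_coe φ hφ⟩

end IsComplSeq

/-- A ring with a filtration for which it is separated and complete. -/
structure IsComplFil {B : Type*} [CommRing B] [TopologicalSpace B] (F : ℤ → AddSubgroup B) :
    Prop where
  isRingFil : IsRingFil F
  complSeq : IsComplSeq fun k : ℕ => F k

namespace IsComplFil

variable {B : Type*} [CommRing B] [TopologicalSpace B] [IsTopologicalRing B]
  {F : ℤ → AddSubgroup B}

theorem exists_le (k : ℤ) : ∃ n : ℕ, k ≤ n := ⟨k.toNat, Int.self_le_toNat k⟩

theorem isOpen (h : IsComplFil F) (k : ℤ) : IsOpen (F k : Set B) := by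
  obtain ⟨n, hn⟩ := exists_le k
  exact AddSubgroup.isOpen_mono (h.isRingFil.anti hn) (h.complSeq.isOpen n)

theorem isClosed (h : IsComplFil F) (k : ℤ) : IsClosed (F k : Set B) :=
  AddSubgroup.isClosed_of_isOpen _ (h.isOpen k)

theorem mem_nhds (h : IsComplFil F) (s : Set B) : s ∈ 𝓝 (0 : B) ↔ ∃ k, (F k : Set B) ⊆ s := by
  rw [h.complSeq.mem_nhds]
  constructor
  · rintro ⟨k, hk⟩
    exact ⟨k, hk⟩
  · rintro ⟨k, hk⟩
    obtain ⟨n, hn⟩ := exists_le k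
    exact ⟨n, (show (F n : Set B) ⊆ F k from h.isRingFil.anti hn).trans hk⟩

/-- Elements `1 + x` with `x` of positive valuation are invertible. -/
theorem exists_mul_eq_one (h : IsComplFil F) {x : B} (hx : x ∈ F 1) :
    ∃ y ∈ F 0, (1 + x) * y = 1 := by
  obtain ⟨y, hy⟩ := h.complSeq.compl (fun k => ∑ i ∈ Finset.range k, (-x) ^ i) fun k => by
    rw [Finset.sum_range_succ, add_sub_cancel_left]
    simpa using h.isRingFil.pow_mem (neg_mem hx) k
  refine ⟨y, by simpa using hy 0, ?_⟩
  rw [← sub_eq_zero]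
  refine h.complSeq.sep _ fun k => ?_
  have h1 : (1 + x) * y - 1 =
      (1 + x) * (y - ∑ i ∈ Finset.range k, (-x) ^ i) - (-x) ^ k := by
    have h2 := mul_neg_geom_sum (-x) k
    rw [sub_neg_eq_add] at h2
    rw [mul_sub, h2]
    ring
  rw [h1]
  refine sub_mem ?_ (by simpa using h.isRingFil.pow_mem (neg_mem hx) k)
  have h3 : 1 + x ∈ F 0 := add_mem h.isRingFil.one_mem (h.isRingFil.anti zero_le_one hx)
  simpa using h.isRingFil.mul_mem h3 (hy k)

/-- An element of valuation at least `m` that is approximated by an element of valuation `m`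
invertible in the graded sense is invertible in that sense. -/
theorem exists_mul_eq_one_of_sub_mem (h : IsComplFil F) {m : ℤ} {u v x : B} (hv : v ∈ F (-m))
    (huv : u * v = 1) (hx : x - u ∈ F (m + 1)) : ∃ y ∈ F (-m), x * y = 1 := by
  have h1 := h.isRingFil.mul_mem hx hv
  rw [show m + 1 + -m = 1 by ring] at h1
  obtain ⟨y, hy, hy'⟩ := h.exists_mul_eq_one h1
  refine ⟨v * y, by simpa using h.isRingFil.mul_mem hv hy, ?_⟩
  rw [← hy', sub_mul, huv]
  ring

end IsComplFil

section Completion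

variable {L : Type*} [CommRing L] [UniformSpace L] [IsUniformAddGroup L] [IsTopologicalRing L]

/-- The filtration of the completion by the closures of the steps of a filtration. -/
def complFil (F : ℤ → AddSubgroup L) (m : ℤ) : AddSubgroup (Completion L) :=
  ((F m).map (Completion.coeRingHom (α := L)).toAddMonoidHom).topologicalClosure

variable {F : ℤ → AddSubgroup L}

theorem mem_complFil_iff {m : ℤ} {x : Completion L} :
    x ∈ complFil F m ↔ x ∈ closure ((fun y : L => (y : Completion L)) '' (F m : Set L)) := Iff.rfl

theorem coe_mem_complFil
    (hn : ∀ s : Set L, s ∈ 𝓝 (0 : L) ↔ ∃ k, (F k : Set L) ⊆ s) {m : ℤ} {x : L} :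
    (x : Completion L) ∈ complFil F m ↔ x ∈ F m := by
  have h1 : IsClosed (F m : Set L) := AddSubgroup.isClosed_of_isOpen _
    (AddSubgroup.isOpen_of_mem_nhds _ (g := 0) ((hn _).2 ⟨m, subset_rfl⟩))
  rw [mem_complFil_iff, ← Set.mem_preimage,
    ← (Completion.isUniformInducing_coe L).isInducing.closure_eq_preimage_closure_image,
    h1.closure_eq, SetLike.mem_coe]

theorem complFil_isOpen (hn : ∀ s : Set L, s ∈ 𝓝 (0 : L) ↔ ∃ k, (F k : Set L) ⊆ s) (m : ℤ) :
    IsOpen (complFil F m : Set (Completion L)) :=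
  AddSubgroup.isOpen_of_mem_nhds _ (g := 0)
    (Completion.isDenseInducing_coe.closure_image_mem_nhds ((hn _).2 ⟨m, subset_rfl⟩))

theorem complFil_mem_nhds (hn : ∀ s : Set L, s ∈ 𝓝 (0 : L) ↔ ∃ k, (F k : Set L) ⊆ s)
    (s : Set (Completion L)) :
    s ∈ 𝓝 (0 : Completion L) ↔ ∃ k, (complFil F k : Set (Completion L)) ⊆ s := by
  constructor
  · intro hs
    obtain ⟨t, ht, htc, hts⟩ := exists_mem_nhds_isClosed_subset hs
    have h1 : (fun y : L => (y : Completion L)) ⁻¹' t ∈ 𝓝 (0 : L) :=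
      (Completion.continuous_coe L).continuousAt.preimage_mem_nhds ht
    obtain ⟨k, hk⟩ := (hn _).1 h1
    exact ⟨k, (closure_minimal (Set.image_subset_iff.2 hk) htc).trans hts⟩
  · rintro ⟨k, hk⟩
    exact mem_of_superset ((complFil_isOpen hn k).mem_nhds (zero_mem _)) hk

theorem exists_sub_coe_mem_complFil (hn : ∀ s : Set L, s ∈ 𝓝 (0 : L) ↔ ∃ k, (F k : Set L) ⊆ s)
    (x : Completion L) (m : ℤ) : ∃ y : L, x - (y : Completion L) ∈ complFil F m := by
  obtain ⟨y, hy⟩ := Completion.denseRange_coe.exists_mem_open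
    ((complFil_isOpen hn m).preimage (continuous_const.sub continuous_id :
      Continuous fun z => x - z)) ⟨x, by simp [zero_mem]⟩
  exact ⟨y, hy⟩

theorem complFil_isRingFil (hF : IsRingFil F)
    (hn : ∀ s : Set L, s ∈ 𝓝 (0 : L) ↔ ∃ k, (F k : Set L) ⊆ s) : IsRingFil (complFil F) where
  anti := fun m n h => AddSubgroup.topologicalClosure_mono (AddSubgroup.map_mono (hF.anti h))
  one_mem := subset_closure ⟨1, hF.one_mem, Completion.coe_one L⟩
  mul_mem := by
    intro m n x y hx hy
    refine map_mem_closure₂ (f := fun a b : Completion L => a * b) continuous_mul hx hy ?_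
    rintro _ ⟨a, ha, rfl⟩ _ ⟨b, hb, rfl⟩
    exact ⟨a * b, hF.mul_mem ha hb, Completion.coe_mul a b⟩
  exists_mem := by
    intro x
    obtain ⟨y, hy⟩ := exists_sub_coe_mem_complFil hn x 0
    obtain ⟨m, hm⟩ := hF.exists_mem y
    refine ⟨min m 0, ?_⟩
    have h1 := AddSubgroup.topologicalClosure_mono (AddSubgroup.map_mono (f :=
      (Completion.coeRingHom (α := L)).toAddMonoidHom) (hF.anti (min_le_right m 0))) hy
    have h2 : (y : Completion L) ∈ complFil F (min m 0) :=
      (coe_mem_complFil hn).2 (hF.anti (min_le_left m 0) hm)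
    rw [← sub_add_cancel x (y : Completion L)]
    exact add_mem h1 h2

theorem complFil_isComplFil (hF : IsRingFil F)
    (hn : ∀ s : Set L, s ∈ 𝓝 (0 : L) ↔ ∃ k, (F k : Set L) ⊆ s) : IsComplFil (complFil F) where
  isRingFil := complFil_isRingFil hF hn
  complSeq :=
    { anti := fun m n h => (complFil_isRingFil hF hn).anti (by exact_mod_cast h)
      mem_nhds := fun s => by
        rw [complFil_mem_nhds hn]
        constructor
        · rintro ⟨k, hk⟩
          obtain ⟨n, hn'⟩ := IsComplFil.exists_le k
          exact ⟨n, (show (complFil F n : Set (Completion L)) ⊆ complFil F k from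
            (complFil_isRingFil hF hn).anti hn').trans hk⟩
        · rintro ⟨k, hk⟩
          exact ⟨k, hk⟩
      sep := fun x hx => by
        by_contra hne
        have h1 : ({x}ᶜ : Set (Completion L)) ∈ 𝓝 0 :=
          isOpen_compl_singleton.mem_nhds (Ne.symm hne)
        obtain ⟨k, hk⟩ := (complFil_mem_nhds hn _).1 h1
        obtain ⟨n, hn'⟩ := IsComplFil.exists_le k
        exact hk ((complFil_isRingFil hF hn).anti hn' (hx n)) rfl
      compl := fun s hs => by
        have hanti := (complFil_isRingFil hF hn).anti
        have h1 : ∀ k l : ℕ, k ≤ l → s l - s k ∈ complFil F (k : ℤ) := by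
          intro k l hkl
          induction l, hkl using Nat.le_induction with
          | base => simp [zero_mem]
          | succ l hkl ih =>
            rw [← sub_add_sub_cancel (s (l + 1)) (s l) (s k)]
            exact add_mem (hanti (by exact_mod_cast hkl) (hs l)) ih
        have h2 : CauchySeq s := by
          refine cauchySeq_iff.2 fun V hV => ?_
          rw [uniformity_eq_comap_nhds_zero, mem_comap] at hV
          obtain ⟨t, ht, htV⟩ := hV
          obtain ⟨k, hk⟩ := (complFil_mem_nhds hn _).1 ht
          obtain ⟨n, hn'⟩ := IsComplFil.exists_le k
          refine ⟨n, fun a ha b hb => htV (hk (hanti hn' ?_))⟩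
          have h3 := sub_mem (h1 n b hb) (h1 n a ha)
          rwa [sub_sub_sub_cancel_right] at h3
        obtain ⟨x, hx⟩ := cauchySeq_tendsto_of_complete h2
        refine ⟨x, fun k => ?_⟩
        have h3 : IsClosed (complFil F (k : ℤ) : Set (Completion L)) :=
          AddSubgroup.isClosed_of_isOpen _ (complFil_isOpen hn k)
        refine h3.mem_of_tendsto (hx.sub_const (s k)) ?_
        filter_upwards [eventually_ge_atTop k] with l hl
        exact h1 k l hl }

end Completion

/-! ### The filtration of the localization and of its completion -/

section Loc

variable {p f : ℕ} {G R : Type*} [CommRing G] [CommRing R] {τ : G →+* R}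

theorem prodT_pow_mul_mem {a b k : ℕ} {Q : iwasawa p G R} (hQ : Q ∈ idealT p f τ ^ a)
    (h : b ≤ a + k * f) : prodT p f τ ^ k * Q ∈ idealT p f τ ^ b := by
  have h1 := Ideal.mul_mem_mul (Ideal.pow_mem_pow (prodT_mem p f τ) k) hQ
  rw [← pow_mul, ← pow_add] at h1
  exact Ideal.pow_le_pow_right (by rw [mul_comm f k]; omega) h1

variable (hreg : ∀ (i : Fin f) (a : ℕ) (Q : iwasawa p G R),
  T p f τ i * Q ∈ idealT p f τ ^ (a + 1) → Q ∈ idealT p f τ ^ a)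
include hreg

theorem mem_of_prodT_mul_mem {a : ℕ} {Q : iwasawa p G R}
    (hQ : prodT p f τ * Q ∈ idealT p f τ ^ (a + f)) : Q ∈ idealT p f τ ^ a := by
  have key : ∀ (s : Finset (Fin f)) (a : ℕ) (Q : iwasawa p G R),
      (∏ i ∈ s, T p f τ i) * Q ∈ idealT p f τ ^ (a + s.card) → Q ∈ idealT p f τ ^ a := by
    classical
    intro s
    induction s using Finset.induction_on with
    | empty => intro a Q h; simpa using h
    | insert i s hi ih =>
      intro a Q h
      rw [Finset.prod_insert hi, Finset.card_insert_of_notMem hi, mul_assoc, ← add_assoc] at h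
      exact ih a Q (hreg i _ _ h)
  refine key Finset.univ a Q ?_
  rwa [Finset.card_univ, Fintype.card_fin]

theorem mem_of_prodT_pow_mul_mem {a b k : ℕ} {Q : iwasawa p G R}
    (hQ : prodT p f τ ^ k * Q ∈ idealT p f τ ^ b) (h : a + k * f ≤ b) :
    Q ∈ idealT p f τ ^ a := by
  have h1 := Ideal.pow_le_pow_right h hQ
  clear h hQ
  induction k generalizing a with
  | zero => simpa using h1
  | succ k ih =>
    rw [pow_succ', mul_assoc, show a + (k + 1) * f = a + k * f + f by ring] at h1
    exact ih (mem_of_prodT_mul_mem hreg h1)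

/-- Membership in the filtration can be tested on any representation as a fraction. -/
theorem mem_locFil_iff {m : ℤ} {x : Loc p f τ} {k : ℕ} {Q : iwasawa p G R}
    (hx : x * toLoc p f τ (prodT p f τ) ^ k = toLoc p f τ Q) :
    x ∈ locFil p f τ m ↔ Q ∈ idealT p f τ ^ (m + k * f).toNat := by
  refine ⟨?_, fun h => ⟨k, Q, h, hx⟩⟩
  rintro ⟨l, P, hP, hx'⟩
  rcases le_total (m + k * f) 0 with h4 | h4
  · rw [Int.toNat_of_nonpos h4]
    simp
  have h1 : toLoc p f τ (Q * prodT p f τ ^ l) = toLoc p f τ (P * prodT p f τ ^ k) := by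
    simp only [map_mul, map_pow, ← hx, ← hx']
    ring
  obtain ⟨⟨_, c, rfl⟩, hc⟩ :=
    (IsLocalization.eq_iff_exists (Submonoid.powers (prodT p f τ))
      (Localization.Away (prodT p f τ))).1 h1
  refine mem_of_prodT_pow_mul_mem hreg (b := (m + k * f).toNat + (c + l) * f) (k := c + l) ?_
    le_rfl
  have h2 : prodT p f τ ^ (c + l) * Q = prodT p f τ ^ (c + k) * P := by
    have h3 : prodT p f τ ^ c * (Q * prodT p f τ ^ l) = prodT p f τ ^ c * (P * prodT p f τ ^ k) :=
      hc
    rw [pow_add, pow_add, mul_assoc, mul_assoc, mul_comm _ Q, mul_comm _ P, h3]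
  rw [h2]
  refine prodT_pow_mul_mem hP ?_
  zify
  have := Int.self_le_toNat (m + l * f)
  rw [Int.toNat_of_nonneg h4]
  linarith

end Loc

section Hat

variable {p f : ℕ} {G R : Type*} [CommRing G] [CommRing R] {τ : G →+* R}

theorem locFil_mem_nhds (s : Set (Loc p f τ)) :
    s ∈ 𝓝 (0 : Loc p f τ) ↔ ∃ k, (locFil p f τ k : Set (Loc p f τ)) ⊆ s := by
  simpa using (locFil_isRingFil p f τ).basis.hasBasis_nhds_zero.mem_iff (t := s)

variable (p f τ) in
theorem hatFil_isComplFil : IsComplFil (hatFil p f τ) :=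
  complFil_isComplFil (locFil_isRingFil p f τ) locFil_mem_nhds

theorem locToHat_mem {m : ℤ} {x : Loc p f τ} :
    locToHat p f τ x ∈ hatFil p f τ m ↔ x ∈ locFil p f τ m :=
  coe_mem_complFil locFil_mem_nhds

theorem exists_sub_locToHat_mem (x : Hat p f τ) (m : ℤ) :
    ∃ y : Loc p f τ, x - locToHat p f τ y ∈ hatFil p f τ m :=
  exists_sub_coe_mem_complFil locFil_mem_nhds x m

theorem exists_toLoc_eq (x : Loc p f τ) :
    ∃ (k : ℕ) (Q : iwasawa p G R), x * toLoc p f τ (prodT p f τ) ^ k = toLoc p f τ Q :=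
  IsLocalization.Away.surj (S := Localization.Away (prodT p f τ)) (prodT p f τ) x

theorem exists_mul_toLoc_eq_one (k : ℕ) :
    ∃ y : Loc p f τ, y * toLoc p f τ (prodT p f τ) ^ k = 1 := by
  obtain ⟨y, hy⟩ := isUnit_iff_exists_inv'.1 ((isUnit_toLoc p f τ).pow k)
  exact ⟨y, hy⟩

theorem exists_mul_toLoc_eq (k : ℕ) (Q : iwasawa p G R) :
    ∃ x : Loc p f τ, x * toLoc p f τ (prodT p f τ) ^ k = toLoc p f τ Q := by
  obtain ⟨y, hy⟩ := exists_mul_toLoc_eq_one (τ := τ) k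
  exact ⟨toLoc p f τ Q * y, by rw [mul_assoc, hy, mul_one]⟩

theorem toLoc_mem {m : ℕ} {Q : iwasawa p G R} (hQ : Q ∈ idealT p f τ ^ m) :
    toLoc p f τ Q ∈ locFil p f τ m :=
  ⟨0, Q, by simpa using hQ, by simp⟩

theorem toHat_mem {m : ℕ} {Q : iwasawa p G R} (hQ : Q ∈ idealT p f τ ^ m) :
    toHat p f τ Q ∈ hatFil p f τ m :=
  locToHat_mem.2 (toLoc_mem hQ)

theorem toHat_mem_zero (Q : iwasawa p G R) : toHat p f τ Q ∈ hatFil p f τ 0 :=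
  toHat_mem (m := 0) (by simp)

theorem exists_toHat_T_mul_eq_one (i : Fin f) :
    ∃ y ∈ hatFil p f τ (-1), toHat p f τ (T p f τ i) * y = 1 := by
  classical
  obtain ⟨x, hx⟩ := exists_mul_toLoc_eq (τ := τ) 1 (∏ j ∈ Finset.univ.erase i, T p f τ j)
  have h1 : T p f τ i * ∏ j ∈ Finset.univ.erase i, T p f τ j = prodT p f τ :=
    Finset.mul_prod_erase _ _ (Finset.mem_univ i)
  refine ⟨locToHat p f τ x, locToHat_mem.2 ⟨1, _, ?_, hx⟩, ?_⟩
  · have := Ideal.prod_mem_prod (s := Finset.univ.erase i) (I := fun _ : Fin f => idealT p f τ)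
      (x := T p f τ) fun i _ => T_mem p f τ i
    rw [Finset.prod_const, Finset.card_erase_of_mem (Finset.mem_univ i), Finset.card_univ,
      Fintype.card_fin] at this
    refine Ideal.pow_le_pow_right ?_ this
    omega
  · have h2 : toLoc p f τ (T p f τ i) * x = 1 := by
      obtain ⟨u, hu⟩ := isUnit_toLoc p f τ
      rw [pow_one] at hx
      have h3 : toLoc p f τ (T p f τ i) * x * u = 1 * u := by
        rw [mul_assoc, hu, hx, ← map_mul, h1, one_mul]
      exact u.isUnit.mul_right_cancel h3
    change locToHat p f τ (toLoc p f τ (T p f τ i)) * locToHat p f τ x = 1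
    rw [← map_mul, h2, map_one]

theorem ringHom_loc_ext {B : Type*} [CommRing B] {φ ψ : Loc p f τ →+* B}
    (h : ∀ x, φ (toLoc p f τ x) = ψ (toLoc p f τ x)) : φ = ψ :=
  IsLocalization.ringHom_ext (S := Localization.Away (prodT p f τ))
    (Submonoid.powers (prodT p f τ)) (RingHom.ext h)

theorem ringHom_hat_ext {B : Type*} [CommRing B] [TopologicalSpace B] [T2Space B]
    {φ ψ : Hat p f τ →+* B} (hφ : Continuous φ) (hψ : Continuous ψ)
    (h : ∀ x, φ (toHat p f τ x) = ψ (toHat p f τ x)) : φ = ψ := by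
  have h1 : φ.comp (locToHat p f τ) = ψ.comp (locToHat p f τ) := ringHom_loc_ext h
  refine DFunLike.coe_injective ((denseRange_locToHat p f τ).equalizer hφ hψ ?_)
  ext x
  exact DFunLike.congr_fun h1 x

/-- Extension of a ring homomorphism from the Iwasawa algebra to the localization. -/
theorem exists_loc_extension {B : Type*} [CommRing B] (φ : iwasawa p G R →+* B)
    (h : IsUnit (φ (prodT p f τ))) :
    ∃ Φ : Loc p f τ →+* B, ∀ x, Φ (toLoc p f τ x) = φ x :=
  ⟨IsLocalization.Away.lift (S := Localization.Away (prodT p f τ)) (prodT p f τ) h,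
    IsLocalization.Away.lift_eq (S := Localization.Away (prodT p f τ)) (prodT p f τ) h⟩

theorem exists_hat_extension {B : Type*} [CommRing B] [TopologicalSpace B] [IsTopologicalRing B]
    {U : ℕ → AddSubgroup B} (hU : IsComplSeq U) (φ : Loc p f τ →+* B)
    (hφ : ∀ k, ∃ m, ∀ x ∈ locFil p f τ m, φ x ∈ U k) :
    ∃ Φ : Hat p f τ →+* B, Continuous Φ ∧ ∀ x, Φ (locToHat p f τ x) = φ x := by
  refine hU.exists_completion_extension φ (continuous_of_continuousAt_zero φ ?_)
  intro s hs
  rw [map_zero, hU.mem_nhds] at hs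
  obtain ⟨k, hk⟩ := hs
  obtain ⟨m, hm⟩ := hφ k
  exact (locFil_mem_nhds _).2 ⟨m, fun x hx => hk (hm x hx)⟩

theorem map_mem_of_locFil {B : Type*} [CommRing B] [TopologicalSpace B]
    {Φ : Hat p f τ →+* B} (hΦ : Continuous Φ) {S : AddSubgroup B} (hS : IsClosed (S : Set B))
    {m : ℤ} (h : ∀ x ∈ locFil p f τ m, Φ (locToHat p f τ x) ∈ S) {x : Hat p f τ}
    (hx : x ∈ hatFil p f τ m) : Φ x ∈ S := by
  refine closure_minimal (t := Φ ⁻¹' (S : Set B)) ?_ (hS.preimage hΦ) hx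
  rintro _ ⟨y, hy, rfl⟩
  exact h y hy

theorem map_idealT_pow_mem {B : Type*} [CommRing B] {F : ℤ → AddSubgroup B} (hF : IsRingFil F)
    (φ : iwasawa p G R →+* B) (e : ℤ) (h0 : ∀ x, φ x ∈ F 0) (hT : ∀ i, φ (T p f τ i) ∈ F e)
    {a : ℕ} {x : iwasawa p G R} (hx : x ∈ idealT p f τ ^ a) : φ x ∈ F (a * e) := by
  have hmon : ∀ α : Fin f → ℕ, φ (mon p f τ α) ∈ F ((∑ i, α i : ℕ) * e) := by
    intro α
    have key : ∀ s : Finset (Fin f), φ (∏ i ∈ s, T p f τ i ^ α i) ∈ F ((∑ i ∈ s, α i : ℕ) * e) := by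
      classical
      intro s
      induction s using Finset.induction_on with
      | empty => simpa using hF.one_mem
      | insert i s hi ih =>
        rw [Finset.prod_insert hi, Finset.sum_insert hi, map_mul, map_pow]
        have := hF.mul_mem (hF.pow_mem (hT i) (α i)) ih
        convert this using 2
        push_cast; ring
    exact key Finset.univ
  obtain ⟨c, rfl⟩ := (mem_idealT_pow_iff_exists p f τ a x).1 hx
  rw [map_sum]
  refine sum_mem fun α hα => ?_
  have h1 := hF.mul_mem (h0 (c α)) (hmon α)
  rwa [mem_piAntidiag_univ.1 hα, zero_add, ← map_mul] at h1

/-- A homomorphism from the Iwasawa algebra that multiplies valuations by `e`, and maps the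
variables to units of valuation exactly `e`, extends to the localization. -/
theorem exists_loc_extension_fil {B : Type*} [CommRing B] {F : ℤ → AddSubgroup B}
    (hF : IsRingFil F) (φ : iwasawa p G R →+* B) (e : ℕ) (h0 : ∀ x, φ x ∈ F 0)
    (hT : ∀ i, φ (T p f τ i) ∈ F e) (hT' : ∀ i, ∃ y ∈ F (-e), φ (T p f τ i) * y = 1) :
    ∃ Φ : Loc p f τ →+* B, (∀ x, Φ (toLoc p f τ x) = φ x) ∧
      ∀ m, ∀ x ∈ locFil p f τ m, Φ x ∈ F (e * m) := by
  choose y hy hy' using hT'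
  have hz : φ (prodT p f τ) * ∏ i, y i = 1 := by
    rw [prodT, map_prod, ← Finset.prod_mul_distrib]
    exact Finset.prod_eq_one fun i _ => hy' i
  -- the product of the inverses of the `f` variables has valuation `-f e`, which matches the
  -- normalization `ord Q - k f` of the filtration
  have hz' : ∏ i, y i ∈ F (-(f * e : ℤ)) := by
    have key : ∀ s : Finset (Fin f), ∏ i ∈ s, y i ∈ F (-(s.card * e : ℤ)) := by
      classical
      intro s
      induction s using Finset.induction_on with
      | empty => simpa using hF.one_mem
      | insert i s hi ih =>
        rw [Finset.prod_insert hi, Finset.card_insert_of_notMem hi]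
        have := hF.mul_mem (hy i) ih
        convert this using 2
        push_cast; ring
    simpa using key Finset.univ
  obtain ⟨Φ, hΦ⟩ := exists_loc_extension (τ := τ) φ (IsUnit.of_mul_eq_one _ hz)
  refine ⟨Φ, hΦ, fun m x hx => ?_⟩
  obtain ⟨k, Q, hQ, hx⟩ := hx
  have h1 : Φ x = φ Q * (∏ i, y i) ^ k := by
    rw [← hΦ, ← hx, map_mul, map_pow, hΦ, mul_assoc, ← mul_pow, hz, one_pow, mul_one]
  rw [h1]
  have h2 := hF.mul_mem (map_idealT_pow_mem hF φ e h0 hT hQ) (hF.pow_mem hz' k)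
  refine hF.anti ?_ h2
  have h3 : (0 : ℤ) ≤ e := by positivity
  have h4 := Int.self_le_toNat (m + k * f)
  nlinarith

end Hat

section CharP

variable {p f : ℕ} [hp : Fact p.Prime] {G : Type*} [CommRing G] [IsDomain G]
  {F : Type*} [Field F] [CharP F p]

theorem hat_sub_pow_p (τ : G →+* F) (x y : Hat p f τ) : (x - y) ^ p = x ^ p - y ^ p :=
  (frobHom p F (Hat p f τ)).map_sub x y

theorem IsUnramified.mem_hatFil_of_pow (hG : IsUnramified p f G) (τ : G →+* F) {m : ℤ}
    {x : Hat p f τ} (hx : x ^ p ∈ hatFil p f τ (p * m)) : x ∈ hatFil p f τ m := by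
  have hF := hatFil_isRingFil p f τ
  -- in characteristic `p`, `x` may be replaced by a fraction `Q / (∏ T_i) ^ k` close to it
  obtain ⟨y, hy⟩ := exists_sub_locToHat_mem x m
  rw [← sub_add_cancel x (locToHat p f τ y)]
  refine add_mem hy (locToHat_mem.2 ?_)
  have h1 : locToHat p f τ (y ^ p) ∈ hatFil p f τ (p * m) := by
    rw [map_pow, ← sub_sub_cancel (x ^ p) (locToHat p f τ y ^ p), ← hat_sub_pow_p]
    exact sub_mem hx (hF.pow_mem hy p)
  rw [locToHat_mem] at h1
  obtain ⟨k, Q, hQ⟩ := exists_toLoc_eq y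
  have hreg := fun (i : Fin f) (a : ℕ) (Q : iwasawa p G F) => hG.mem_of_T_mul_mem τ (i := i)
    (a := a) (x := Q)
  have hQ' : y ^ p * toLoc p f τ (prodT p f τ) ^ (k * p) = toLoc p f τ (Q ^ p) := by
    rw [map_pow, ← hQ, mul_pow, pow_mul]
  rw [mem_locFil_iff hreg hQ'] at h1
  rw [mem_locFil_iff hreg hQ]
  refine hG.mem_of_pow_mem τ ?_
  convert h1 using 2
  rw [show (p : ℤ) * m + (k * p : ℕ) * f = p * (m + k * f) by push_cast; ring]
  rcases le_total 0 (m + k * f) with h | h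
  · lift m + k * f to ℕ using h with n
    norm_cast
  · rw [Int.toNat_of_nonpos h, Int.toNat_of_nonpos (mul_nonpos_of_nonneg_of_nonpos (by positivity) h),
      mul_zero]

theorem IsUnramified.one_notMem_hatFil (hG : IsUnramified p f G) (τ : G →+* F) :
    (1 : Hat p f τ) ∉ hatFil p f τ 1 := by
  have hreg := fun (i : Fin f) (a : ℕ) (Q : iwasawa p G F) => hG.mem_of_T_mul_mem τ (i := i)
    (a := a) (x := Q)
  rw [← map_one (locToHat p f τ), locToHat_mem,
    mem_locFil_iff hreg (k := 0) (Q := 1) (by simp)]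
  simpa using hG.one_notMem_idealT τ

end CharP

/-! ### The completed perfection -/

section AInf

variable {p : ℕ} [hp : Fact p.Prime] {f : ℕ} {G F : Type*} [CommRing G] [CommRing F] [CharP F p]
  {τ : G →+* F}

instance : IsTopologicalRing (Ainf p f τ) :=
  inferInstanceAs (IsTopologicalRing (Completion (Perf p f τ)))

variable (p f τ) in
/-- The canonical map from the perfection to its completion. -/
def perfToAinf : Perf p f τ →+* Ainf p f τ := Completion.coeRingHom (α := Perf p f τ)

variable (p f τ) in
/-- The elements of valuation at least `m` in the completed perfection. -/
def ainfFil (m : ℤ) : AddSubgroup (Ainf p f τ) := complFil (perfFil p f τ) m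

theorem perfFil_mem_nhds (s : Set (Perf p f τ)) :
    s ∈ 𝓝 (0 : Perf p f τ) ↔ ∃ k, (perfFil p f τ k : Set (Perf p f τ)) ⊆ s := by
  simpa using (perfFil_isRingFil p f τ).basis.hasBasis_nhds_zero.mem_iff (t := s)

variable (p f τ) in
theorem ainfFil_isComplFil : IsComplFil (ainfFil p f τ) :=
  complFil_isComplFil (perfFil_isRingFil p f τ) perfFil_mem_nhds

theorem perfToAinf_mem {m : ℤ} {x : Perf p f τ} :
    perfToAinf p f τ x ∈ ainfFil p f τ m ↔ x ∈ perfFil p f τ m :=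
  coe_mem_complFil perfFil_mem_nhds

theorem exists_sub_perfToAinf_mem (x : Ainf p f τ) (m : ℤ) :
    ∃ y : Perf p f τ, x - perfToAinf p f τ y ∈ ainfFil p f τ m :=
  exists_sub_coe_mem_complFil perfFil_mem_nhds x m

theorem exists_toPerf_eq (x : Perf p f τ) : ∃ N y, x = toPerf p f τ N y :=
  DirectLimit.exists_eq_mk (perfMap p f τ) x

theorem toPerf_eq_iff {N M : ℕ} {x y : Hat p f τ} :
    toPerf p f τ N x = toPerf p f τ M y ↔
      ∃ K, N ≤ K ∧ M ≤ K ∧ x ^ p ^ (K - N) = y ^ p ^ (K - M) := by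
  constructor
  · intro h
    obtain ⟨K, h1, h2, h3⟩ := Quotient.exact (s := DirectLimit.setoid (perfMap p f τ)) h
    simp only [perfMap_apply] at h3
    exact ⟨K, h1, h2, h3⟩
  · rintro ⟨K, h1, h2, h3⟩
    rw [← toPerf_pow p f τ N (K - N), ← toPerf_pow p f τ M (K - M), h3, Nat.add_sub_cancel' h1,
      Nat.add_sub_cancel' h2]

variable (p f τ) in
theorem natCast_ainf_eq_zero : (p : Ainf p f τ) = 0 := by
  rw [← map_natCast (algebraMap F (Ainf p f τ)), CharP.cast_eq_zero, map_zero]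

theorem ainf_sub_pow_p (x y : Ainf p f τ) : (x - y) ^ p = x ^ p - y ^ p :=
  (frobHom p F (Ainf p f τ)).map_sub x y

theorem hatToAinf_eq (x : Hat p f τ) :
    hatToAinf p f τ x = perfToAinf p f τ (toPerf p f τ 0 x) := rfl

theorem toAinf_eq (x : iwasawa p G F) : toAinf p f τ x = hatToAinf p f τ (toHat p f τ x) := rfl

theorem exists_pow_eq_perf (x : Perf p f τ) (N : ℕ) : ∃ y, x = y ^ p ^ N := by
  obtain ⟨M, x, rfl⟩ := exists_toPerf_eq x
  refine ⟨toPerf p f τ (M + N) x, ?_⟩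
  rw [← map_pow, toPerf_pow]

theorem hatToAinf_mem_of_mem {m : ℤ} {x : Hat p f τ} (hx : x ∈ hatFil p f τ m) :
    hatToAinf p f τ x ∈ ainfFil p f τ m :=
  perfToAinf_mem.2 ⟨0, x, by simpa using hx, rfl⟩

theorem toAinf_mem_zero (x : iwasawa p G F) : toAinf p f τ x ∈ ainfFil p f τ 0 :=
  hatToAinf_mem_of_mem (toHat_mem_zero x)

theorem toAinf_T_mem (i : Fin f) : toAinf p f τ (T p f τ i) ∈ ainfFil p f τ 1 :=
  hatToAinf_mem_of_mem (toHat_mem (m := 1) (by simpa using T_mem p f τ i))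

theorem exists_toAinf_T_mul_eq_one (i : Fin f) :
    ∃ y ∈ ainfFil p f τ (-1), toAinf p f τ (T p f τ i) * y = 1 := by
  obtain ⟨y, hy, hy'⟩ := exists_toHat_T_mul_eq_one (τ := τ) i
  exact ⟨hatToAinf p f τ y, hatToAinf_mem_of_mem hy, by rw [toAinf_eq, ← map_mul, hy', map_one]⟩

theorem continuous_hatToAinf : Continuous (hatToAinf p f τ) := by
  refine continuous_of_continuousAt_zero (hatToAinf p f τ) ?_
  intro s hs
  rw [map_zero, (ainfFil_isComplFil p f τ).mem_nhds] at hs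
  obtain ⟨k, hk⟩ := hs
  exact ((hatFil_isComplFil p f τ).mem_nhds _).2 ⟨k, fun x hx => hk (hatToAinf_mem_of_mem hx)⟩

end AInf

section Field

variable {p f : ℕ} [hp : Fact p.Prime] {G : Type*} [CommRing G] [IsDomain G]
  {F : Type*} [Field F] [CharP F p]

theorem IsUnramified.mem_hatFil_of_pow_pow (hG : IsUnramified p f G) (τ : G →+* F) (n : ℕ) {m : ℤ}
    {x : Hat p f τ} (hx : x ^ p ^ n ∈ hatFil p f τ (p ^ n * m)) : x ∈ hatFil p f τ m := by
  induction n with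
  | zero => simpa using hx
  | succ n ih =>
    refine ih (hG.mem_hatFil_of_pow τ ?_)
    rwa [← pow_mul, ← pow_succ, ← mul_assoc, ← pow_succ']

/-- The valuation on the perfection extends that of `A`, because the graded ring of `A` is
reduced. -/
theorem IsUnramified.toPerf_mem (hG : IsUnramified p f G) (τ : G →+* F) {N : ℕ} {m : ℤ}
    {x : Hat p f τ} : toPerf p f τ N x ∈ perfFil p f τ m ↔ x ∈ hatFil p f τ (p ^ N * m) := by
  refine ⟨?_, fun h => ⟨N, x, h, rfl⟩⟩
  rintro ⟨M, y, hy, h⟩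
  obtain ⟨K, h1, h2, h3⟩ := toPerf_eq_iff.1 h
  refine hG.mem_hatFil_of_pow_pow τ (K - N) ?_
  rw [h3]
  have := (hatFil_isRingFil p f τ).pow_mem hy (p ^ (K - M))
  convert this using 2
  push_cast
  rw [← mul_assoc, ← mul_assoc, ← pow_add, ← pow_add, Nat.sub_add_cancel h1, Nat.sub_add_cancel h2]

theorem IsUnramified.hatToAinf_mem (hG : IsUnramified p f G) (τ : G →+* F) {m : ℤ}
    {x : Hat p f τ} : hatToAinf p f τ x ∈ ainfFil p f τ m ↔ x ∈ hatFil p f τ m := by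
  rw [hatToAinf_eq, perfToAinf_mem, hG.toPerf_mem]
  simp

theorem IsUnramified.mem_ainfFil_of_pow (hG : IsUnramified p f G) (τ : G →+* F) {m : ℤ}
    {x : Ainf p f τ} (hx : x ^ p ∈ ainfFil p f τ (p * m)) : x ∈ ainfFil p f τ m := by
  have hF := (ainfFil_isComplFil p f τ).isRingFil
  obtain ⟨y, hy⟩ := exists_sub_perfToAinf_mem x m
  rw [← sub_add_cancel x (perfToAinf p f τ y)]
  refine add_mem hy (perfToAinf_mem.2 ?_)
  have h1 : perfToAinf p f τ (y ^ p) ∈ ainfFil p f τ (p * m) := by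
    rw [map_pow, ← sub_sub_cancel (x ^ p) (perfToAinf p f τ y ^ p), ← ainf_sub_pow_p]
    exact sub_mem hx (hF.pow_mem hy p)
  rw [perfToAinf_mem] at h1
  obtain ⟨N, z, rfl⟩ := exists_toPerf_eq y
  rw [← map_pow, hG.toPerf_mem] at h1
  rw [hG.toPerf_mem]
  refine hG.mem_hatFil_of_pow τ ?_
  convert h1 using 2
  ring

theorem IsUnramified.charP_ainf (hG : IsUnramified p f G) (τ : G →+* F) : CharP (Ainf p f τ) p := by
  have : Nontrivial (Ainf p f τ) := by
    refine ⟨1, 0, fun h => hG.one_notMem_hatFil τ ?_⟩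
    rw [← hG.hatToAinf_mem, map_one, h]
    exact zero_mem _
  exact charP_of_injective_algebraMap (algebraMap F (Ainf p f τ)).injective p

/-- The Frobenius of the completed perfection is surjective. -/
theorem IsUnramified.exists_pow_eq_ainf (hG : IsUnramified p f G) (τ : G →+* F) (x : Ainf p f τ) :
    ∃ y, y ^ p = x := by
  have hF := ainfFil_isComplFil p f τ
  choose y hy using fun k : ℕ => exists_sub_perfToAinf_mem x (p * k)
  -- the exact `p`-th roots of the approximations of `x` form a Cauchy sequence, since valuations
  -- are divided by `p`
  choose z hz using fun k : ℕ => exists_pow_eq_perf (y k) 1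
  obtain ⟨w, hw⟩ := hF.complSeq.compl (fun k => perfToAinf p f τ (z k)) fun k => by
    refine hG.mem_ainfFil_of_pow τ ?_
    rw [ainf_sub_pow_p, ← map_pow, ← map_pow]
    have h1 : ∀ k, z k ^ p = y k := fun k => by rw [hz k, pow_one]
    rw [h1, h1, ← sub_sub_sub_cancel_left _ _ x]
    exact sub_mem (hy k) (hF.isRingFil.anti (by push_cast; nlinarith) (hy (k + 1)))
  refine ⟨w, ?_⟩
  rw [← sub_eq_zero]
  refine hF.complSeq.sep _ fun k => ?_
  have h1 : z k ^ p = y k := by rw [hz k, pow_one]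
  have hp1 : (1 : ℤ) ≤ p := by exact_mod_cast hp.out.one_le
  have h2 := hF.isRingFil.pow_mem (hw k) p
  rw [ainf_sub_pow_p, ← map_pow, h1] at h2
  have h3 := hF.isRingFil.anti (by nlinarith : (k : ℤ) ≤ p * k) (sub_mem h2 (hy k))
  rwa [sub_sub_sub_cancel_right] at h3

theorem IsUnramified.bijective_pow_ainf (hG : IsUnramified p f G) (τ : G →+* F) :
    Function.Bijective (frobHom p F (Ainf p f τ)) := by
  refine ⟨(injective_iff_map_eq_zero _).2 fun x hx => ?_, hG.exists_pow_eq_ainf τ⟩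
  refine (ainfFil_isComplFil p f τ).complSeq.sep _ fun k => hG.mem_ainfFil_of_pow τ ?_
  have h : x ^ p = 0 := hx
  rw [h]
  exact zero_mem _

theorem IsUnramified.mem_ainfFil_of_pow_pow (hG : IsUnramified p f G) (τ : G →+* F) (n : ℕ) {m : ℤ}
    {x : Ainf p f τ} (hx : x ^ p ^ n ∈ ainfFil p f τ (p ^ n * m)) : x ∈ ainfFil p f τ m := by
  induction n with
  | zero => simpa using hx
  | succ n ih =>
    refine ih (hG.mem_ainfFil_of_pow τ ?_)
    rwa [← pow_mul, ← pow_succ, ← mul_assoc, ← pow_succ']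

/-- A homomorphism from the Iwasawa algebra to the completed perfection that multiplies valuations
by `e ≥ 1` extends to the completed perfection. -/
theorem IsUnramified.exists_ainf_extension (hG : IsUnramified p f G) (τ : G →+* F)
    (φ : iwasawa p G F →+* Ainf p f τ) (e : ℕ) (he : 1 ≤ e)
    (h0 : ∀ x, φ x ∈ ainfFil p f τ 0) (hT : ∀ i, φ (T p f τ i) ∈ ainfFil p f τ e)
    (hT' : ∀ i, ∃ y ∈ ainfFil p f τ (-e), φ (T p f τ i) * y = 1) :
    ∃ Φ : Ainf p f τ →+* Ainf p f τ, Continuous Φ ∧ (∀ x, Φ (toAinf p f τ x) = φ x) ∧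
      ∀ m, ∀ x ∈ ainfFil p f τ m, Φ x ∈ ainfFil p f τ (e * m) := by
  have hF := ainfFil_isComplFil p f τ
  have he' : (1 : ℤ) ≤ e := by exact_mod_cast he
  obtain ⟨Φ₀, h1, h2⟩ := exists_loc_extension_fil hF.isRingFil φ e h0 hT hT'
  obtain ⟨Φ₁, h3, h4⟩ := exists_hat_extension hF.complSeq Φ₀ fun k =>
    ⟨k, fun x hx => hF.isRingFil.anti (by nlinarith) (h2 k x hx)⟩
  have h5 : ∀ m, ∀ x ∈ hatFil p f τ m, Φ₁ x ∈ ainfFil p f τ (e * m) := fun m x hx =>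
    map_mem_of_locFil h3 (hF.isClosed (e * m)) (fun y hy => by rw [h4]; exact h2 m y hy) hx
  -- on the `N`-th copy of `A` in the perfection the extension is `Frob ^ (-N) ∘ Φ₁`
  let σ : Ainf p f τ ≃+* Ainf p f τ := RingEquiv.ofBijective _ (hG.bijective_pow_ainf τ)
  have hσ : ∀ x, σ x = x ^ p := fun x => rfl
  have hσ' : ∀ (n : ℕ) x, (σ.symm.toRingHom ^ n) (x ^ p ^ n) = x := by
    intro n
    induction n with
    | zero => intro x; simp
    | succ n ih =>
      intro x
      rw [pow_succ, pow_succ, pow_mul, ← hσ]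
      change (σ.symm.toRingHom ^ n) (σ.symm (σ _)) = x
      rw [σ.symm_apply_apply, ih]
  have hσ2 : ∀ (n : ℕ) x, (σ.symm.toRingHom ^ n) x ^ p ^ n = x := by
    intro n x
    rw [← map_pow, hσ']
  let Φ₂ : Perf p f τ →+* Ainf p f τ := DirectLimit.Ring.lift _ (perfMap p f τ) _
    (fun N => (σ.symm.toRingHom ^ N).comp Φ₁) fun i j hij x => by
      rw [perfMap_apply, RingHom.comp_apply, RingHom.comp_apply, map_pow]
      obtain ⟨d, rfl⟩ := Nat.exists_eq_add_of_le hij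
      rw [Nat.add_sub_cancel_left, pow_add, RingHom.mul_def, RingHom.comp_apply, hσ']
  have h6 : ∀ N x, Φ₂ (toPerf p f τ N x) = (σ.symm.toRingHom ^ N) (Φ₁ x) := fun N x => rfl
  have h7 : ∀ m, ∀ x ∈ perfFil p f τ m, Φ₂ x ∈ ainfFil p f τ (e * m) := by
    rintro m _ ⟨N, x, hx, rfl⟩
    refine hG.mem_ainfFil_of_pow_pow τ N ?_
    rw [h6, hσ2]
    convert h5 _ x hx using 2
    ring
  obtain ⟨Φ, h8, h9⟩ := hF.complSeq.exists_completion_extension Φ₂ <| by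
    refine continuous_of_continuousAt_zero Φ₂ ?_
    intro s hs
    rw [map_zero, hF.mem_nhds] at hs
    obtain ⟨k, hk⟩ := hs
    refine (perfFil_mem_nhds _).2 ⟨max k 0, fun x hx => hk (hF.isRingFil.anti ?_ (h7 _ x hx))⟩
    have := le_max_left k 0
    have := le_max_right k 0
    nlinarith
  refine ⟨Φ, h8, fun x => ?_, fun m x hx => ?_⟩
  · refine (h9 _).trans ?_
    rw [h6, pow_zero]
    change Φ₁ (toHat p f τ x) = _
    rw [← h1, ← h4]
    rfl
  · refine closure_minimal (t := Φ ⁻¹' (ainfFil p f τ (e * m) : Set (Ainf p f τ))) ?_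
      ((hF.isClosed _).preimage h8) hx
    rintro _ ⟨y, hy, rfl⟩
    have := h7 m y hy
    rw [← h9] at this
    exact this

/-- Continuous endomorphisms of the completed perfection are determined on the Iwasawa algebra. -/
theorem IsUnramified.ringHom_ainf_ext (hG : IsUnramified p f G) (τ : G →+* F)
    {φ ψ : Ainf p f τ →+* Ainf p f τ} (hφ : Continuous φ) (hψ : Continuous ψ)
    (h : ∀ x, φ (toAinf p f τ x) = ψ (toAinf p f τ x)) : φ = ψ := by
  have := (ainfFil_isComplFil p f τ).complSeq.t2Space
  have h1 : φ.comp (hatToAinf p f τ) = ψ.comp (hatToAinf p f τ) :=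
    ringHom_hat_ext (hφ.comp continuous_hatToAinf) (hψ.comp continuous_hatToAinf) h
  have hinj : ∀ (n : ℕ) {x y : Ainf p f τ}, x ^ p ^ n = y ^ p ^ n → x = y := by
    intro n
    induction n with
    | zero => intro x y h; simpa using h
    | succ n ih =>
      intro x y h
      rw [pow_succ, pow_mul, pow_mul] at h
      exact ih ((hG.bijective_pow_ainf τ).1 h)
  refine DFunLike.coe_injective
    ((Completion.denseRange_coe (α := Perf p f τ)).equalizer hφ hψ ?_)
  ext x
  obtain ⟨N, x, rfl⟩ := exists_toPerf_eq x
  refine hinj N ?_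
  have h2 : ∀ χ : Ainf p f τ →+* Ainf p f τ,
      χ (perfToAinf p f τ (toPerf p f τ N x)) ^ p ^ N = χ (hatToAinf p f τ x) := by
    intro χ
    have h3 := toPerf_pow p f τ 0 N x
    rw [zero_add, map_pow] at h3
    rw [← map_pow, ← map_pow, h3]
    rfl
  refine (h2 φ).trans (Eq.trans ?_ (h2 ψ).symm)
  exact DFunLike.congr_fun h1 x

end Field

/-! ### The endomorphisms of the completed perfection -/

section Scale

variable {p : ℕ} {G R : Type*} [CommRing G] [CommRing R]

theorem lev_scale (c : G) (n : ℕ) (x : iwasawa p G R) :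
    lev p R n (scale p G R c x) = finLevelScale p G R c n (lev p R n x) := rfl

theorem scale_grp (c g : G) : scale p G R c (grp p R g) = grp p R (c * g) :=
  iwasawa_ext p fun n => by
    rw [lev_scale, lev_grp, lev_grp]
    simp [finLevelScale, levGrp]

theorem scale_mul (c d : G) (x : iwasawa p G R) :
    scale p G R (c * d) x = scale p G R c (scale p G R d x) :=
  iwasawa_ext p fun n => by
    rw [lev_scale, lev_scale, lev_scale]
    induction lev p R n x using AddMonoidAlgebra.induction_linear with
    | zero => simp
    | add x y hx hy => simp only [map_add, hx, hy]
    | single g r => simp [finLevelScale, mul_assoc]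

theorem IsContExt.contExt {R Λ B : Type*} [CommRing R] [CommRing Λ] [CommRing B] [Algebra R Λ]
    [Algebra R B] [TopologicalSpace B] {j : Λ →ₐ[R] B} {ψ : Λ →ₐ[R] Λ} {g : B →ₐ[R] B}
    (h : IsContExt j ψ g) : IsContExt j ψ (contExt j ψ) := by
  have h' : ∃ g, IsContExt j ψ g := ⟨g, h⟩
  rw [MvIwasawa.contExt, dif_pos h']
  exact h'.choose_spec

end Scale

variable {p f : ℕ} [hp : Fact p.Prime] {G : Type*} [CommRing G] [IsDomain G]
  {F : Type*} [Field F] [CharP F p]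

theorem frobHom_pow_apply {B : Type*} [CommRing B] [Algebra F B] (n : ℕ) (x : B) :
    (frobHom p F B ^ n) x = x ^ p ^ n := by
  induction n with
  | zero => simp
  | succ n ih =>
    rw [pow_succ', RingHom.mul_def, RingHom.comp_apply, ih, pow_succ, pow_mul]
    rfl

theorem grp_sub_one_pow (n : ℕ) (g : G) :
    (grp p F g - 1) ^ p ^ n = grp p F ((p : G) ^ n * g) - 1 := by
  rw [← frobHom_pow_apply (F := F), map_sub, map_one, frobHom_pow_apply, ← grp_nsmul, nsmul_eq_mul]
  push_cast
  rfl

theorem IsUnramified.grp_sub_one_mem (hG : IsUnramified p f G) (τ : G →+* F) (g : G) :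
    grp p F g - 1 ∈ idealT p f τ := by
  rw [← pow_one (idealT p f τ), hG.mem_idealT_pow_iff]
  intro β hβ
  have hβ : β = 0 := by
    ext i
    have := Finset.single_le_sum (f := β) (fun i _ => Nat.zero_le _) (Finset.mem_univ i)
    rw [Pi.zero_apply]
    omega
  subst hβ
  rw [← hG.coefLev_lev τ (n := 0) (by simp), map_sub, map_one, lev_grp]
  have h := levGrp_pow_mul p F 0 g
  simp only [pow_zero, one_mul] at h
  have h' : levGrp p F 0 g - 1 = 0 := sub_eq_zero.2 h
  rw [h', map_zero]

theorem pow_eq_of_mem_roots (ζ : rootsOfUnity (p ^ f - 1) G) : (ζ : Gˣ) ^ p ^ f = ζ := by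
  have h1 : (ζ : Gˣ) ^ (p ^ f - 1) = 1 := (mem_rootsOfUnity _ _).1 ζ.2
  have h2 : (ζ : Gˣ) ^ (p ^ f - 1 + 1) = ζ := by rw [pow_succ, h1, one_mul]
  rwa [Nat.sub_add_cancel (Nat.one_le_pow _ _ hp.out.pos)] at h2

/-- In characteristic `p`, multiplication by `q` maps `[ζ] - 1` to `([ζ] - 1) ^ q`, and
`τ(ζ) ^ q = τ(ζ)`. -/
theorem IsUnramified.scale_q_T (hG : IsUnramified p f G) (τ : G →+* F) (i : Fin f) :
    scale p G F ((p : G) ^ f) (T p f τ i) = T p f τ i ^ p ^ f := by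
  have := hG.finite_rootsOfUnity
  let _ := Fintype.ofFinite (rootsOfUnity (p ^ f - 1) G)
  rw [hG.T_eq τ (hG.eq_one_of_map_eq_one τ), map_sum, ← frobHom_pow_apply (F := F), map_sum]
  refine Finset.sum_congr rfl fun ζ _ => ?_
  rw [frobHom_pow_apply, map_smul, map_sub, map_one, scale_grp, smul_pow, grp_sub_one_pow]
  congr 1
  rw [← pow_mul, mul_comm, pow_mul, ← map_pow τ _ (p ^ f), ← Units.val_pow_eq_pow_val,
    pow_eq_of_mem_roots]

/-- Multiplication by a unit `c` scales the initial form of `T_i` by the power `p ^ i` of the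
residue of `c`: for a root of unity it permutes the terms of `T_i`, and multiplication by `1 + p d`
changes `[ζ] - 1` by a multiple of a `p`-th power of an element of the ideal. -/
theorem IsUnramified.scale_unit_T (hG : IsUnramified p f G) (τ : G →+* F) {c : G} (hc : IsUnit c)
    (i : Fin f) : ∃ a : F, a ≠ 0 ∧
      scale p G F c (T p f τ i) - a • T p f τ i ∈ idealT p f τ ^ 2 := by
  have := hG.finite_rootsOfUnity
  let _ := Fintype.ofFinite (rootsOfUnity (p ^ f - 1) G)
  obtain ⟨μ, hμ⟩ := hG.exists_root c fun h =>
    hG.isMaximal.ne_top (Ideal.eq_top_of_isUnit_mem _ h hc)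
  obtain ⟨d, hd⟩ := Ideal.mem_span_singleton.1 hμ
  have hcμ : c = ((μ : Gˣ) : G) + p * -d := by linear_combination -hd
  refine ⟨τ ((μ : Gˣ) : G) ^ p ^ (i : ℕ), pow_ne_zero _ ((μ : Gˣ).isUnit.map τ).ne_zero, ?_⟩
  rw [hG.T_eq τ (hG.eq_one_of_map_eq_one τ), map_sum, Finset.smul_sum]
  have h1 : ∑ ζ : rootsOfUnity (p ^ f - 1) G, τ ((μ : Gˣ) : G) ^ p ^ (i : ℕ) •
      τ ((ζ⁻¹ : rootsOfUnity (p ^ f - 1) G) : Gˣ) ^ p ^ (i : ℕ) • (grp p F ((ζ : Gˣ) : G) - 1) =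
      ∑ ζ : rootsOfUnity (p ^ f - 1) G,
        τ ((ζ⁻¹ : rootsOfUnity (p ^ f - 1) G) : Gˣ) ^ p ^ (i : ℕ) •
          (grp p F (((μ : Gˣ) : G) * ((ζ : Gˣ) : G)) - 1) := by
    refine (Fintype.sum_equiv (Equiv.mulLeft μ) _ _ fun ζ => ?_).symm
    rw [smul_smul, ← mul_pow, ← map_mul]
    have h2 : ((μ : Gˣ) : G) * (((Equiv.mulLeft μ ζ)⁻¹ : rootsOfUnity (p ^ f - 1) G) : Gˣ) =
        ((ζ⁻¹ : rootsOfUnity (p ^ f - 1) G) : Gˣ) := by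
      rw [Equiv.coe_mulLeft, mul_inv, Subgroup.coe_mul, Units.val_mul, ← mul_assoc,
        Subgroup.coe_inv, Units.mul_inv, one_mul]
    rw [h2]
    rfl
  rw [h1, ← Finset.sum_sub_distrib]
  refine Ideal.sum_mem _ fun ζ _ => ?_
  rw [map_smul, ← smul_sub, map_sub, scale_grp, map_one, sub_sub_sub_cancel_right, hcμ, add_mul,
    grp_add, mul_assoc]
  have h3 := grp_sub_one_pow (p := p) (F := F) 1 (-d * ((ζ : Gˣ) : G))
  simp only [pow_one] at h3
  rw [← mul_sub_one, ← h3, Algebra.smul_def]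
  refine Ideal.mul_mem_left _ _ (Ideal.mul_mem_left _ _ ?_)
  exact Ideal.pow_le_pow_right hp.out.two_le (Ideal.pow_mem_pow (hG.grp_sub_one_mem τ _) p)

/-- Multiplication by `p ^ k` on `G` induces the `p ^ k`-power map when all scalars are fixed by
it. -/
theorem scale_eq_pow {k : ℕ} (hF : ∀ a : F, a ^ p ^ k = a) (x : iwasawa p G F) :
    scale p G F ((p : G) ^ k) x = x ^ p ^ k := by
  refine iwasawa_ext p fun n => ?_
  rw [lev_scale, map_pow]
  induction lev p F n x using AddMonoidAlgebra.induction_linear with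
  | zero => rw [map_zero, zero_pow (pow_pos hp.out.pos _).ne']
  | add x y hx hy => rw [map_add, hx, hy, add_pow_expChar_pow]
  | single g r =>
    rw [AddMonoidAlgebra.single_pow, hF]
    simp [finLevelScale]

/-- Multiplication by `c` on `G` multiplies the valuation of the variables by `e`. -/
structure IsMult (p f : ℕ) [Fact p.Prime] {G F : Type*} [CommRing G] [Field F] [CharP F p]
    (τ : G →+* F) (c : G) (e : ℕ) : Prop where
  one_le : 1 ≤ e
  mem : ∀ i, toAinf p f τ (scale p G F c (T p f τ i)) ∈ ainfFil p f τ e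
  exists_mul : ∀ i, ∃ y ∈ hatFil p f τ (-e), toHat p f τ (scale p G F c (T p f τ i)) * y = 1

theorem IsUnramified.isMult_q (hG : IsUnramified p f G) (τ : G →+* F) :
    IsMult p f τ ((p : G) ^ f) (p ^ f) where
  one_le := Nat.one_le_pow _ _ hp.out.pos
  mem i := by
    rw [hG.scale_q_T, map_pow]
    simpa using (ainfFil_isComplFil p f τ).isRingFil.pow_mem (toAinf_T_mem (τ := τ) i) (p ^ f)
  exists_mul i := by
    obtain ⟨y, hy, hy'⟩ := exists_toHat_T_mul_eq_one (τ := τ) i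
    refine ⟨y ^ p ^ f, ?_, by rw [hG.scale_q_T, map_pow, ← mul_pow, hy', one_pow]⟩
    have := (hatFil_isComplFil p f τ).isRingFil.pow_mem hy (p ^ f)
    rwa [mul_neg_one] at this

theorem IsUnramified.isMult_unit (hG : IsUnramified p f G) (τ : G →+* F) {c : G} (hc : IsUnit c) :
    IsMult p f τ c 1 := by
  have hF := hatFil_isComplFil p f τ
  have hconst : ∀ a : F, toHat p f τ (algebraMap F _ a) ∈ hatFil p f τ 0 :=
    fun a => toHat_mem_zero _
  have hmem : ∀ i, toHat p f τ (scale p G F c (T p f τ i)) ∈ hatFil p f τ 1 ∧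
      ∃ y ∈ hatFil p f τ (-1), toHat p f τ (scale p G F c (T p f τ i)) * y = 1 := by
    intro i
    obtain ⟨a, ha, h⟩ := hG.scale_unit_T τ hc i
    obtain ⟨y, hy, hy'⟩ := exists_toHat_T_mul_eq_one (τ := τ) i
    have h1 := toHat_mem (τ := τ) h
    rw [map_sub, Algebra.smul_def, map_mul] at h1
    have h2 : toHat p f τ (algebraMap F _ a) * toHat p f τ (T p f τ i) ∈ hatFil p f τ 1 := by
      have h3 := hF.isRingFil.mul_mem (hconst a)
        (toHat_mem (m := 1) (by simpa using T_mem p f τ i))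
      simpa using h3
    refine ⟨?_, hF.exists_mul_eq_one_of_sub_mem (m := 1)
      (v := y * toHat p f τ (algebraMap F _ a⁻¹)) ?_ ?_ h1⟩
    · rw [← sub_add_cancel (toHat p f τ (scale p G F c (T p f τ i)))
        (toHat p f τ (algebraMap F _ a) * toHat p f τ (T p f τ i))]
      exact add_mem (hF.isRingFil.anti (by norm_num) h1) h2
    · simpa using hF.isRingFil.mul_mem hy (hconst a⁻¹)
    · have h3 : toHat p f τ (algebraMap F _ a) * toHat p f τ (algebraMap F _ a⁻¹) = 1 := by
        rw [← map_mul, ← map_mul, mul_inv_cancel₀ ha, map_one, map_one]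
      linear_combination toHat p f τ (T p f τ i) * y * h3 + hy'
  exact ⟨le_rfl, fun i => hatToAinf_mem_of_mem (hmem i).1, fun i => (hmem i).2⟩

theorem IsMult.exists_actInf (hG : IsUnramified p f G) {τ : G →+* F} {c : G} {e : ℕ}
    (h : IsMult p f τ c e) :
    ∃ g : Ainf p f τ →ₐ[F] Ainf p f τ, IsContExt (toAinf p f τ) (scale p G F c) g ∧
      ∀ m, ∀ x ∈ ainfFil p f τ m, g x ∈ ainfFil p f τ (e * m) := by
  obtain ⟨Φ, h1, h2, h3⟩ := hG.exists_ainf_extension τ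
    ((toAinf p f τ).comp (scale p G F c)).toRingHom e h.one_le (fun x => toAinf_mem_zero _) h.mem
    fun i => by
      obtain ⟨y, hy, hy'⟩ := h.exists_mul i
      refine ⟨hatToAinf p f τ y, hatToAinf_mem_of_mem hy, ?_⟩
      change toAinf p f τ (scale p G F c (T p f τ i)) * _ = 1
      rw [toAinf_eq, ← map_mul, hy', map_one]
  refine ⟨{ Φ with commutes' := fun r => ?_ }, ⟨h1, AlgHom.ext h2⟩, h3⟩
  change Φ (algebraMap F (Ainf p f τ) r) = _
  rw [← (toAinf p f τ).commutes, h2]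
  change toAinf p f τ (scale p G F c (algebraMap F _ r)) = _
  rw [(scale p G F c).commutes, (toAinf p f τ).commutes]

theorem IsUnramified.isContExt_ainf_unique (hG : IsUnramified p f G) {τ : G →+* F} {c : G}
    {g g' : Ainf p f τ →ₐ[F] Ainf p f τ} (h : IsContExt (toAinf p f τ) (scale p G F c) g)
    (h' : IsContExt (toAinf p f τ) (scale p G F c) g') : g = g' := by
  have h1 := hG.ringHom_ainf_ext τ (φ := g.toRingHom) (ψ := g'.toRingHom) h.1 h'.1 fun x =>
    DFunLike.congr_fun (h.2.trans h'.2.symm) x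
  exact AlgHom.ext fun x => DFunLike.congr_fun h1 x

theorem IsMult.isContExt_actInf (hG : IsUnramified p f G) {τ : G →+* F} {c : G} {e : ℕ}
    (h : IsMult p f τ c e) :
    IsContExt (toAinf p f τ) (scale p G F c) (actInf p f τ c) := by
  obtain ⟨g, hg, _⟩ := h.exists_actInf hG
  exact hg.contExt

theorem IsMult.actInf_toAinf (hG : IsUnramified p f G) {τ : G →+* F} {c : G} {e : ℕ}
    (h : IsMult p f τ c e) (x : iwasawa p G F) :
    actInf p f τ c (toAinf p f τ x) = toAinf p f τ (scale p G F c x) :=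
  DFunLike.congr_fun (h.isContExt_actInf hG).2 x

theorem IsMult.actInf_mem (hG : IsUnramified p f G) {τ : G →+* F} {c : G} {e : ℕ}
    (h : IsMult p f τ c e) {m : ℤ} {x : Ainf p f τ} (hx : x ∈ ainfFil p f τ m) :
    actInf p f τ c x ∈ ainfFil p f τ (e * m) := by
  obtain ⟨g, hg, hg'⟩ := h.exists_actInf hG
  rw [← hG.isContExt_ainf_unique hg (h.isContExt_actInf hG)]
  exact hg' m x hx

/-- A power of `φ_q` is a power of the Frobenius when the coefficient field is finite. -/
theorem IsUnramified.exists_actInf_pow [Finite F] (hG : IsUnramified p f G) (τ : G →+* F) :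
    ∃ d : ℕ, ∀ x, (actInf p f τ ((p : G) ^ f) ^ (d + 1)) x = x ^ p ^ (f * (d + 1)) := by
  let _ := Fintype.ofFinite F
  obtain ⟨n, -, hn⟩ := FiniteField.card F p
  have hq := hG.isMult_q τ
  have hc := (hq.isContExt_actInf hG).1
  refine ⟨n - 1, fun x => ?_⟩
  rw [Nat.sub_add_cancel (show 1 ≤ (n : ℕ) from n.2)]
  -- with `#F = p ^ n`, the Frobenius to the power `f n` fixes `F`, hence induces on the Iwasawa
  -- algebra the same map as multiplication by `p ^ (f n)`, which is `φ_q ^ n`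
  have hF : ∀ a : F, a ^ p ^ (f * (n : ℕ)) = a := fun a => by
    rw [mul_comm f, pow_mul p, ← hn, FiniteField.pow_card_pow]
  have h1 : ∀ k : ℕ, Continuous (actInf p f τ ((p : G) ^ f) ^ k) := by
    intro k
    induction k with
    | zero => exact continuous_id
    | succ k ih => rw [pow_succ]; exact ih.comp hc
  have h2 : ∀ (k : ℕ) (x : iwasawa p G F), (actInf p f τ ((p : G) ^ f) ^ k) (toAinf p f τ x) =
      toAinf p f τ (scale p G F ((p : G) ^ (f * k)) x) := by
    intro k
    induction k with
    | zero =>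
      intro x
      rw [mul_zero, pow_zero, pow_zero]
      have := scale_eq_pow (p := p) (G := G) (F := F) (k := 0) (fun a => by simp) x
      rw [pow_zero, pow_zero, pow_one] at this
      rw [this]
      rfl
    | succ k ih =>
      intro x
      rw [pow_succ, AlgHom.mul_apply, hq.actInf_toAinf hG, ih, ← scale_mul, ← pow_add, mul_add_one]
  have h3 := hG.ringHom_ainf_ext τ (φ := (actInf p f τ ((p : G) ^ f) ^ (n : ℕ)).toRingHom)
    (ψ := frobHom p F _ ^ (f * (n : ℕ))) (h1 n)
    (by
      have : ⇑(frobHom p F (Ainf p f τ) ^ (f * (n : ℕ))) = fun x => x ^ p ^ (f * (n : ℕ)) :=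
        funext fun x => frobHom_pow_apply _ x
      rw [this]
      fun_prop) fun x => by
      refine (h2 n x).trans ?_
      rw [scale_eq_pow hF, map_pow, frobHom_pow_apply]
  have := DFunLike.congr_fun h3 x
  rw [frobHom_pow_apply] at this
  exact this

/-! ### The weak topology on Witt vectors -/

section Teichmuller

variable {p : ℕ} [hp : Fact p.Prime]

theorem truncate_eq_iff {B : Type*} [CommRing B] {x y : WittVector p B} {n : ℕ} :
    WittVector.truncate n x = WittVector.truncate n y ↔ ∀ l < n, x.coeff l = y.coeff l := by
  constructor
  · intro h l hl
    rw [← WittVector.coeff_truncate x ⟨l, hl⟩, ← WittVector.coeff_truncate y ⟨l, hl⟩, h]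
  · intro h
    ext i
    rw [WittVector.coeff_truncate, WittVector.coeff_truncate, h i i.2]

variable {B : Type*} [CommRing B] [CharP B p]

/-- Multiplication by a Teichmüller representative in the coordinates of Witt vectors. -/
theorem teichmuller_mul_coeff (c : B) (x : WittVector p B) (l : ℕ) :
    (WittVector.teichmuller p c * x).coeff l = c ^ p ^ l * x.coeff l := by
  have hdis : ∀ (a : B) (z : WittVector p B) (n : ℕ),
      (WittVector.teichmuller p a).coeff n = 0 ∨ (WittVector.verschiebung z).coeff n = 0 := by
    intro a z n
    cases n with
    | zero => exact Or.inr (WittVector.verschiebung_coeff_zero _)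
    | succ n => exact Or.inl (WittVector.teichmuller_coeff_pos p a _ n.succ_pos)
  induction l generalizing c x with
  | zero => rw [WittVector.mul_coeff_zero, WittVector.teichmuller_coeff_zero, pow_zero, pow_one]
  | succ l ih =>
    let y : WittVector p B := WittVector.mk p fun n => x.coeff (n + 1)
    have hx : x = WittVector.teichmuller p (x.coeff 0) + WittVector.verschiebung y := by
      ext n
      rw [WittVector.coeff_add_of_disjoint n _ _ (hdis _ _)]
      cases n with
      | zero => simp
      | succ n =>
        rw [WittVector.teichmuller_coeff_pos p _ _ n.succ_pos, zero_add,
          WittVector.verschiebung_coeff_succ]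
        rfl
    have hc : WittVector.frobenius (WittVector.teichmuller p c) = WittVector.teichmuller p (c ^ p) := by
      ext n
      rw [WittVector.coeff_frobenius_charP]
      cases n with
      | zero => rw [WittVector.teichmuller_coeff_zero, WittVector.teichmuller_coeff_zero]
      | succ n =>
        rw [WittVector.teichmuller_coeff_pos p _ _ n.succ_pos,
          WittVector.teichmuller_coeff_pos p _ _ n.succ_pos, zero_pow hp.out.ne_zero]
    -- `[c] ([x₀] + V y) = [c x₀] + V ([c ^ p] y)`
    have h1 : WittVector.teichmuller p c * x = WittVector.teichmuller p (c * x.coeff 0) +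
        WittVector.verschiebung (WittVector.teichmuller p (c ^ p) * y) := by
      conv_lhs => rw [hx]
      rw [mul_add, ← map_mul, mul_comm _ (WittVector.verschiebung y),
        ← WittVector.verschiebung_mul_frobenius, hc, mul_comm y]
    rw [h1, WittVector.coeff_add_of_disjoint _ _ _ (hdis _ _),
      WittVector.teichmuller_coeff_pos p _ _ l.succ_pos, zero_add,
      WittVector.verschiebung_coeff_succ, ih, ← pow_mul, ← pow_succ']
    rfl

end Teichmuller

/-- A complete filtration on a ring of characteristic `p` that is compatible with the Frobenius,
with a unit `t` of valuation exactly one, with inverse `u`. -/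
structure IsPerfFil (p : ℕ) {B : Type*} [CommRing B] [TopologicalSpace B]
    (F : ℤ → AddSubgroup B) (t u : B) : Prop extends IsComplFil F where
  mem_of_pow : ∀ {m : ℤ} {x : B}, x ^ p ∈ F (p * m) → x ∈ F m
  t_mem : t ∈ F 1
  u_mem : u ∈ F (-1)
  t_mul_u : t * u = 1

namespace IsPerfFil

variable {p : ℕ} [hp : Fact p.Prime] {B : Type*} [CommRing B] [TopologicalSpace B]
  [IsTopologicalRing B] [CharP B p] {F : ℤ → AddSubgroup B} {t u : B}

theorem exists_unit (h : IsPerfFil p F t u) (k : ℤ) :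
    ∃ c c' : B, c ∈ F k ∧ c' ∈ F (-k) ∧ c * c' = 1 := by
  obtain ⟨n, rfl | rfl⟩ := k.eq_nat_or_neg
  · refine ⟨t ^ n, u ^ n, ?_, ?_, by rw [← mul_pow, h.t_mul_u, one_pow]⟩
    · simpa using h.isRingFil.pow_mem h.t_mem n
    · simpa using h.isRingFil.pow_mem h.u_mem n
  · refine ⟨u ^ n, t ^ n, ?_, ?_, by rw [← mul_pow, mul_comm u, h.t_mul_u, one_pow]⟩
    · simpa using h.isRingFil.pow_mem h.u_mem n
    · simpa using h.isRingFil.pow_mem h.t_mem n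

/-- The subring of elements of nonnegative valuation. -/
def ring0 (h : IsPerfFil p F t u) : Subring B where
  toAddSubgroup := F 0
  one_mem' := h.isRingFil.one_mem
  mul_mem' hx hy := by simpa using h.isRingFil.mul_mem hx hy

/-- The ideal of the elements of valuation at least `j` in the subring of elements of nonnegative
valuation. -/
def ideal0 (h : IsPerfFil p F t u) (j : ℤ) : Ideal h.ring0 where
  carrier := {x | x.1 ∈ F j}
  zero_mem' := zero_mem (F j)
  add_mem' hx hy := add_mem (S := AddSubgroup B) hx hy
  smul_mem' c x hx := by simpa using h.isRingFil.mul_mem c.2 hx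

/-- Truncation of Witt vectors with coefficients of nonnegative valuation. -/
theorem exists_lift (h : IsPerfFil p F t u) {n : ℕ} {x : WittVector p B}
    (hx : ∀ l < n, x.coeff l ∈ F 0) : ∃ X : WittVector p h.ring0,
      WittVector.truncate n x = WittVector.truncate n (WittVector.map h.ring0.subtype X) := by
  classical
  refine ⟨WittVector.mk p fun l => if hl : l < n then ⟨x.coeff l, hx l hl⟩ else 0, ?_⟩
  rw [truncate_eq_iff]
  intro l hl
  simp [WittVector.map_coeff, hl]

theorem coeff_mem_of_truncate (h : IsPerfFil p F t u) {n : ℕ} {x : WittVector p B}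
    {X : WittVector p h.ring0}
    (hX : WittVector.truncate n x = WittVector.truncate n (WittVector.map h.ring0.subtype X)) :
    ∀ l < n, x.coeff l = (X.coeff l : B) := by
  intro l hl
  rw [truncate_eq_iff.1 hX l hl, WittVector.map_coeff]
  rfl

theorem coeff_sub_mem_zero (h : IsPerfFil p F t u) {n : ℕ} {x y : WittVector p B}
    (hx : ∀ l < n, x.coeff l ∈ F 0) (hy : ∀ l < n, y.coeff l ∈ F 0) :
    ∀ l < n, (x - y).coeff l ∈ F 0 := by
  obtain ⟨X, hX⟩ := h.exists_lift hx
  obtain ⟨Y, hY⟩ := h.exists_lift hy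
  intro l hl
  rw [h.coeff_mem_of_truncate (X := X - Y) (by rw [map_sub, map_sub, map_sub, hX, hY]) l hl]
  exact ((X - Y).coeff l).2

theorem coeff_mul_mem_zero (h : IsPerfFil p F t u) {n : ℕ} {x y : WittVector p B}
    (hx : ∀ l < n, x.coeff l ∈ F 0) (hy : ∀ l < n, y.coeff l ∈ F 0) :
    ∀ l < n, (x * y).coeff l ∈ F 0 := by
  obtain ⟨X, hX⟩ := h.exists_lift hx
  obtain ⟨Y, hY⟩ := h.exists_lift hy
  intro l hl
  rw [h.coeff_mem_of_truncate (X := X * Y) (by rw [map_mul, map_mul, map_mul, hX, hY]) l hl]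
  exact ((X * Y).coeff l).2

/-- Congruence of Witt vectors with integral coefficients can be tested on coefficients. -/
theorem coeff_sub_mem_iff (h : IsPerfFil p F t u) {n : ℕ} {x y : WittVector p B}
    (hx : ∀ l < n, x.coeff l ∈ F 0) (hy : ∀ l < n, y.coeff l ∈ F 0) (j : ℤ) :
    (∀ l < n, (x - y).coeff l ∈ F j) ↔ ∀ l < n, x.coeff l - y.coeff l ∈ F j := by
  obtain ⟨X, hX⟩ := h.exists_lift hx
  obtain ⟨Y, hY⟩ := h.exists_lift hy
  -- both conditions say that the truncations of `x` and `y` agree in the Witt vectors of the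
  -- quotient of the ring of integers by the ideal of valuation `j`
  let π := WittVector.map (p := p) (Ideal.Quotient.mk (h.ideal0 j))
  have h1 : (∀ l < n, (x - y).coeff l ∈ F j) ↔
      WittVector.truncate n (π (X - Y)) = WittVector.truncate n (0 : WittVector p _) := by
    rw [truncate_eq_iff]
    refine forall₂_congr fun l hl => ?_
    rw [h.coeff_mem_of_truncate (X := X - Y) (by rw [map_sub, map_sub, map_sub, hX, hY]) l hl,
      WittVector.map_coeff, WittVector.zero_coeff, Ideal.Quotient.eq_zero_iff_mem]
    rfl
  have h2 : (∀ l < n, x.coeff l - y.coeff l ∈ F j) ↔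
      WittVector.truncate n (π X) = WittVector.truncate n (π Y) := by
    rw [truncate_eq_iff]
    refine forall₂_congr fun l hl => ?_
    rw [h.coeff_mem_of_truncate hX l hl, h.coeff_mem_of_truncate hY l hl,
      WittVector.map_coeff, WittVector.map_coeff, Ideal.Quotient.eq]
    rfl
  rw [h1, h2, map_sub, map_sub, map_zero, sub_eq_zero]

theorem coeff_teichmuller_mul_mem (h : IsPerfFil p F t u) {n : ℕ} {k j : ℤ} {x : WittVector p B}
    {c : B} (hc : c ∈ F j) (hx : ∀ l < n, x.coeff l ∈ F (p ^ l * k)) :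
    ∀ l < n, (WittVector.teichmuller p c * x).coeff l ∈ F (p ^ l * (j + k)) := by
  intro l hl
  rw [teichmuller_mul_coeff, mul_add]
  have := h.isRingFil.mul_mem (h.isRingFil.pow_mem hc (p ^ l)) (hx l hl)
  exact_mod_cast this

theorem teichmuller_mul_teichmuller_mul {c c' : B} (hc : c * c' = 1) (x : WittVector p B) :
    WittVector.teichmuller p c * (WittVector.teichmuller p c' * x) = x := by
  rw [← mul_assoc, ← map_mul, hc, map_one, one_mul]

theorem coeff_sub_mem (h : IsPerfFil p F t u) {n : ℕ} {k : ℤ} {x y : WittVector p B}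
    (hx : ∀ l < n, x.coeff l ∈ F (p ^ l * k)) (hy : ∀ l < n, y.coeff l ∈ F (p ^ l * k)) :
    ∀ l < n, (x - y).coeff l ∈ F (p ^ l * k) := by
  -- scaling by the Teichmüller representative of a unit of valuation `-k` reduces to `k = 0`
  obtain ⟨c, c', hc, hc', hcc⟩ := h.exists_unit k
  have hx' := h.coeff_teichmuller_mul_mem hc' hx
  have hy' := h.coeff_teichmuller_mul_mem hc' hy
  simp only [neg_add_cancel, mul_zero] at hx' hy'
  have h1 := h.coeff_sub_mem_zero hx' hy'
  rw [← mul_sub] at h1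
  have h2 := h.coeff_teichmuller_mul_mem (n := n) (k := 0) hc (by simpa using h1)
  rw [teichmuller_mul_teichmuller_mul hcc, add_zero] at h2
  exact h2

/-- The Witt vectors whose first `n` Teichmüller components have valuation at least `k`. The `l`-th
coordinate is the `p ^ l`-th power of the `l`-th Teichmüller component, whence the factor
`p ^ l`. -/
def wFil (h : IsPerfFil p F t u) (n : ℕ) (k : ℤ) : AddSubgroup (WittVector p B) where
  carrier := {x | ∀ l < n, x.coeff l ∈ F (p ^ l * k)}
  zero_mem' := fun l _ => by rw [WittVector.zero_coeff]; exact zero_mem _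
  neg_mem' := fun {x} hx => by
    have := h.coeff_sub_mem (x := 0)
      (fun l _ => by rw [WittVector.zero_coeff]; exact zero_mem _) hx
    rwa [zero_sub] at this
  add_mem' := fun {x y} hx hy => by
    have h1 := h.coeff_sub_mem (x := 0)
      (fun l _ => by rw [WittVector.zero_coeff]; exact zero_mem _) hy
    have h2 := h.coeff_sub_mem hx h1
    rwa [zero_sub, sub_neg_eq_add] at h2

theorem mem_wFil (h : IsPerfFil p F t u) {n : ℕ} {k : ℤ} {x : WittVector p B} :
    x ∈ h.wFil n k ↔ ∀ l < n, x.coeff l ∈ F (p ^ l * k) := Iff.rfl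

theorem teichmuller_mul_mem (h : IsPerfFil p F t u) {n : ℕ} {k j : ℤ} {x : WittVector p B}
    {c : B} (hc : c ∈ F j) (hx : x ∈ h.wFil n k) :
    WittVector.teichmuller p c * x ∈ h.wFil n (j + k) :=
  h.coeff_teichmuller_mul_mem hc hx

theorem wFil_mul_mem (h : IsPerfFil p F t u) {n : ℕ} {k j : ℤ} {x y : WittVector p B}
    (hx : x ∈ h.wFil n k) (hy : y ∈ h.wFil n j) : x * y ∈ h.wFil n (k + j) := by
  obtain ⟨c, c', hc, hc', hcc⟩ := h.exists_unit k
  obtain ⟨d, d', hd, hd', hdd⟩ := h.exists_unit j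
  have hx' := h.coeff_teichmuller_mul_mem hc' hx
  have hy' := h.coeff_teichmuller_mul_mem hd' hy
  simp only [neg_add_cancel, mul_zero] at hx' hy'
  have h1 := h.coeff_mul_mem_zero hx' hy'
  have h2 := h.teichmuller_mul_mem (n := n) (k := j + 0) hc
    (h.teichmuller_mul_mem (k := 0) hd (x := _) (by simpa [mem_wFil] using h1))
  rw [add_zero] at h2
  have h3 : WittVector.teichmuller p c * (WittVector.teichmuller p d *
      (WittVector.teichmuller p c' * x * (WittVector.teichmuller p d' * y))) = x * y := by
    conv_rhs => rw [← teichmuller_mul_teichmuller_mul hcc x, ← teichmuller_mul_teichmuller_mul hdd y]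
    ring
  rwa [h3] at h2

theorem wFil_anti (h : IsPerfFil p F t u) {n n' : ℕ} (hn : n ≤ n') {k k' : ℤ} (hk : k ≤ k') :
    h.wFil n' k' ≤ h.wFil n k := fun x hx l hl =>
  h.isRingFil.anti (by gcongr) (hx l (hl.trans_le hn))

theorem teichmuller_mem (h : IsPerfFil p F t u) {n : ℕ} {k : ℤ} {c : B} (hc : c ∈ F k) :
    WittVector.teichmuller p c ∈ h.wFil n k := by
  intro l _
  cases l with
  | zero => simpa using hc
  | succ l =>
    rw [WittVector.teichmuller_coeff_pos p _ _ l.succ_pos]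
    exact zero_mem _

theorem one_mem_wFil (h : IsPerfFil p F t u) (n : ℕ) : (1 : WittVector p B) ∈ h.wFil n 0 := by
  rw [← map_one (WittVector.teichmuller p)]
  exact h.teichmuller_mem h.isRingFil.one_mem

theorem exists_mem_wFil (h : IsPerfFil p F t u) (n : ℕ) (x : WittVector p B) :
    ∃ M : ℕ, x ∈ h.wFil n (-M) := by
  induction n with
  | zero => exact ⟨0, fun l hl => absurd hl (Nat.not_lt_zero l)⟩
  | succ n ih =>
    obtain ⟨M, hM⟩ := ih
    obtain ⟨k, hk⟩ := h.isRingFil.exists_mem (x.coeff n)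
    refine ⟨max M k.natAbs, fun l hl => ?_⟩
    have hp1 : (1 : ℤ) ≤ (p : ℤ) ^ l := by exact_mod_cast Nat.one_le_pow _ _ hp.out.pos
    have h1 : (M : ℤ) ≤ (max M k.natAbs : ℕ) := by exact_mod_cast le_max_left _ _
    have h2 : (k.natAbs : ℤ) ≤ (max M k.natAbs : ℕ) := by exact_mod_cast le_max_right _ _
    rcases (Nat.lt_succ_iff_lt_or_eq.1 hl) with hl | rfl
    · exact h.isRingFil.anti (by nlinarith) (hM l hl)
    · refine h.isRingFil.anti ?_ hk
      have : -(k.natAbs : ℤ) ≤ k := by omega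
      nlinarith

theorem natCast_mem_wFil (h : IsPerfFil p F t u) (n m : ℕ) : (m : WittVector p B) ∈ h.wFil n 0 := by
  induction m with
  | zero => simp [zero_mem]
  | succ m ih => rw [Nat.cast_succ]; exact add_mem ih (h.one_mem_wFil n)

theorem p_mul_mem_wFil_iff (h : IsPerfFil p F t u) {n : ℕ} {k : ℤ} {x : WittVector p B} :
    (p : WittVector p B) * x ∈ h.wFil (n + 1) k ↔ x ∈ h.wFil n k := by
  rw [mul_comm]
  constructor
  · intro H l hl
    have := H (l + 1) (by omega)
    rw [WittVector.mul_charP_coeff_succ, pow_succ', mul_assoc] at this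
    exact h.mem_of_pow this
  · intro H l hl
    cases l with
    | zero => rw [WittVector.mul_charP_coeff_zero]; exact zero_mem _
    | succ l =>
      rw [WittVector.mul_charP_coeff_succ, pow_succ', mul_assoc]
      exact h.isRingFil.pow_mem (H l (by omega)) p

theorem p_pow_mul_mem_wFil (h : IsPerfFil p F t u) {n : ℕ} (k : ℤ) (x : WittVector p B) :
    (p : WittVector p B) ^ n * x ∈ h.wFil n k := by
  intro l hl
  rw [mul_comm ((p : WittVector p B) ^ n), WittVector.mul_pow_charP_coeff_zero _ hl]
  exact zero_mem _

theorem wFil_basis (h : IsPerfFil p F t u) :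
    RingSubgroupsBasis fun i : ℕ × ℤ => h.wFil i.1 i.2 := by
  refine RingSubgroupsBasis.of_comm _ (fun i j => ⟨(max i.1 j.1, max i.2 j.2), ?_⟩)
    (fun i => ⟨(i.1, max i.2 0), ?_⟩) ?_
  · exact le_inf (h.wFil_anti (le_max_left _ _) (le_max_left _ _))
      (h.wFil_anti (le_max_right _ _) (le_max_right _ _))
  · rintro _ ⟨x, hx, y, hy, rfl⟩
    exact h.wFil_anti le_rfl (by dsimp; omega) (h.wFil_mul_mem hx hy)
  · rintro x ⟨n, k⟩
    obtain ⟨M, hM⟩ := h.exists_mem_wFil n x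
    refine ⟨(n, k + M), fun y hy => ?_⟩
    have := h.wFil_mul_mem hM hy
    simpa using this

/-- The weak topology on the ring of Witt vectors. -/
abbrev weakTopology (h : IsPerfFil p F t u) : TopologicalSpace (WittVector p B) :=
  h.wFil_basis.topology

theorem weakTopology_isTopologicalRing (h : IsPerfFil p F t u) :
    @IsTopologicalRing _ h.weakTopology _ :=
  h.wFil_basis.toRingFilterBasis.isTopologicalRing

theorem mem_nhds_weakTopology (h : IsPerfFil p F t u) (s : Set (WittVector p B)) :
    s ∈ @nhds _ h.weakTopology 0 ↔ ∃ i : ℕ × ℤ, (h.wFil i.1 i.2 : Set (WittVector p B)) ⊆ s := by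
  simpa using h.wFil_basis.hasBasis_nhds_zero.mem_iff (t := s)

/-- Witt vectors that are close for the weak topology have close coordinates, with a loss that
depends on a lower bound `-M` for their valuations. -/
theorem coeff_sub_coeff_mem (h : IsPerfFil p F t u) {n M : ℕ} {x y : WittVector p B}
    (hx : x ∈ h.wFil n (-M)) (hy : y ∈ h.wFil n (-M)) {j : ℤ} (hj : 0 ≤ M + j)
    (hxy : x - y ∈ h.wFil n j) : ∀ l < n, x.coeff l - y.coeff l ∈ F (M + j - p ^ l * M) := by
  obtain ⟨c, c', hc, hc', hcc⟩ := h.exists_unit M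
  have hx' := h.coeff_teichmuller_mul_mem hc hx
  have hy' := h.coeff_teichmuller_mul_mem hc hy
  simp only [add_neg_cancel, mul_zero] at hx' hy'
  have h1 := (h.coeff_sub_mem_iff hx' hy' (M + j)).1 fun l hl => by
    rw [← mul_sub]
    refine h.isRingFil.anti ?_ (h.coeff_teichmuller_mul_mem hc hxy l hl)
    have hp1 : (1 : ℤ) ≤ (p : ℤ) ^ l := by exact_mod_cast Nat.one_le_pow _ _ hp.out.pos
    nlinarith
  intro l hl
  have h2 := h.isRingFil.mul_mem (h1 l hl) (h.isRingFil.pow_mem hc' (p ^ l))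
  rw [teichmuller_mul_coeff, teichmuller_mul_coeff, ← mul_sub, mul_right_comm, ← mul_pow, hcc,
    one_pow, one_mul] at h2
  convert h2 using 2
  push_cast
  ring

/-- Witt vectors with close coordinates are close for the weak topology, with a loss that depends on
a lower bound `-M` for their valuations. -/
theorem sub_mem_wFil (h : IsPerfFil p F t u) {n M : ℕ} {x y : WittVector p B}
    (hx : x ∈ h.wFil n (-M)) (hy : y ∈ h.wFil n (-M)) {k : ℤ} (hk : 0 ≤ M + k)
    (hxy : ∀ l < n, x.coeff l - y.coeff l ∈ F (p ^ n * (M + k))) : x - y ∈ h.wFil n k := by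
  obtain ⟨c, c', hc, hc', hcc⟩ := h.exists_unit M
  have hx' := h.coeff_teichmuller_mul_mem hc hx
  have hy' := h.coeff_teichmuller_mul_mem hc hy
  simp only [add_neg_cancel, mul_zero] at hx' hy'
  have h1 := (h.coeff_sub_mem_iff hx' hy' (p ^ n * (M + k))).2 fun l hl => by
    rw [teichmuller_mul_coeff, teichmuller_mul_coeff, ← mul_sub]
    refine h.isRingFil.anti ?_ (h.isRingFil.mul_mem (h.isRingFil.pow_mem hc (p ^ l)) (hxy l hl))
    have : (0 : ℤ) ≤ (p ^ l : ℕ) * M := by positivity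
    linarith
  intro l hl
  have h2 := h.isRingFil.mul_mem (h.isRingFil.pow_mem hc' (p ^ l)) (h1 l hl)
  rw [← mul_sub, teichmuller_mul_coeff, ← mul_assoc, ← mul_pow, mul_comm c', hcc, one_pow,
    one_mul] at h2
  refine h.isRingFil.anti ?_ h2
  have h3 : (p : ℤ) ^ l ≤ (p : ℤ) ^ n :=
    pow_le_pow_right₀ (by exact_mod_cast hp.out.one_le) hl.le
  push_cast
  nlinarith

/-- Completeness of the ring of Witt vectors for the weak topology. -/
theorem exists_limit (h : IsPerfFil p F t u) (s : ℕ → WittVector p B)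
    (hs : ∀ k : ℕ, s (k + 1) - s k ∈ h.wFil k k) : ∃ x, ∀ k : ℕ, x - s k ∈ h.wFil k k := by
  have hs' : ∀ k l : ℕ, k ≤ l → s l - s k ∈ h.wFil k k := by
    intro k l hkl
    induction l, hkl using Nat.le_induction with
    | base => rw [sub_self]; exact zero_mem _
    | succ l hkl ih =>
      rw [← sub_add_sub_cancel (s (l + 1)) (s l) (s k)]
      exact add_mem (h.wFil_anti hkl (by exact_mod_cast hkl) (hs l)) ih
  -- the first `n` coefficients are bounded, uniformly in the sequence
  have hbd : ∀ n : ℕ, ∃ M : ℕ, ∀ k, n ≤ k → s k ∈ h.wFil n (-M) := by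
    intro n
    obtain ⟨M, hM⟩ := h.exists_mem_wFil n (s n)
    refine ⟨M, fun k hk => ?_⟩
    rw [← sub_add_cancel (s k) (s n)]
    exact add_mem (h.wFil_anti le_rfl (by omega) (hs' n k hk)) hM
  -- hence the coefficients converge
  have hlim : ∀ l : ℕ, ∃ a : B, ∀ j : ℤ, ∀ᶠ i in atTop, a - (s i).coeff l ∈ F j := by
    intro l
    obtain ⟨M, hM⟩ := hbd (l + 1)
    obtain ⟨a, ha⟩ := h.complSeq.compl (fun i => (s (l + 1 + p ^ l * M + i)).coeff l) fun i => by
      refine h.isRingFil.anti ?_ (h.coeff_sub_coeff_mem (n := l + 1) (M := M)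
        (j := (l + 1 + p ^ l * M + i : ℕ)) (hM _ (by omega)) (hM _ (by omega)) (by positivity)
        (h.wFil_anti (by omega) le_rfl (hs _)) l (by omega))
      push_cast
      linarith
    refine ⟨a, fun j => ?_⟩
    filter_upwards [eventually_ge_atTop (l + 1 + p ^ l * M + j.toNat)] with i hi
    obtain ⟨d, rfl⟩ := Nat.exists_eq_add_of_le hi
    have := ha (j.toNat + d)
    rw [← add_assoc] at this
    exact h.isRingFil.anti (by push_cast; linarith [Int.self_le_toNat j, d.cast_nonneg (α := ℤ)]) this
  choose a ha using hlim
  refine ⟨WittVector.mk p a, fun k => ?_⟩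
  obtain ⟨M, hM⟩ := hbd k
  obtain ⟨M', hM'⟩ := h.exists_mem_wFil k (WittVector.mk p a)
  have h1 : ∀ᶠ i in atTop, ∀ l ∈ Finset.range k,
      a l - (s i).coeff l ∈ F (p ^ k * ((max M M' : ℕ) + k)) :=
    (Filter.eventually_all_finset _).2 fun l _ => ha l _
  -- the vector of the limits is compared with a term of the sequence all of whose coordinates are
  -- close to it
  obtain ⟨i, hi, hik⟩ := (h1.and (eventually_ge_atTop k)).exists
  have h2 : WittVector.mk p a - s i ∈ h.wFil k k := by
    refine h.sub_mem_wFil (M := max M M') (h.wFil_anti le_rfl ?_ hM')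
      (h.wFil_anti le_rfl ?_ (hM i hik)) (by positivity) fun l hl => hi l (Finset.mem_range.2 hl)
    all_goals push_cast
    · exact neg_le_neg (le_max_right _ _)
    · exact neg_le_neg (le_max_left _ _)
  rw [← sub_add_sub_cancel (WittVector.mk p a) (s i) (s k)]
  exact add_mem h2 (hs' k i hik)

theorem wFil_isComplSeq (h : IsPerfFil p F t u) :
    @IsComplSeq _ _ h.weakTopology fun k : ℕ => h.wFil k k := by
  let _ := h.weakTopology
  refine ⟨fun m n hmn => h.wFil_anti hmn (by exact_mod_cast hmn), fun s => ?_, fun x hx => ?_,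
    h.exists_limit⟩
  · rw [h.mem_nhds_weakTopology]
    constructor
    · rintro ⟨⟨n, k⟩, hnk⟩
      refine ⟨max n k.toNat, (show (h.wFil _ _ : Set (WittVector p B)) ⊆ h.wFil n k from
        h.wFil_anti (le_max_left _ _) ?_).trans hnk⟩
      exact (Int.self_le_toNat k).trans (by exact_mod_cast le_max_right _ _)
    · rintro ⟨k, hk⟩
      exact ⟨(k, k), hk⟩
  · ext l
    rw [WittVector.zero_coeff]
    refine h.complSeq.sep _ fun j => ?_
    have h1 := hx (max (l + 1) j) l (by omega)
    refine h.isRingFil.anti ?_ h1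
    have hp1 : (1 : ℤ) ≤ (p : ℤ) ^ l := by exact_mod_cast Nat.one_le_pow _ _ hp.out.pos
    have h2 : (j : ℤ) ≤ (max (l + 1) j : ℕ) := by exact_mod_cast le_max_right _ _
    nlinarith

theorem isOpen_wFil (h : IsPerfFil p F t u) (n : ℕ) (k : ℤ) :
    IsOpen[h.weakTopology] (h.wFil n k : Set (WittVector p B)) := by
  let _ := h.weakTopology
  have := h.weakTopology_isTopologicalRing
  exact AddSubgroup.isOpen_of_mem_nhds _ (g := 0)
    ((h.mem_nhds_weakTopology _).2 ⟨(n, k), subset_rfl⟩)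

theorem isClosed_wFil (h : IsPerfFil p F t u) (n : ℕ) (k : ℤ) :
    IsClosed[h.weakTopology] (h.wFil n k : Set (WittVector p B)) := by
  let _ := h.weakTopology
  have := h.weakTopology_isTopologicalRing
  exact AddSubgroup.isClosed_of_isOpen _ (h.isOpen_wFil n k)

end IsPerfFil

/-! ### The filtration of Witt vectors for which `p` has the valuation of `t` -/

section PowFil

variable {A : Type*} [CommRing A] {q : A} {F : ℤ → AddSubgroup A}

/-- The filtration generated by the filtration `F` when the element `q` is given the valuation
`1`. -/
def powFil (q : A) (F : ℤ → AddSubgroup A) (m : ℤ) : AddSubgroup A :=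
  ⨆ i : ℕ, (F (m - i)).map (AddMonoidHom.mulLeft (q ^ i))

theorem pow_mul_mem_powFil {m : ℤ} (i : ℕ) {x : A} (hx : x ∈ F (m - i)) :
    q ^ i * x ∈ powFil q F m :=
  (le_iSup (fun i : ℕ => (F (m - i)).map (AddMonoidHom.mulLeft (q ^ i))) i) ⟨x, hx, rfl⟩

theorem le_powFil (m : ℤ) : F m ≤ powFil q F m := by
  intro x hx
  have := pow_mul_mem_powFil (q := q) (F := F) (m := m) 0 (x := x) (by simpa using hx)
  simpa using this

theorem powFil_le {m : ℤ} {S : AddSubgroup A} (hS : ∀ (i : ℕ), ∀ x ∈ F (m - i), q ^ i * x ∈ S) :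
    powFil q F m ≤ S := by
  refine iSup_le fun i => ?_
  rintro _ ⟨x, hx, rfl⟩
  exact hS i x hx

theorem IsRingFil.powFil (h : IsRingFil F) (q : A) : IsRingFil (powFil q F) where
  anti := fun m m' hm => powFil_le fun i x hx => pow_mul_mem_powFil i (h.anti (by omega) hx)
  one_mem := le_powFil 0 h.one_mem
  mul_mem := by
    intro m m' x y hx hy
    have h1 : MvIwasawa.powFil q F m ≤
        (MvIwasawa.powFil q F (m + m')).comap (AddMonoidHom.mulRight y) := by
      refine powFil_le fun i x hx => ?_
      have h2 : MvIwasawa.powFil q F m' ≤ (MvIwasawa.powFil q F (m + m')).comap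
          (AddMonoidHom.mulLeft (q ^ i * x)) := by
        refine powFil_le fun j y hy => ?_
        change q ^ i * x * (q ^ j * y) ∈ MvIwasawa.powFil q F (m + m')
        rw [mul_mul_mul_comm, ← pow_add]
        refine pow_mul_mem_powFil (i + j) ?_
        have := h.mul_mem hx hy
        convert this using 2
        push_cast
        ring
      exact h2 hy
    exact h1 hx
  exists_mem := fun x => by
    obtain ⟨M, hM⟩ := h.exists_mem x
    exact ⟨M, le_powFil M hM⟩

end PowFil

namespace IsPerfFil

variable {p : ℕ} [hp : Fact p.Prime] {B : Type*} [CommRing B] [TopologicalSpace B]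
  [IsTopologicalRing B] [CharP B p] {F : ℤ → AddSubgroup B} {t u : B}

theorem wFil_isRingFil (h : IsPerfFil p F t u) (n : ℕ) : IsRingFil (h.wFil n) where
  anti := fun _ _ hm => h.wFil_anti le_rfl hm
  one_mem := h.one_mem_wFil n
  mul_mem := h.wFil_mul_mem
  exists_mem := fun x => by
    obtain ⟨M, hM⟩ := h.exists_mem_wFil n x
    exact ⟨-M, hM⟩

/-- Modulo `p ^ n`, the sums of elements `p ^ i x` with `x` of valuation at least `m - i`. The image
of `T_i` in the Witt vectors is `[T_i] + p y` with `y` integral; it is a unit of valuation `1` for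
this filtration, whereas its inverse need not have valuation `-1` for `wFil`. -/
def zFil (h : IsPerfFil p F t u) (n : ℕ) (m : ℤ) : AddSubgroup (WittVector p B) :=
  powFil (p : WittVector p B) (h.wFil n) m

theorem p_pow_mul_mem_zFil (h : IsPerfFil p F t u) {n : ℕ} {m : ℤ} (i : ℕ) {x : WittVector p B}
    (hx : x ∈ h.wFil n (m - i)) : (p : WittVector p B) ^ i * x ∈ h.zFil n m :=
  pow_mul_mem_powFil i hx

theorem wFil_le_zFil (h : IsPerfFil p F t u) (n : ℕ) (m : ℤ) : h.wFil n m ≤ h.zFil n m :=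
  le_powFil m

theorem zFil_isRingFil (h : IsPerfFil p F t u) (n : ℕ) : IsRingFil (h.zFil n) :=
  (h.wFil_isRingFil n).powFil _

/-- At level `n` the two filtrations differ by at most `n - 1`, since `p ^ n` is zero there. -/
theorem zFil_le_wFil (h : IsPerfFil p F t u) (n : ℕ) (m : ℤ) :
    h.zFil n m ≤ h.wFil n (m - n + 1) := by
  refine powFil_le fun i x hx => ?_
  rcases lt_or_ge i n with hi | hi
  · have h1 : (p : WittVector p B) ^ i ∈ h.wFil n 0 := by
      exact_mod_cast h.natCast_mem_wFil n (p ^ i)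
    exact h.wFil_anti le_rfl (by omega) (h.wFil_mul_mem h1 hx)
  · obtain ⟨d, rfl⟩ := Nat.exists_eq_add_of_le hi
    rw [pow_add, mul_assoc]
    exact h.p_pow_mul_mem_wFil _ _

variable [PerfectRing B p]

theorem exists_eq_p_mul (h : IsPerfFil p F t u) {x : WittVector p B} (hx : x.coeff 0 = 0) :
    ∃ y, x = p * y ∧ ∀ n k, x ∈ h.wFil (n + 1) k → y ∈ h.wFil n k := by
  obtain ⟨y, rfl⟩ := Ideal.mem_span_singleton.1
    ((WittVector.mem_span_p_iff_coeff_zero_eq_zero x).2 hx)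
  exact ⟨y, rfl, fun n k => h.p_mul_mem_wFil_iff.1⟩

/-- Elements `1 + p v` are invertible, and the inverse has valuation at least `0` if `v` has
valuation at least `-1`. -/
theorem exists_one_add_p_mul_inv (h : IsPerfFil p F t u) {v : WittVector p B}
    (hv : ∀ n, v ∈ h.wFil n (-1)) :
    ∃ w, (1 + p * v) * w = 1 ∧ ∀ n, w ∈ h.zFil n 0 := by
  have h1 : (p : WittVector p B) * v ∈ Ideal.jacobson (⊥ : Ideal (WittVector p B)) :=
    IsAdicComplete.le_jacobson_bot (Ideal.span {(p : WittVector p B)})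
      (Ideal.mul_mem_right _ _ (Ideal.mem_span_singleton_self _))
  have h2 := Ideal.mem_jacobson_bot.1 h1 1
  rw [mul_one, add_comm] at h2
  obtain ⟨w, hw⟩ := h2.exists_right_inv
  refine ⟨w, hw, fun n => ?_⟩
  have ha : -((p : WittVector p B) * v) ∈ h.zFil n 0 := by
    have := h.p_pow_mul_mem_zFil (n := n) (m := 0) 1 (x := v) (by simpa using hv n)
    rw [pow_one] at this
    exact neg_mem this
  -- modulo `p ^ n` the inverse is a finite geometric sum
  have h3 : w = ∑ i ∈ Finset.range n, (-((p : WittVector p B) * v)) ^ i +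
      (p : WittVector p B) ^ n * ((-v) ^ n * w) := by
    have h4 := mul_neg_geom_sum (-((p : WittVector p B) * v)) n
    rw [sub_neg_eq_add] at h4
    have h5 : (p : WittVector p B) ^ n * ((-v) ^ n * w) = (-((p : WittVector p B) * v)) ^ n * w := by
      rw [← mul_assoc, ← mul_pow, mul_neg]
    rw [h5]
    calc w = (1 - (-((p : WittVector p B) * v)) ^ n) * w + (-((p : WittVector p B) * v)) ^ n * w := by
          ring
      _ = _ := by
        rw [← h4]
        linear_combination
          (∑ i ∈ Finset.range n, (-((p : WittVector p B) * v)) ^ i) * hw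
  rw [h3]
  refine add_mem (sum_mem fun i _ => ?_) (h.wFil_le_zFil n 0 (h.p_pow_mul_mem_wFil _ _))
  simpa using (h.zFil_isRingFil n).pow_mem ha i

/-- A Witt vector with integral components whose first component is a unit of valuation `1` is a
unit of valuation `1`. -/
theorem exists_inv_of_coeff_zero (h : IsPerfFil p F t u) {x : WittVector p B}
    (hx : ∀ n, x ∈ h.wFil n 0) (hx0 : x.coeff 0 ∈ F 1) {c : B} (hc : c ∈ F (-1))
    (hxc : x.coeff 0 * c = 1) :
    (∀ n, x ∈ h.zFil n 1) ∧ ∃ y, x * y = 1 ∧ ∀ n, y ∈ h.zFil n (-1) := by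
  obtain ⟨y, hy, hy'⟩ := h.exists_eq_p_mul
    (x := x - WittVector.teichmuller p (x.coeff 0)) (by
      rw [← WittVector.constantCoeff_apply, map_sub]
      simp)
  have hy0 : ∀ n, y ∈ h.wFil n 0 := fun n => hy' n 0 (sub_mem (hx _)
    (h.wFil_anti le_rfl zero_le_one (h.teichmuller_mem hx0)))
  -- `x = [x₀] + p y` is `[x₀] (1 + p [x₀⁻¹] y)`
  have hxy : x = WittVector.teichmuller p (x.coeff 0) + p * y := by rw [← hy]; ring
  obtain ⟨w, hw, hw'⟩ := h.exists_one_add_p_mul_inv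
    (v := WittVector.teichmuller p c * y) fun n => by
      simpa using h.teichmuller_mul_mem hc (hy0 n)
  refine ⟨fun n => ?_, WittVector.teichmuller p c * w, ?_, fun n => ?_⟩
  · rw [hxy]
    refine add_mem (h.wFil_le_zFil n 1 (h.teichmuller_mem hx0)) ?_
    have := h.p_pow_mul_mem_zFil (n := n) (m := 1) 1 (x := y) (by simpa using hy0 n)
    rwa [pow_one] at this
  · have h1 : WittVector.teichmuller p (x.coeff 0) * WittVector.teichmuller p c = 1 := by
      rw [← map_mul, hxc, map_one]
    rw [← hw]
    conv_lhs => rw [hxy]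
    linear_combination w * h1
  · simpa using (h.zFil_isRingFil n).mul_mem (h.wFil_le_zFil n (-1) (h.teichmuller_mem hc)) (hw' n)

end IsPerfFil

/-! ### The map from the Iwasawa algebra to Witt vectors -/

section Witt

variable (p : ℕ) [hp : Fact p.Prime] {f : ℕ} {G F : Type*} [CommRing G] [CommRing F]

/-- The map `W(F)[G / p ^ n] → W(F[G / p ^ n])` that sends group elements to their Teichmüller
representatives. -/
def wittLev (n : ℕ) : FinLevel p G (WittVector p F) n →+* WittVector p (FinLevel p G F n) :=
  AddMonoidAlgebra.liftNCRingHom (WittVector.map (algebraMap F (FinLevel p G F n)))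
    ((WittVector.teichmuller p).comp (AddMonoidAlgebra.of F _)) fun _ _ => Commute.all _ _

theorem wittLev_single (n : ℕ) (g : G ⧸ Ideal.span {(p : G) ^ n}) (c : WittVector p F) :
    wittLev p n (AddMonoidAlgebra.single g c) =
      WittVector.map (algebraMap F (FinLevel p G F n)) c *
        WittVector.teichmuller p (AddMonoidAlgebra.single g 1) :=
  AddMonoidAlgebra.liftNCRingHom_single _ _ _ _ _

theorem wittLev_map (n : ℕ) (x : FinLevel p G (WittVector p F) (n + 1)) :
    WittVector.map (finLevelMap p G F n).toRingHom (wittLev p (n + 1) x) =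
      wittLev p n (finLevelMap p G (WittVector p F) n x) := by
  induction x using AddMonoidAlgebra.induction_linear with
  | zero => simp only [map_zero]
  | add x y hx hy => simp only [map_add, hx, hy]
  | single g c =>
    have h1 : finLevelMap p G (WittVector p F) n (AddMonoidAlgebra.single g c) =
        AddMonoidAlgebra.single (Ideal.Quotient.factor (S := Ideal.span {(p : G) ^ (n + 1)})
          (T := Ideal.span {(p : G) ^ n}) (by
            rw [Ideal.span_singleton_le_span_singleton]
            exact pow_dvd_pow _ n.le_succ) g) c := by
      simp [finLevelMap]
    have h2 : (finLevelMap p G F n).toRingHom (AddMonoidAlgebra.single g 1) =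
        AddMonoidAlgebra.single (Ideal.Quotient.factor (S := Ideal.span {(p : G) ^ (n + 1)})
          (T := Ideal.span {(p : G) ^ n}) (by
            rw [Ideal.span_singleton_le_span_singleton]
            exact pow_dvd_pow _ n.le_succ) g) 1 := by
      simp [finLevelMap]
    rw [h1, wittLev_single, wittLev_single, map_mul, WittVector.map_teichmuller, h2]
    congr 1
    refine WittVector.ext fun l => ?_
    rw [WittVector.map_coeff, WittVector.map_coeff, WittVector.map_coeff]
    exact (finLevelMap p G F n).commutes _

theorem wittLev_scale (c : G) (n : ℕ) (x : FinLevel p G (WittVector p F) n) :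
    WittVector.map (finLevelScale p G F c n).toRingHom (wittLev p n x) =
      wittLev p n (finLevelScale p G (WittVector p F) c n x) := by
  induction x using AddMonoidAlgebra.induction_linear with
  | zero => simp only [map_zero]
  | add x y hx hy => simp only [map_add, hx, hy]
  | single g a =>
    have h1 : finLevelScale p G (WittVector p F) c n (AddMonoidAlgebra.single g a) =
        AddMonoidAlgebra.single (Ideal.Quotient.mk _ c * g) a := by
      simp [finLevelScale]
    have h2 : (finLevelScale p G F c n).toRingHom (AddMonoidAlgebra.single g 1) =
        AddMonoidAlgebra.single (Ideal.Quotient.mk _ c * g) 1 := by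
      simp [finLevelScale]
    rw [h1, wittLev_single, wittLev_single, map_mul, WittVector.map_teichmuller, h2]
    congr 1
    refine WittVector.ext fun l => ?_
    rw [WittVector.map_coeff, WittVector.map_coeff]
    exact (finLevelScale p G F c n).commutes _

theorem wittLev_coeff_zero (n : ℕ) (x : FinLevel p G (WittVector p F) n) :
    (wittLev p n x).coeff 0 = redLev p WittVector.constantCoeff n x := by
  rw [← WittVector.constantCoeff_apply]
  induction x using AddMonoidAlgebra.induction_linear with
  | zero => simp only [map_zero]
  | add x y hx hy => simp only [map_add, hx, hy]
  | single g c =>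
    rw [wittLev_single, map_mul, WittVector.constantCoeff_apply, WittVector.constantCoeff_apply,
      WittVector.map_coeff, WittVector.teichmuller_coeff_zero]
    simp [redLev]

/-- The map of Witt vectors induced by the projection to the finite level `n`. -/
def mapLev (n : ℕ) : WittVector p (iwasawa p G F) →+* WittVector p (FinLevel p G F n) :=
  WittVector.map (R := iwasawa p G F) (S := FinLevel p G F n) (lev p F n).toRingHom

theorem mapLev_coeff (n l : ℕ) (x : WittVector p (iwasawa p G F)) :
    (mapLev p n x).coeff l = lev p F n (x.coeff l) := rfl

theorem witt_ext_lev {x y : WittVector p (iwasawa p G F)}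
    (h : ∀ n, mapLev p n x = mapLev p n y) :
    x = y := by
  refine WittVector.ext fun l => ?_
  refine iwasawa_ext p fun n => ?_
  have := congrArg (fun z => z.coeff l) (h n)
  simpa only [mapLev_coeff] using this

/-- The map `W(F)⟦G⟧ → W(F⟦G⟧)` that sends group elements to their Teichmüller representatives. -/
def wittMap : iwasawa p G (WittVector p F) →+* WittVector p (iwasawa p G F) := by
  let φ : iwasawa p G (WittVector p F) → WittVector p (iwasawa p G F) := fun x =>
    WittVector.mk p fun l => ⟨fun n => (wittLev p n (lev p _ n x)).coeff l, fun n => by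
      change finLevelMap p G F n ((wittLev p (n + 1) (lev p _ (n + 1) x)).coeff l) =
        (wittLev p n (lev p _ n x)).coeff l
      have h := wittLev_map p n (lev p (WittVector p F) (n + 1) x)
      rw [finLevelMap_lev] at h
      rw [← h, WittVector.map_coeff]
      rfl⟩
  have hφ : ∀ n x, mapLev p n (φ x) = wittLev p n (lev p _ n x) := by
    intro n x
    refine WittVector.ext fun l => ?_
    rw [mapLev_coeff]
    rfl
  exact
    { toFun := φ
      map_one' := witt_ext_lev p fun n => by rw [hφ, map_one, map_one, map_one]
      map_zero' := witt_ext_lev p fun n => by rw [hφ, map_zero, map_zero, map_zero]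
      map_mul' := fun x y => witt_ext_lev p fun n => by
        rw [hφ, map_mul, map_mul, map_mul, hφ, hφ]
      map_add' := fun x y => witt_ext_lev p fun n => by
        rw [hφ, map_add, map_add, map_add, hφ, hφ] }

theorem map_lev_wittMap (n : ℕ) (x : iwasawa p G (WittVector p F)) :
    mapLev p n (wittMap p x) = wittLev p n (lev p _ n x) := by
  refine WittVector.ext fun l => ?_
  rw [mapLev_coeff]
  rfl

theorem wittMap_coeff_zero (x : iwasawa p G (WittVector p F)) :
    (wittMap p x).coeff 0 = red p WittVector.constantCoeff x :=
  iwasawa_ext p fun n => by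
    rw [lev_red, ← wittLev_coeff_zero, ← map_lev_wittMap, mapLev_coeff]

theorem wittMap_scale (c : G) (x : iwasawa p G (WittVector p F)) :
    wittMap p (scale p G (WittVector p F) c x) =
      WittVector.map (scale p G F c).toRingHom (wittMap p x) :=
  witt_ext_lev p fun n => by
    have h1 : ∀ y : WittVector p (iwasawa p G F), mapLev p n
        (WittVector.map (scale p G F c).toRingHom y) =
          WittVector.map (finLevelScale p G F c n).toRingHom
            (mapLev p n y) := fun y => by
      refine WittVector.ext fun l => ?_
      simp only [mapLev_coeff, WittVector.map_coeff]
      rfl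
    rw [h1, map_lev_wittMap, map_lev_wittMap, lev_scale, wittLev_scale]

theorem wittMap_algebraMap (c : WittVector p F) :
    wittMap p (algebraMap _ (iwasawa p G (WittVector p F)) c) =
      WittVector.map (algebraMap F (iwasawa p G F)) c :=
  witt_ext_lev p fun n => by
    have h1 : mapLev p n
        (WittVector.map (algebraMap F (iwasawa p G F)) c) =
          WittVector.map (algebraMap F (FinLevel p G F n)) c := by
      refine WittVector.ext fun l => ?_
      simp only [mapLev_coeff, WittVector.map_coeff]
      rfl
    rw [h1, map_lev_wittMap, AlgHom.commutes]
    change wittLev p n (AddMonoidAlgebra.single 0 c) = _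
    rw [wittLev_single]
    change _ * WittVector.teichmuller p 1 = _
    rw [map_one, mul_one]

end Witt

/-! ### Reduction modulo `p` of the completed localization -/

theorem IsComplFil.exists_sum {B : Type*} [CommRing B] [TopologicalSpace B]
    {F : ℤ → AddSubgroup B} (h : IsComplFil F) (m : ℤ) (e : ℕ → B)
    (he : ∀ n : ℕ, e n ∈ F (m + n)) :
    ∃ x, ∀ N : ℕ, x - ∑ n ∈ Finset.range N, e n ∈ F (m + N) := by
  let S : ℕ → B := fun N => ∑ n ∈ Finset.range N, e n
  have hS : ∀ N M : ℕ, N ≤ M → S M - S N ∈ F (m + N) := by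
    intro N M hNM
    induction M, hNM using Nat.le_induction with
    | base => simp
    | succ M hM ih =>
      have h1 : S (M + 1) - S N = (S M - S N) + e M := by
        simp only [S, Finset.sum_range_succ]
        ring
      rw [h1]
      exact add_mem ih (h.isRingFil.anti (by omega) (he M))
  obtain ⟨x, hx⟩ := h.complSeq.compl (fun k => S (k - m).toNat) fun k =>
    h.isRingFil.anti (by omega) (hS (k - m).toNat ((k + 1 : ℕ) - m).toNat (by omega))
  refine ⟨x, fun N => ?_⟩
  have h1 := hx (m + N).toNat
  have h2 := hS N (((m + N).toNat : ℕ) - m).toNat (by omega)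
  have h3 := add_mem (h.isRingFil.anti (by omega) h1) h2
  simpa [S] using h3

theorem IsComplFil.eq_zero {B : Type*} [CommRing B] [TopologicalSpace B]
    {F : ℤ → AddSubgroup B} (h : IsComplFil F) (m : ℤ) {x : B} (hx : ∀ N : ℕ, x ∈ F (m + N)) :
    x = 0 :=
  h.complSeq.sep x fun k => h.isRingFil.anti (by omega) (hx (k - m).toNat)

section

variable {p f : ℕ} [hp : Fact p.Prime] {G : Type*} [CommRing G] [IsDomain G]
  {F : Type*} [Field F] [CharP F p] {R : Type*} [CommRing R] {r : R →+* F}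

theorem IsUnramified.exists_redHat (hG : IsUnramified p f G) (r : R →+* F) (σ : G →+* R) :
    ∃ Φ : Hat p f σ →+* Hat p f (r.comp σ), Continuous Φ ∧
      (∀ x, Φ (toHat p f σ x) = toHat p f (r.comp σ) (red p r x)) ∧
      ∀ m, ∀ x ∈ hatFil p f σ m, Φ x ∈ hatFil p f (r.comp σ) m := by
  have hF := hatFil_isComplFil p f (r.comp σ)
  obtain ⟨φ, hφ, hφ'⟩ := exists_loc_extension_fil hF.isRingFil (τ := σ)
    ((toHat p f (r.comp σ)).toRingHom.comp (red p r)) 1 (fun x => toHat_mem_zero _)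
    (fun i => by
      change toHat p f (r.comp σ) (red p r (T p f σ i)) ∈ _
      rw [red_T p r hG]
      simpa using toHat_mem (m := 1) (by simpa using T_mem p f (r.comp σ) i))
    (fun i => by
      change ∃ y ∈ _, toHat p f (r.comp σ) (red p r (T p f σ i)) * y = 1
      rw [red_T p r hG]
      simpa using exists_toHat_T_mul_eq_one (τ := r.comp σ) i)
  obtain ⟨Φ, hΦ, hΦ'⟩ := exists_hat_extension hF.complSeq φ fun k => ⟨k, fun x hx => by
    simpa using hφ' k x hx⟩
  refine ⟨Φ, hΦ, fun x => ?_, fun m x hx => map_mem_of_locFil hΦ (hF.isClosed m)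
    (fun y hy => ?_) hx⟩
  · exact (hΦ' _).trans (hφ x)
  · rw [hΦ']
    simpa using hφ' m y hy

/-- Reduction modulo `p` of the coefficients, as a map between the completed localizations. -/
def IsUnramified.redHat (hG : IsUnramified p f G) (r : R →+* F) (σ : G →+* R) :
    Hat p f σ →+* Hat p f (r.comp σ) := (hG.exists_redHat r σ).choose

theorem IsUnramified.continuous_redHat (hG : IsUnramified p f G) (r : R →+* F) (σ : G →+* R) :
    Continuous (hG.redHat r σ) := (hG.exists_redHat r σ).choose_spec.1

theorem IsUnramified.redHat_toHat (hG : IsUnramified p f G) (r : R →+* F) (σ : G →+* R)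
    (x : iwasawa p G R) :
    hG.redHat r σ (toHat p f σ x) = toHat p f (r.comp σ) (red p r x) :=
  (hG.exists_redHat r σ).choose_spec.2.1 x

theorem IsUnramified.redHat_mem (hG : IsUnramified p f G) (r : R →+* F) (σ : G →+* R) {m : ℤ}
    {x : Hat p f σ} (hx : x ∈ hatFil p f σ m) :
    hG.redHat r σ x ∈ hatFil p f (r.comp σ) m :=
  (hG.exists_redHat r σ).choose_spec.2.2 m x hx

theorem IsUnramified.redHat_p_mul (hG : IsUnramified p f G) (r : R →+* F) (σ : G →+* R)
    (x : Hat p f σ) : hG.redHat r σ (p * x) = 0 := by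
  have h : ((p : ℕ) : Hat p f (r.comp σ)) = 0 := by
    rw [← map_natCast (algebraMap F (Hat p f (r.comp σ))), CharP.cast_eq_zero, map_zero]
  rw [map_mul, map_natCast, h, zero_mul]

theorem toLoc_prodT_pow_mul_cancel {τ : G →+* R} {k : ℕ} {x y : Loc p f τ}
    (h : x * toLoc p f τ (prodT p f τ) ^ k = y * toLoc p f τ (prodT p f τ) ^ k) : x = y :=
  ((isUnit_toLoc p f τ).pow k).mul_right_cancel h

/-- The reduction of the fraction `Q / (∏ T_i) ^ k` is computed on the numerator. -/
theorem IsUnramified.redHat_fraction (hG : IsUnramified p f G) (r : R →+* F) (σ : G →+* R)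
    {x : Loc p f σ} {k : ℕ} {Q : iwasawa p G R} {y : Loc p f (r.comp σ)}
    (hx : x * toLoc p f σ (prodT p f σ) ^ k = toLoc p f σ Q)
    (hy : y * toLoc p f _ (prodT p f (r.comp σ)) ^ k = toLoc p f (r.comp σ) (red p r Q)) :
    hG.redHat r σ (locToHat p f σ x) = locToHat p f (r.comp σ) y := by
  have h1 : red p r (prodT p f σ) = prodT p f (r.comp σ) := by
    simp only [prodT, map_prod, red_T p r hG]
  have h2 : hG.redHat r σ (locToHat p f σ x) * toHat p f (r.comp σ) (prodT p f (r.comp σ)) ^ k =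
      toHat p f (r.comp σ) (red p r Q) := by
    rw [← h1, ← hG.redHat_toHat, ← hG.redHat_toHat, ← map_pow, ← map_mul]
    congr 1
    have := congrArg (locToHat p f σ) hx
    rw [map_mul, map_pow] at this
    exact this
  have h3 : locToHat p f (r.comp σ) y * toHat p f (r.comp σ) (prodT p f (r.comp σ)) ^ k =
      toHat p f (r.comp σ) (red p r Q) := by
    have := congrArg (locToHat p f (r.comp σ)) hy
    rw [map_mul, map_pow] at this
    exact this
  have h4 : IsUnit (toHat p f (r.comp σ) (prodT p f (r.comp σ)) ^ k) :=
    ((isUnit_toLoc p f (r.comp σ)).map (locToHat p f (r.comp σ))).pow k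
  exact h4.mul_right_cancel (h2.trans h3.symm)

/-- Elements can be lifted along the reduction without loss of valuation. -/
theorem IsCoeffRing.exists_redHat_eq (hr : IsCoeffRing p r) (hG : IsUnramified p f G)
    (σ : G →+* R) {m : ℤ} {z : Hat p f (r.comp σ)} (hz : z ∈ hatFil p f (r.comp σ) m) :
    ∃ x ∈ hatFil p f σ m, hG.redHat r σ x = z := by
  have hF := hatFil_isComplFil p f σ
  have hF' := hatFil_isComplFil p f (r.comp σ)
  -- an approximation of `z` by a fraction is lifted by lifting its numerator; the lift improves
  -- the valuation of the remainder by one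
  have step : ∀ (n : ℕ) (z : Hat p f (r.comp σ)), z ∈ hatFil p f (r.comp σ) (m + n) →
      ∃ y, y ∈ hatFil p f (r.comp σ) (m + (n + 1 : ℕ)) ∧
        ∃ x ∈ hatFil p f σ (m + n), z - y = hG.redHat r σ x := by
    intro n z hz
    obtain ⟨y, hy⟩ := exists_sub_locToHat_mem z (m + (n + 1 : ℕ))
    obtain ⟨k, Q, hQ⟩ := exists_toLoc_eq y
    have hy1 : y ∈ locFil p f (r.comp σ) (m + n) := by
      rw [← locToHat_mem]
      have := sub_mem hz (hF'.isRingFil.anti (by omega) hy : _ ∈ hatFil p f (r.comp σ) (m + n))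
      simpa using this
    rw [mem_locFil_iff (fun i a Q => hG.mem_of_T_mul_mem _) hQ] at hy1
    obtain ⟨Q', hQ', rfl⟩ := hr.exists_red_eq hG σ hy1
    obtain ⟨x, hx⟩ := exists_mul_toLoc_eq (τ := σ) k Q'
    refine ⟨_, hy, locToHat p f σ x, locToHat_mem.2 ⟨k, Q', hQ', hx⟩, ?_⟩
    rw [hG.redHat_fraction r σ hx hQ]
    ring
  obtain ⟨s, hs0, hs⟩ := exists_seq_of_step
    (fun n z => z ∈ hatFil p f (r.comp σ) (m + n))
    (fun n z y => ∃ x ∈ hatFil p f σ (m + n), z - y = hG.redHat r σ x) z (by simpa using hz) step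
  choose hs1 e he he' using hs
  obtain ⟨x, hx⟩ := hF.exists_sum m e he
  refine ⟨x, by simpa using hx 0, ?_⟩
  have key : ∀ N : ℕ, z - hG.redHat r σ (∑ n ∈ Finset.range N, e n) = s N := by
    intro N
    induction N with
    | zero => simp [hs0]
    | succ N ih =>
      rw [Finset.sum_range_succ, map_add, ← he', ← sub_sub, ih]
      ring
  refine (sub_eq_zero.1 (hF'.eq_zero m fun N => ?_)).symm
  have h1 := sub_mem (hs1 N) (hG.redHat_mem r σ (hx N))
  rw [← key, map_sub] at h1
  simpa using h1

/-- The kernel of the reduction is generated by `p`, strictly with respect to the valuation. -/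
theorem IsCoeffRing.exists_eq_p_mul_of_redHat (hr : IsCoeffRing p r) (hG : IsUnramified p f G)
    (σ : G →+* R) {m : ℤ} {z : Hat p f σ} (hz : z ∈ hatFil p f σ m)
    (hz0 : hG.redHat r σ z = 0) : ∃ x ∈ hatFil p f σ m, z = p * x := by
  have hF := hatFil_isComplFil p f σ
  -- it suffices to subtract a multiple of `p` so as to improve the valuation by one
  have step : ∀ (n : ℕ) (z : Hat p f σ), z ∈ hatFil p f σ (m + n) ∧ hG.redHat r σ z = 0 →
      ∃ y, (y ∈ hatFil p f σ (m + (n + 1 : ℕ)) ∧ hG.redHat r σ y = 0) ∧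
        ∃ x ∈ hatFil p f σ (m + n), z - y = p * x := by
    rintro n z ⟨hz, hz0⟩
    obtain ⟨y, hy⟩ := exists_sub_locToHat_mem z (m + (n + 1 : ℕ))
    obtain ⟨k, Q, hQ⟩ := exists_toLoc_eq y
    have hy1 : y ∈ locFil p f σ (m + n) := by
      rw [← locToHat_mem]
      have := sub_mem hz (hF.isRingFil.anti (by omega) hy : _ ∈ hatFil p f σ (m + n))
      simpa using this
    rw [mem_locFil_iff (fun i a Q => hr.mem_of_T_mul_mem hG σ) hQ] at hy1
    obtain ⟨y', hy'⟩ := exists_mul_toLoc_eq (τ := r.comp σ) k (red p r Q)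
    have h1 : y' ∈ locFil p f (r.comp σ) (m + (n + 1 : ℕ)) := by
      rw [← locToHat_mem, ← hG.redHat_fraction r σ hQ hy']
      have := hG.redHat_mem r σ hy
      rw [map_sub, hz0, zero_sub] at this
      exact neg_mem_iff.1 this
    rw [mem_locFil_iff (fun i a Q => hG.mem_of_T_mul_mem _) hy'] at h1
    -- the numerator of the approximating fraction is `Q' + p Q3`, where `Q'` has higher order, and
    -- `p Q3` and hence `Q3` have the original order
    obtain ⟨Q', hQ', hQr⟩ := hr.exists_red_eq hG σ h1
    obtain ⟨Q3, hQ3⟩ := hr.red_eq_zero hG (x := Q - Q') (by rw [map_sub, hQr, sub_self])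
    have h2 : Q3 ∈ idealT p f σ ^ (m + n + k * f).toNat := by
      refine hr.mem_of_p_mul_mem hG σ ?_
      rw [← hQ3]
      exact Ideal.sub_mem _ hy1 (Ideal.pow_le_pow_right (by omega) hQ')
    obtain ⟨x, hx⟩ := exists_mul_toLoc_eq (τ := σ) k Q3
    obtain ⟨w, hw⟩ := exists_mul_toLoc_eq (τ := σ) k Q'
    have hyw : y = w + (p : Loc p f σ) * x := by
      refine toLoc_prodT_pow_mul_cancel (k := k) ?_
      rw [hQ, add_mul, hw, mul_assoc, hx, ← map_natCast (toLoc p f σ), ← map_mul, ← map_add,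
        ← hQ3]
      congr 1
      ring
    have h3 : z - p * locToHat p f σ x ∈ hatFil p f σ (m + (n + 1 : ℕ)) := by
      have h4 := add_mem hy (locToHat_mem.2 ⟨k, Q', hQ', hw⟩ :
        locToHat p f σ w ∈ hatFil p f σ (m + (n + 1 : ℕ)))
      have h5 : z - locToHat p f σ y + locToHat p f σ w = z - p * locToHat p f σ x := by
        rw [hyw, map_add, map_mul, map_natCast]
        ring
      rwa [h5] at h4
    refine ⟨_, ⟨h3, ?_⟩, locToHat p f σ x, locToHat_mem.2 ⟨k, Q3, h2, hx⟩, by ring⟩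
    rw [map_sub, hz0, hG.redHat_p_mul, sub_zero]
  obtain ⟨s, hs0, hs⟩ := exists_seq_of_step
    (fun n z => z ∈ hatFil p f σ (m + n) ∧ hG.redHat r σ z = 0)
    (fun n z y => ∃ x ∈ hatFil p f σ (m + n), z - y = p * x) z ⟨by simpa using hz, hz0⟩ step
  choose hs1 e he he' using hs
  obtain ⟨x, hx⟩ := hF.exists_sum m e he
  refine ⟨x, by simpa using hx 0, ?_⟩
  have key : ∀ N : ℕ, z - p * (∑ n ∈ Finset.range N, e n) = s N := by
    intro N
    induction N with
    | zero => simp [hs0]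
    | succ N ih =>
      rw [Finset.sum_range_succ, mul_add, ← he', ← sub_sub, ih]
      ring
  have hp0 : ((p : ℕ) : Hat p f σ) ∈ hatFil p f σ 0 := by
    rw [← map_natCast (toHat p f σ)]
    exact toHat_mem_zero _
  refine sub_eq_zero.1 (hF.eq_zero m fun N => ?_)
  have h1 := sub_mem (hs1 N).1 (hF.isRingFil.mul_mem hp0 (hx N) |> fun h => by simpa using h)
  rw [← key] at h1
  have h2 : z - p * (∑ n ∈ Finset.range N, e n) - p * (x - ∑ n ∈ Finset.range N, e n) =
      z - p * x := by ring
  rwa [h2] at h1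

theorem IsUnramified.hatToAinf_injective (hG : IsUnramified p f G) (τ : G →+* F) :
    Function.Injective (hatToAinf p f τ) := by
  refine (injective_iff_map_eq_zero _).2 fun x hx => ?_
  refine (hatFil_isComplFil p f τ).eq_zero 0 fun N => ?_
  rw [← hG.hatToAinf_mem τ, hx]
  exact zero_mem _

end

/-! ### Lifts of a filtered ring of characteristic `p` -/

/-- Ring homomorphisms to a `p`-adically complete ring extend to the `p`-adic completion. -/
theorem exists_adicCompletion_extension (p : ℕ) {L C : Type*} [CommRing L] [CommRing C]
    [IsAdicComplete (Ideal.span {(p : C)}) C] (J : L →+* C) :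
    ∃ j : AdicCompletion (Ideal.span {(p : L)}) L →+* C,
      ∀ x, j (algebraMap L (AdicCompletion (Ideal.span {(p : L)}) L) x) = J x := by
  let I : Ideal L := Ideal.span {(p : L)}
  let I' : Ideal C := Ideal.span {(p : C)}
  have hI : ∀ n, I ^ n ≤ (I' ^ n).comap J := by
    intro n
    refine (Ideal.pow_right_mono ?_ n).trans (Ideal.le_comap_pow J n)
    refine (Ideal.span_singleton_le_iff_mem _).2 ?_
    rw [Ideal.mem_comap, map_natCast]
    exact Ideal.mem_span_singleton_self _
  let g : (n : ℕ) → AdicCompletion I L →+* C ⧸ I' ^ n := fun n =>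
    (Ideal.quotientMap (I' ^ n) J (hI n)).comp (AdicCompletion.evalₐ I n).toRingHom
  have hgx : ∀ n x, g n x = Ideal.quotientMap (I' ^ n) J (hI n) (AdicCompletion.evalₐ I n x) :=
    fun _ _ => rfl
  have hg : ∀ {m n : ℕ} (hle : m ≤ n), (Ideal.Quotient.factorPow I' hle).comp (g n) = g m := by
    intro m n hle
    refine RingHom.ext fun x => ?_
    obtain ⟨a, rfl⟩ := AdicCompletion.mk_surjective I L x
    have h1 : ∀ k, g k (AdicCompletion.mk I L a) = Ideal.Quotient.mk (I' ^ k) (J (a.1 k)) := by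
      intro k
      rw [hgx, AdicCompletion.evalₐ_mk, Ideal.quotientMap_mk]
    rw [RingHom.comp_apply, h1, h1]
    change Ideal.Quotient.mk (I' ^ m) (J (a.1 n)) = _
    rw [Ideal.Quotient.eq, ← map_sub]
    refine hI m ?_
    have h2 := a.2 hle
    rw [SModEq.comm, SModEq.sub_mem] at h2
    simpa using h2
  refine ⟨IsAdicComplete.liftRingHom I' g hg, fun x => ?_⟩
  refine eq_of_sub_eq_zero (IsHausdorff.haus (I := I') inferInstance _ fun n => ?_)
  rw [SModEq.zero]
  have h1 := IsAdicComplete.mk_liftRingHom I' g hg n (algebraMap L (AdicCompletion I L) x)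
  have h2 : g n (algebraMap L (AdicCompletion I L) x) = Ideal.Quotient.mk (I' ^ n) (J x) := by
    rw [hgx, AlgHom.commutes]
    exact Ideal.quotientMap_mk
  rw [h2, Ideal.Quotient.eq] at h1
  simpa using h1

/-- Continuity of a homomorphism between groups topologized by subgroups. -/
theorem continuous_of_mem_subgroups {A B : Type*} [AddCommGroup A] [TopologicalSpace A]
    [IsTopologicalAddGroup A] [AddCommGroup B] [TopologicalSpace B] [IsTopologicalAddGroup B]
    {U : ℕ → AddSubgroup B} (hU : IsComplSeq U) (φ : A →+ B)
    (h : ∀ k, ∃ V : AddSubgroup A, (V : Set A) ∈ 𝓝 (0 : A) ∧ ∀ x ∈ V, φ x ∈ U k) :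
    Continuous φ := by
  refine continuous_of_continuousAt_zero φ ?_
  rw [ContinuousAt, map_zero]
  intro s hs
  obtain ⟨k, hk⟩ := (hU.mem_nhds s).1 hs
  obtain ⟨V, hV, hVk⟩ := h k
  exact mem_map.2 (mem_of_superset hV fun x hx => hk (hVk x hx))

/-- The properties of the ring of Witt vectors `C` of a filtered perfect ring `D` of characteristic
`p`, with the residue map `θ : C → D` and the filtrations `W n` that are meaningful modulo
`p ^ n`. -/
structure IsWittLift (p : ℕ) {C D : Type*} [CommRing C] [TopologicalSpace C] [CommRing D]
    (Fil : ℤ → AddSubgroup D) (θ : C →+* D) (W : ℕ → ℤ → AddSubgroup C) : Prop where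
  anti : ∀ {n n' : ℕ} {k k' : ℤ}, n ≤ n' → k ≤ k' → W n' k' ≤ W n k
  complSeq : IsComplSeq fun k : ℕ => W k k
  complete : IsAdicComplete (Ideal.span {(p : C)}) C
  mem_one : ∀ {k : ℤ} {x : C}, x ∈ W 1 k ↔ θ x ∈ Fil k
  p_mul_mem : ∀ {n : ℕ} {k : ℤ} {x : C}, (p : C) * x ∈ W (n + 1) k ↔ x ∈ W n k
  p_pow_mul_mem : ∀ (n : ℕ) (k : ℤ) (x : C), (p : C) ^ n * x ∈ W n k
  exists_eq_p_mul : ∀ {x : C}, θ x = 0 → ∃ y, x = p * y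
  exists_lift : ∀ {k : ℤ} {z : D}, z ∈ Fil k → ∃ x, θ x = z ∧ ∀ n, x ∈ W n k

theorem IsPerfFil.isWittLift {p : ℕ} [hp : Fact p.Prime] {B : Type*} [CommRing B]
    [TopologicalSpace B] [IsTopologicalRing B] [CharP B p] [PerfectRing B p]
    {F : ℤ → AddSubgroup B} {t u : B} (h : IsPerfFil p F t u) :
    @IsWittLift p (WittVector p B) B _ h.weakTopology _ F WittVector.constantCoeff h.wFil :=
  let _ := h.weakTopology
  { anti := fun hn hk => h.wFil_anti hn hk
    complSeq := h.wFil_isComplSeq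
    complete := inferInstance
    mem_one := fun {k x} => by
      rw [h.mem_wFil, WittVector.constantCoeff_apply]
      constructor
      · intro H
        simpa using H 0 one_pos
      · intro H l hl
        obtain rfl : l = 0 := by omega
        simpa using H
    p_mul_mem := h.p_mul_mem_wFil_iff
    p_pow_mul_mem := fun n k x => h.p_pow_mul_mem_wFil k x
    exists_eq_p_mul := fun hx => by
      obtain ⟨y, hy, -⟩ := h.exists_eq_p_mul hx
      exact ⟨y, hy⟩
    exists_lift := fun {k z} hz => ⟨WittVector.teichmuller p z, by
      rw [WittVector.constantCoeff_apply, WittVector.teichmuller_coeff_zero],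
      fun n => h.teichmuller_mem hz⟩ }

namespace IsWittLift

variable {p : ℕ} {C D : Type*} [CommRing C] [TopologicalSpace C] [IsTopologicalRing C] [CommRing D]
  {Fil : ℤ → AddSubgroup D} {θ : C →+* D} {W : ℕ → ℤ → AddSubgroup C}

theorem mem_zero (h : IsWittLift p Fil θ W) (k : ℤ) (x : C) : x ∈ W 0 k := by
  simpa using h.p_pow_mul_mem 0 k x

theorem mem_nhds (h : IsWittLift p Fil θ W) (n : ℕ) (k : ℤ) : (W n k : Set C) ∈ 𝓝 (0 : C) :=
  (h.complSeq.mem_nhds _).2 ⟨max n k.toNat, h.anti (le_max_left _ _) (by omega)⟩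

theorem eq_zero (h : IsWittLift p Fil θ W) {x : C} (hx : ∀ n k, x ∈ W n k) : x = 0 :=
  h.complSeq.sep x fun k => hx k k

theorem p_mul_eq_zero (h : IsWittLift p Fil θ W) {x : C} (hx : (p : C) * x = 0) : x = 0 :=
  h.eq_zero fun n k => h.p_mul_mem.1 (by rw [hx]; exact zero_mem _)

theorem mem_closure_iff (h : IsWittLift p Fil θ W) {S : Set C} {x : C} :
    x ∈ closure S ↔ ∀ (n : ℕ) (k : ℤ), ∃ y ∈ S, x - y ∈ W n k := by
  rw [h.complSeq.mem_closure_iff]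
  refine ⟨fun H n k => ?_, fun H k => H k k⟩
  obtain ⟨y, hy, hy'⟩ := H (max n k.toNat)
  exact ⟨y, hy, h.anti (le_max_left _ _) (by omega) hy'⟩

end IsWittLift

/-! ### The embedding of `A_mv` -/

section

variable {p f : ℕ} [hp : Fact p.Prime] {G : Type*} [CommRing G] [IsDomain G]
  {F : Type*} [Field F] [CharP F p] {R : Type*} [CommRing R] {r : R →+* F} {σ : G →+* R}
  {C : Type*} [CommRing C] [TopologicalSpace C] [IsTopologicalRing C]
  {θ : C →+* Ainf p f (r.comp σ)} {W : ℕ → ℤ → AddSubgroup C}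

theorem exists_hatToAmv_sub (n : ℕ) (P : Amv p f σ) :
    ∃ (a : Hat p f σ) (Q : Amv p f σ), P = hatToAmv p f σ a + (p : Amv p f σ) ^ n * Q := by
  obtain ⟨k, hk⟩ := exists_mem_amvNhd p f σ n P
  obtain ⟨_, ⟨a, -, rfl⟩, b, hb, rfl⟩ := AddSubgroup.mem_sup.1 hk
  obtain ⟨Q, rfl⟩ := Ideal.mem_span_singleton.1 hb
  exact ⟨a, Q, rfl⟩

theorem mem_amvNhd_iff {n : ℕ} {k : ℤ} {P : Amv p f σ} :
    P ∈ amvNhd p f σ n k ↔ ∃ a ∈ hatFil p f σ k, ∃ Q : Amv p f σ,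
      P = hatToAmv p f σ a + (p : Amv p f σ) ^ n * Q := by
  constructor
  · intro h
    obtain ⟨_, ⟨a, ha, rfl⟩, b, hb, rfl⟩ := AddSubgroup.mem_sup.1 h
    obtain ⟨Q, rfl⟩ := Ideal.mem_span_singleton.1 hb
    exact ⟨a, ha, Q, rfl⟩
  · rintro ⟨a, ha, Q, rfl⟩
    exact AddSubgroup.mem_sup.2 ⟨_, ⟨a, ha, rfl⟩, _, Ideal.mem_span_singleton.2 ⟨Q, rfl⟩, rfl⟩

theorem amvNhd_mem_nhds (n : ℕ) (k : ℤ) : (amvNhd p f σ n k : Set (Amv p f σ)) ∈ 𝓝 0 :=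
  (amvNhd_basis p f σ).hasBasis_nhds_zero.mem_of_mem (i := (n, k)) trivial

instance : IsAdicComplete (Ideal.span {(p : Amv p f σ)}) (Amv p f σ) := by
  have := AdicCompletion.isAdicComplete_self (Ideal.span {(p : Hat p f σ)})
    ⟨{(p : Hat p f σ)}, by simp⟩
  rw [Ideal.map_span, Set.image_singleton, map_natCast] at this
  exact this

/-- A homomorphism `J` from the completed localization that lifts the reduction modulo `p` and is
compatible with the filtrations. -/
structure IsHatLift (r : R →+* F) (σ : G →+* R) (θ : C →+* Ainf p f (r.comp σ))
    (W : ℕ → ℤ → AddSubgroup C) (J : Hat p f σ →+* C) : Prop where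
  lift : IsWittLift p (ainfFil p f (r.comp σ)) θ W
  mem : ∀ (n : ℕ) (m : ℤ) (x : Hat p f σ), x ∈ hatFil p f σ m → J x ∈ W n (m - n + 1)
  res : ∀ x, θ (J (toHat p f σ x)) = toAinf p f (r.comp σ) (red p r x)

variable {J : Hat p f σ →+* C}

theorem IsHatLift.continuous (h : IsHatLift r σ θ W J) : Continuous J :=
  continuous_of_mem_subgroups h.lift.complSeq J.toAddMonoidHom fun k =>
    ⟨hatFil p f σ (k + k - 1), ((hatFil_isComplFil p f σ).mem_nhds _).2 ⟨_, subset_rfl⟩,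
      fun x hx => h.lift.anti le_rfl (by omega) (h.mem k _ x hx)⟩

theorem IsWittLift.continuous_res {D : Type*} [CommRing D] [TopologicalSpace D]
    [IsTopologicalRing D] {Fil : ℤ → AddSubgroup D} {θ : C →+* D}
    (h : IsWittLift p Fil θ W) (hFil : IsComplFil Fil) : Continuous θ :=
  continuous_of_mem_subgroups hFil.complSeq θ.toAddMonoidHom fun k =>
    ⟨W 1 k, h.mem_nhds 1 k, fun _ hx => h.mem_one.1 hx⟩

theorem IsHatLift.res_hat (h : IsHatLift r σ θ W J) (hG : IsUnramified p f G) (x : Hat p f σ) :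
    θ (J x) = hatToAinf p f (r.comp σ) (hG.redHat r σ x) := by
  have := (ainfFil_isComplFil p f (r.comp σ)).complSeq.t2Space
  have h1 : Continuous (θ.comp J) :=
    (h.lift.continuous_res (ainfFil_isComplFil p f _)).comp h.continuous
  have h2 : Continuous ((hatToAinf p f (r.comp σ)).comp (hG.redHat r σ)) :=
    continuous_hatToAinf.comp (hG.continuous_redHat r σ)
  have h3 := ringHom_hat_ext h1 h2 fun x => by
    rw [RingHom.comp_apply, RingHom.comp_apply, h.res, hG.redHat_toHat, toAinf_eq]
  exact DFunLike.congr_fun h3 x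

/-- A homomorphism `j` from `A_mv` whose restriction to the completed localization lifts the
reduction modulo `p` and is compatible with the filtrations. -/
structure IsAmvLift (r : R →+* F) (σ : G →+* R) (θ : C →+* Ainf p f (r.comp σ))
    (W : ℕ → ℤ → AddSubgroup C) (j : Amv p f σ →+* C) : Prop where
  isHatLift : IsHatLift r σ θ W (j.comp (hatToAmv p f σ).toRingHom)

theorem IsHatLift.exists_isAmvLift (h : IsHatLift r σ θ W J) :
    ∃ j : Amv p f σ →+* C, IsAmvLift r σ θ W j ∧ ∀ x, j (hatToAmv p f σ x) = J x := by
  have := h.lift.complete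
  obtain ⟨j, hj⟩ := exists_adicCompletion_extension p J
  have h1 : (RingHom.comp (j : Amv p f σ →+* C) (hatToAmv p f σ).toRingHom) = J := RingHom.ext hj
  exact ⟨j, ⟨h1 ▸ h⟩, hj⟩

theorem map_p_mul_ainf (θ : C →+* Ainf p f (r.comp σ)) (x : C) : θ (p * x) = 0 := by
  rw [map_mul, map_natCast, natCast_ainf_eq_zero, zero_mul]

namespace IsAmvLift

variable {j : Amv p f σ →+* C}

theorem lift (h : IsAmvLift r σ θ W j) : IsWittLift p (ainfFil p f (r.comp σ)) θ W :=
  h.isHatLift.lift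

theorem res_hat (h : IsAmvLift r σ θ W j) (hG : IsUnramified p f G) (x : Hat p f σ) :
    θ (j (hatToAmv p f σ x)) = hatToAinf p f (r.comp σ) (hG.redHat r σ x) :=
  h.isHatLift.res_hat hG x

theorem mem_hat (h : IsAmvLift r σ θ W j) (n : ℕ) {m : ℤ} {x : Hat p f σ}
    (hx : x ∈ hatFil p f σ m) : j (hatToAmv p f σ x) ∈ W n (m - n + 1) :=
  h.isHatLift.mem n m x hx

/-- The map `j` lowers the valuation at level `n` by at most `n - 1`. -/
theorem mem (h : IsAmvLift r σ θ W j) {n : ℕ} {k : ℤ} {P : Amv p f σ}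
    (hP : P ∈ amvNhd p f σ n k) : j P ∈ W n (k - n + 1) := by
  obtain ⟨a, ha, Q, rfl⟩ := mem_amvNhd_iff.1 hP
  rw [map_add, map_mul, map_pow, map_natCast]
  exact add_mem (h.mem_hat n ha) (h.lift.p_pow_mul_mem _ _ _)

theorem continuous (h : IsAmvLift r σ θ W j) : Continuous j :=
  continuous_of_mem_subgroups h.lift.complSeq j.toAddMonoidHom fun k =>
    ⟨amvNhd p f σ k (k + k - 1), amvNhd_mem_nhds _ _,
      fun x hx => h.lift.anti le_rfl (by omega) (h.mem hx)⟩

/-- The valuation of the reduction modulo `p` is attained by a representative. -/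
theorem exists_of_res_mem (h : IsAmvLift r σ θ W j) (hr : IsCoeffRing p r)
    (hG : IsUnramified p f G) {k : ℤ} {P : Amv p f σ}
    (hP : θ (j P) ∈ ainfFil p f (r.comp σ) k) :
    ∃ a ∈ hatFil p f σ k, ∃ Q, P = hatToAmv p f σ a + p * Q := by
  obtain ⟨b, Q, rfl⟩ := exists_hatToAmv_sub 1 P
  rw [pow_one, map_add, map_mul, map_natCast, map_add, map_p_mul_ainf θ, add_zero, h.res_hat hG,
    hG.hatToAinf_mem] at hP
  obtain ⟨a, ha, hab⟩ := hr.exists_redHat_eq hG σ hP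
  obtain ⟨m, hm⟩ := (hatFil_isRingFil p f σ).exists_mem (b - a)
  obtain ⟨c, -, hc⟩ := hr.exists_eq_p_mul_of_redHat hG σ hm (by rw [map_sub, hab, sub_self])
  refine ⟨a, ha, hatToAmv p f σ c + Q, ?_⟩
  have hb : b = a + p * c := by rw [← hc]; ring
  rw [hb, map_add, map_mul, map_natCast, pow_one]
  ring

theorem exists_eq_p_mul (h : IsAmvLift r σ θ W j) (hr : IsCoeffRing p r)
    (hG : IsUnramified p f G) {P : Amv p f σ} (hP : θ (j P) = 0) : ∃ Q, P = p * Q := by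
  obtain ⟨b, Q, rfl⟩ := exists_hatToAmv_sub 1 P
  rw [pow_one, map_add, map_mul, map_natCast, map_add, map_p_mul_ainf θ, add_zero, h.res_hat hG] at hP
  obtain ⟨m, hm⟩ := (hatFil_isRingFil p f σ).exists_mem b
  obtain ⟨c, -, rfl⟩ := hr.exists_eq_p_mul_of_redHat hG σ hm
    (hG.hatToAinf_injective _ (by rw [hP, map_zero]))
  refine ⟨hatToAmv p f σ c + Q, ?_⟩
  rw [map_mul, map_natCast, pow_one]
  ring

/-- An element of the kernel reduces to zero, hence is divisible by `p`; the quotient is again in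
the kernel, and `A_mv` is `p`-adically separated. -/
theorem injective (h : IsAmvLift r σ θ W j) (hr : IsCoeffRing p r)
    (hG : IsUnramified p f G) : Function.Injective j := by
  refine (injective_iff_map_eq_zero _).2 fun P hP => ?_
  have key : ∀ n : ℕ, ∃ Q, P = (p : Amv p f σ) ^ n * Q ∧ j Q = 0 := by
    intro n
    induction n with
    | zero => exact ⟨P, by simp, hP⟩
    | succ n ih =>
      obtain ⟨Q, hQ, hQ0⟩ := ih
      obtain ⟨Q', rfl⟩ := h.exists_eq_p_mul hr hG (P := Q) (by rw [hQ0, map_zero])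
      rw [map_mul, map_natCast] at hQ0
      exact ⟨Q', by rw [hQ, pow_succ, mul_assoc], h.lift.p_mul_eq_zero hQ0⟩
  refine IsHausdorff.haus (I := Ideal.span {(p : Amv p f σ)}) inferInstance _ fun n => ?_
  obtain ⟨Q, hQ, -⟩ := key n
  rw [SModEq.zero, hQ, smul_eq_mul, Ideal.mul_top, Ideal.span_singleton_pow]
  exact Ideal.mul_mem_right _ _ (Ideal.mem_span_singleton_self _)

/-- The topology of `A_mv` is induced by that of its image: at each level `n`, the loss of valuation
in passing from the image back to `A_mv` is bounded. -/
theorem exists_mem_amvNhd (h : IsAmvLift r σ θ W j) (hr : IsCoeffRing p r)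
    (hG : IsUnramified p f G) (n : ℕ) :
    ∃ c : ℕ, ∀ (k : ℤ) (P : Amv p f σ), j P ∈ W n k → P ∈ amvNhd p f σ n (k - c) := by
  induction n with
  | zero =>
    refine ⟨0, fun k P _ => mem_amvNhd_iff.2 ⟨0, zero_mem _, P, by simp⟩⟩
  | succ n ih =>
    obtain ⟨c, hc⟩ := ih
    refine ⟨n + c, fun k P hP => ?_⟩
    obtain ⟨a, ha, Q, rfl⟩ := h.exists_of_res_mem hr hG
      (h.lift.mem_one.1 (h.lift.anti (by omega) le_rfl hP))
    -- `P = a + p Q`, where `a` has the valuation of the reduction of `P`; the valuation of `p Q`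
    -- is lower by at most `n`, the loss in `mem_hat`
    have h1 : (p : C) * j Q ∈ W (n + 1) (k - n) := by
      have h2 := sub_mem (h.lift.anti le_rfl (by omega) hP : _ ∈ W (n + 1) (k - n))
        (h.lift.anti le_rfl (by push_cast; omega) (h.mem_hat (n + 1) ha) :
          _ ∈ W (n + 1) (k - n))
      rw [map_add, map_mul, map_natCast] at h2
      simpa using h2
    obtain ⟨a', ha', Q', hQ'⟩ := mem_amvNhd_iff.1 (hc _ Q (h.lift.p_mul_mem.1 h1))
    have hp0 : ((p : ℕ) : Hat p f σ) ∈ hatFil p f σ 0 := by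
      rw [← map_natCast (toHat p f σ)]
      exact toHat_mem_zero _
    have hR := hatFil_isRingFil p f σ
    refine mem_amvNhd_iff.2 ⟨a + p * a', add_mem (hR.anti (by push_cast; omega) ha)
      (hR.anti (by push_cast; omega) (hR.mul_mem hp0 ha')), Q', ?_⟩
    rw [hQ', map_add, map_mul, map_natCast]
    ring

/-- The range is closed: a limit `x` of elements of the range agrees modulo `p` with an element of
the range, because the ring `A` is complete and embeds strictly into `A_∞`, and the difference
divided by `p` is again a limit of elements of the range. -/
theorem exists_sub_eq_p_mul (h : IsAmvLift r σ θ W j) (hr : IsCoeffRing p r)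
    (hG : IsUnramified p f G) {x : C} (hx : x ∈ closure (Set.range j)) :
    ∃ P, ∃ y ∈ closure (Set.range j), x = j P + p * y := by
  have hF := hatFil_isComplFil p f (r.comp σ)
  have hA := ainfFil_isComplFil p f (r.comp σ)
  have hx' := h.lift.mem_closure_iff.1 hx
  have h1 : ∀ k : ℕ, ∃ z : Hat p f (r.comp σ),
      θ x - hatToAinf p f (r.comp σ) z ∈ ainfFil p f (r.comp σ) k := by
    intro k
    obtain ⟨_, ⟨P, rfl⟩, hP⟩ := hx' 1 k
    obtain ⟨b, Q, rfl⟩ := exists_hatToAmv_sub 1 P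
    refine ⟨hG.redHat r σ b, ?_⟩
    have h2 := h.lift.mem_one.1 hP
    rwa [pow_one, map_sub, map_add, map_mul, map_natCast, map_add, map_p_mul_ainf θ, add_zero,
      h.res_hat hG] at h2
  choose z hz using h1
  obtain ⟨z', hz'⟩ := hF.complSeq.compl z fun k => by
    change z (k + 1) - z k ∈ hatFil p f (r.comp σ) k
    rw [← hG.hatToAinf_mem, map_sub]
    have := sub_mem (hz k) (hA.isRingFil.anti (by omega) (hz (k + 1)) :
      _ ∈ ainfFil p f (r.comp σ) k)
    convert this using 1
    ring
  -- the reduction of `x` comes from an element of `A`, by completeness of `A`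
  have hxz : θ x = hatToAinf p f (r.comp σ) z' := by
    refine sub_eq_zero.1 (hA.eq_zero 0 fun N => ?_)
    have h2 := (hG.hatToAinf_mem _).2 (hz' N)
    rw [map_sub] at h2
    have := sub_mem (hz N) h2
    rw [zero_add]
    convert this using 1
    ring
  obtain ⟨m, hm⟩ := (hatFil_isRingFil p f (r.comp σ)).exists_mem z'
  obtain ⟨a, -, ha⟩ := hr.exists_redHat_eq hG σ hm
  obtain ⟨y, hy⟩ := h.lift.exists_eq_p_mul (x := x - j (hatToAmv p f σ a)) (by
    rw [map_sub, h.res_hat hG, ha, hxz, sub_self])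
  refine ⟨hatToAmv p f σ a, y, ?_, by rw [← hy]; ring⟩
  refine h.lift.mem_closure_iff.2 fun n k => ?_
  obtain ⟨_, ⟨P, rfl⟩, hP⟩ := hx' (n + 1) (k + n + 1)
  have h3 : θ (j (P - hatToAmv p f σ a)) ∈ ainfFil p f (r.comp σ) (k + n) := by
    have h4 := h.lift.mem_one.1 (h.lift.anti (by omega) (by omega) hP : _ ∈ W 1 (k + n))
    rw [map_sub, map_sub, h.res_hat hG, ha, ← hxz, ← neg_sub, neg_mem_iff, ← map_sub]
    exact h4
  -- if `j P` is close to `x`, then `P - a` has small reduction, so that it is a small element plus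
  -- `p Q`
  obtain ⟨b, hb, Q, hQ⟩ := h.exists_of_res_mem hr hG h3
  refine ⟨j Q, ⟨Q, rfl⟩, h.lift.p_mul_mem.1 ?_⟩
  have h5 : (p : C) * (y - j Q) = (x - j P) + j (hatToAmv p f σ b) := by
    have h6 := congrArg j hQ
    rw [map_sub, map_add, map_mul, map_natCast] at h6
    rw [mul_sub, ← hy]
    linear_combination h6
  rw [h5]
  exact add_mem (h.lift.anti le_rfl (by omega) hP)
    (h.lift.anti le_rfl (by push_cast; omega) (h.mem_hat (n + 1) hb))

theorem isClosed_range (h : IsAmvLift r σ θ W j) (hr : IsCoeffRing p r)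
    (hG : IsUnramified p f G) : IsClosed (Set.range j) := by
  refine isClosed_of_closure_subset fun x hx => ?_
  obtain ⟨s, hs0, hs⟩ := exists_seq_of_step (fun _ y => y ∈ closure (Set.range j))
    (fun _ y y' => ∃ P, y = j P + p * y') x hx fun _ y hy => by
      obtain ⟨P, y', hy', h1⟩ := h.exists_sub_eq_p_mul hr hG hy
      exact ⟨y', hy', P, h1⟩
  choose hs1 P hP using hs
  -- `x = j P₀ + p (j P₁ + p (j P₂ + ⋯))`
  let S : ℕ → Amv p f σ := fun n => ∑ i ∈ Finset.range n, (p : Amv p f σ) ^ i * P i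
  have hS : ∀ n, x = j (S n) + (p : C) ^ n * s n := by
    intro n
    induction n with
    | zero => simp [S, hs0]
    | succ n ih =>
      simp only [S, Finset.sum_range_succ, map_add, map_mul, map_pow, map_natCast]
      rw [ih, hP n]
      simp only [S]
      ring
  obtain ⟨L, hL⟩ := IsPrecomplete.prec (I := Ideal.span {(p : Amv p f σ)}) inferInstance
    (f := S) fun {m n} hmn => by
      rw [SModEq.comm, SModEq.sub_mem, smul_eq_mul, Ideal.mul_top, Ideal.span_singleton_pow]
      simp only [S]
      rw [← Finset.sum_range_add_sum_Ico _ hmn, add_sub_cancel_left]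
      refine Ideal.sum_mem _ fun i hi => Ideal.mul_mem_right _ _ ?_
      exact Ideal.mem_span_singleton.2 (pow_dvd_pow _ (Finset.mem_Ico.1 hi).1)
  refine ⟨L, ?_⟩
  refine sub_eq_zero.1 (h.lift.eq_zero fun n k => ?_)
  have h1 := hL n
  rw [SModEq.sub_mem, smul_eq_mul, Ideal.mul_top, Ideal.span_singleton_pow] at h1
  obtain ⟨Q, hQ⟩ := Ideal.mem_span_singleton.1 h1
  have h2 := congrArg j hQ
  rw [map_sub, map_mul, map_pow, map_natCast] at h2
  have h3 : j L - x = (p : C) ^ n * (-(j Q) - s n) := by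
    rw [hS n]
    linear_combination -h2
  rw [h3]
  exact h.lift.p_pow_mul_mem _ _ _

theorem t2Space (h : IsAmvLift r σ θ W j) (hr : IsCoeffRing p r)
    (hG : IsUnramified p f G) : T2Space (Amv p f σ) :=
  have := h.lift.complSeq.t2Space
  T2Space.of_injective_continuous (h.injective hr hG) h.continuous

end IsAmvLift

end

/-! ### The endomorphisms of `A_mv` -/

theorem isInducing_of_subgroups {A B ι : Type*} [AddCommGroup A] [TopologicalSpace A]
    [IsTopologicalAddGroup A] [AddCommGroup B] [TopologicalSpace B] [IsTopologicalAddGroup B]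
    {φ : A →+ B} (hφ : Continuous φ) {V : ι → AddSubgroup A}
    (hV : ∀ s ∈ 𝓝 (0 : A), ∃ i, (V i : Set A) ⊆ s)
    (h : ∀ i, ∃ U ∈ 𝓝 (0 : B), ∀ x, φ x ∈ U → x ∈ V i) : IsInducing φ := by
  refine isInducing_iff_nhds.2 fun x => le_antisymm (hφ.tendsto x).le_comap fun s hs => ?_
  have h1 : (fun y => x + y) ⁻¹' s ∈ 𝓝 (0 : A) := by
    refine (continuous_const_add x).continuousAt.preimage_mem_nhds ?_
    simpa using hs
  obtain ⟨i, hi⟩ := hV _ h1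
  obtain ⟨U, hU, hUi⟩ := h i
  refine ⟨(fun z => z - φ x) ⁻¹' U, ?_, fun y hy => ?_⟩
  · refine (continuous_sub_right (φ x)).continuousAt.preimage_mem_nhds ?_
    simpa using hU
  · have h2 : y - x ∈ V i := hUi _ (by rw [map_sub]; exact hy)
    simpa using hi h2

section

variable {p f : ℕ} [hp : Fact p.Prime] {G : Type*} [CommRing G] [IsDomain G]
  {F : Type*} [Field F] [CharP F p] {R : Type*} [CommRing R] {r : R →+* F} {σ : G →+* R}

theorem red_scale (c : G) (x : iwasawa p G R) :
    red p r (scale p G R c x) = scale p G F c (red p r x) := by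
  refine iwasawa_ext p fun n => ?_
  rw [lev_red, lev_scale, lev_scale, lev_red]
  generalize lev p R n x = y
  induction y using AddMonoidAlgebra.induction_linear with
  | zero => simp only [map_zero]
  | add x y hx hy => simp only [map_add, hx, hy]
  | single g a => simp [finLevelScale, redLev]

theorem continuous_hatToAmv : Continuous (hatToAmv p f σ) := by
  refine continuous_of_continuousAt_zero (hatToAmv p f σ).toRingHom.toAddMonoidHom ?_
  rw [ContinuousAt, map_zero]
  intro s hs
  obtain ⟨⟨n, k⟩, -, hnk⟩ := (amvNhd_basis p f σ).hasBasis_nhds_zero.mem_iff.1 hs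
  refine mem_map.2 (mem_of_superset
    (((hatFil_isComplFil p f σ).mem_nhds _).2 ⟨k, subset_rfl⟩) fun x hx => hnk ?_)
  exact mem_amvNhd_iff.2 ⟨x, hx, 0, by simp⟩

theorem denseRange_hatToAmv : DenseRange (hatToAmv p f σ) := by
  intro P
  refine mem_closure_iff_nhds.2 fun s hs => ?_
  have h1 : (fun y => P + y) ⁻¹' s ∈ 𝓝 (0 : Amv p f σ) := by
    refine (continuous_const_add P).continuousAt.preimage_mem_nhds ?_
    simpa using hs
  obtain ⟨⟨n, k⟩, -, hnk⟩ := (amvNhd_basis p f σ).hasBasis_nhds_zero.mem_iff.1 h1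
  obtain ⟨a, Q, hQ⟩ := exists_hatToAmv_sub n P
  refine ⟨hatToAmv p f σ a, ?_, a, rfl⟩
  have h2 : a ∈ Set.univ := trivial
  have h3 : hatToAmv p f σ a = P + (p : Amv p f σ) ^ n * (-Q) := by rw [hQ]; ring
  rw [h3]
  exact hnk (mem_amvNhd_iff.2 ⟨0, zero_mem _, -Q, by simp⟩)

theorem ringHom_amv_ext {B : Type*} [CommRing B] [TopologicalSpace B] [T2Space B]
    {φ ψ : Amv p f σ →+* B} (hφ : Continuous φ) (hψ : Continuous ψ)
    (h : ∀ x, φ (toAmv p f σ x) = ψ (toAmv p f σ x)) : φ = ψ := by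
  have h1 := ringHom_hat_ext (φ := φ.comp (hatToAmv p f σ).toRingHom)
    (ψ := ψ.comp (hatToAmv p f σ).toRingHom) (hφ.comp continuous_hatToAmv)
    (hψ.comp continuous_hatToAmv) h
  exact DFunLike.coe_injective (denseRange_hatToAmv.equalizer hφ hψ
    (funext fun x => DFunLike.congr_fun h1 x))

theorem exists_one_add_p_mul_amv (x : Amv p f σ) : ∃ y, (1 + p * x) * y = 1 := by
  have h1 : (p : Amv p f σ) * x ∈ Ideal.jacobson (⊥ : Ideal (Amv p f σ)) :=
    IsAdicComplete.le_jacobson_bot (Ideal.span {(p : Amv p f σ)})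
      (Ideal.mul_mem_right _ _ (Ideal.mem_span_singleton_self _))
  have h2 := Ideal.mem_jacobson_bot.1 h1 1
  rw [mul_one, add_comm] at h2
  exact h2.exists_right_inv

/-- The image of `∏ T_i` under multiplication by `c` is a unit of `A_mv`, since it is one modulo
`p`. -/
theorem IsMult.isUnit_toAmv (hr : IsCoeffRing p r) (hG : IsUnramified p f G) {c : G} {e : ℕ}
    (h : IsMult p f (r.comp σ) c e) :
    IsUnit (toAmv p f σ (scale p G R c (prodT p f σ))) := by
  simp only [prodT, map_prod]
  refine IsUnit.prod_univ_iff.2 fun i => ?_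
  obtain ⟨y, hy, hy1⟩ := h.exists_mul i
  obtain ⟨a, -, ha⟩ := hr.exists_redHat_eq hG σ hy
  let z := toHat p f σ (scale p G R c (T p f σ i)) * a - 1
  obtain ⟨m, hm⟩ := (hatFil_isRingFil p f σ).exists_mem z
  obtain ⟨b, -, hb⟩ := hr.exists_eq_p_mul_of_redHat hG σ hm (by
    simp only [z]
    rw [map_sub, map_mul, hG.redHat_toHat, red_scale, red_T p r hG, ha, hy1, map_one, sub_self])
  obtain ⟨w, hw⟩ := exists_one_add_p_mul_amv (hatToAmv p f σ b)
  refine IsUnit.of_mul_eq_one (hatToAmv p f σ a * w) ?_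
  have h1 : toHat p f σ (scale p G R c (T p f σ i)) * a = 1 + p * b := by
    rw [← hb]
    simp only [z]
    ring
  have h2 := congrArg (hatToAmv p f σ) h1
  rw [map_add, map_mul, map_mul, map_natCast, map_one] at h2
  rw [← mul_assoc, ← hw, ← h2]
  rfl

variable {C : Type*} [CommRing C] [TopologicalSpace C] [IsTopologicalRing C] [Algebra R C]
  {θ : C →+* Ainf p f (r.comp σ)} {W : ℕ → ℤ → AddSubgroup C} {j : Amv p f σ →ₐ[R] C}

/-- The topology of `A_mv` is induced by that of its image. -/
theorem IsAmvLift.isInducing (h : IsAmvLift r σ θ W (j : Amv p f σ →+* C))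
    (hr : IsCoeffRing p r) (hG : IsUnramified p f G) : IsInducing j := by
  refine isInducing_of_subgroups (φ := (j : Amv p f σ →+* C).toAddMonoidHom)
    (V := fun i : ℕ × ℤ => amvNhd p f σ i.1 i.2) h.continuous (fun s hs => ?_) fun i => ?_
  · obtain ⟨i, -, hi⟩ := (amvNhd_basis p f σ).hasBasis_nhds_zero.mem_iff.1 hs
    exact ⟨i, hi⟩
  · obtain ⟨c, hc⟩ := h.exists_mem_amvNhd hr hG i.1
    exact ⟨W i.1 (i.2 + c), h.lift.mem_nhds _ _, fun x hx => by simpa using hc _ x hx⟩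

/-- An endomorphism of the lift of `A_∞` that extends the endomorphism of the Iwasawa algebra
induced by multiplication by `c` preserves `A_mv`. -/
theorem IsAmvLift.exists_act (h : IsAmvLift r σ θ W (j : Amv p f σ →+* C))
    (hr : IsCoeffRing p r) (hG : IsUnramified p f G) {c : G} {e : ℕ}
    (hc : IsMult p f (r.comp σ) c e) {Θ : C →ₐ[R] C} (hΘ : Continuous Θ)
    (hΘj : ∀ x, Θ (j (toAmv p f σ x)) = j (toAmv p f σ (scale p G R c x))) :
    ∃ g : Amv p f σ →ₐ[R] Amv p f σ,
      IsContExt (toAmv p f σ) (scale p G R c) g ∧ ∀ x, j (g x) = Θ (j x) := by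
  have hinj : Function.Injective j := h.injective hr hG
  have hcl : IsClosed {x | Θ (j x) ∈ Set.range j} :=
    (h.isClosed_range hr hG).preimage (hΘ.comp h.continuous)
  -- the image of a fraction is a fraction whose denominator is a unit of `A_mv`
  have hloc : ∀ l : Loc p f σ, Θ (j (hatToAmv p f σ (locToHat p f σ l))) ∈ Set.range j := by
    intro l
    obtain ⟨k, Q, hQ⟩ := exists_toLoc_eq l
    obtain ⟨u, hu⟩ := ((hc.isUnit_toAmv hr hG).pow k).exists_right_inv
    have h1 : hatToAmv p f σ (locToHat p f σ l) * toAmv p f σ (prodT p f σ) ^ k =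
        toAmv p f σ Q := by
      have := congrArg (fun z => hatToAmv p f σ (locToHat p f σ z)) hQ
      simp only [map_mul, map_pow] at this
      exact this
    refine ⟨toAmv p f σ (scale p G R c Q) * u, ?_⟩
    have h2 := congrArg (fun z => Θ (j z)) h1
    simp only [map_mul, map_pow, hΘj] at h2
    have h3 := congrArg j hu
    simp only [map_mul, map_pow, map_one] at h3
    rw [map_mul, ← h2, mul_assoc, h3, mul_one]
  -- the range is closed, and the fractions are dense in `A_mv`
  have hall : ∀ x, Θ (j x) ∈ Set.range j := by
    intro x
    refine denseRange_hatToAmv.induction_on (p := fun x => Θ (j x) ∈ Set.range j) x hcl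
      fun a => ?_
    exact (denseRange_locToHat p f σ).induction_on
      (p := fun a => Θ (j (hatToAmv p f σ a)) ∈ Set.range j) a
      (hcl.preimage continuous_hatToAmv) hloc
  let g : Amv p f σ →ₐ[R] Amv p f σ :=
    ((AlgEquiv.ofInjective j hinj).symm : j.range →ₐ[R] Amv p f σ).comp
      ((Θ.comp j).codRestrict j.range hall)
  have hg : ∀ x, j (g x) = Θ (j x) := by
    intro x
    have := (AlgEquiv.ofInjective j hinj).apply_symm_apply ((Θ.comp j).codRestrict j.range hall x)
    exact congrArg Subtype.val this
  refine ⟨g, ⟨?_, ?_⟩, hg⟩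
  · rw [(h.isInducing hr hG).continuous_iff]
    have h1 : j ∘ g = Θ ∘ j := funext hg
    rw [h1]
    exact hΘ.comp h.continuous
  · refine AlgHom.ext fun x => hinj ?_
    rw [AlgHom.comp_apply, hg, hΘj]
    rfl

theorem IsAmvLift.isContExt_unique (h : IsAmvLift r σ θ W (j : Amv p f σ →+* C))
    (hr : IsCoeffRing p r) (hG : IsUnramified p f G) {c : G} {g g' : Amv p f σ →ₐ[R] Amv p f σ}
    (hg : IsContExt (toAmv p f σ) (scale p G R c) g)
    (hg' : IsContExt (toAmv p f σ) (scale p G R c) g') : g = g' := by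
  have := h.t2Space hr hG
  have h1 := ringHom_amv_ext (φ := (g : Amv p f σ →+* Amv p f σ))
    (ψ := (g' : Amv p f σ →+* Amv p f σ)) hg.1 hg'.1 fun x =>
      (DFunLike.congr_fun hg.2 x).trans (DFunLike.congr_fun hg'.2 x).symm
  exact AlgHom.ext fun x => DFunLike.congr_fun h1 x

theorem IsAmvLift.isContExt_actMv (h : IsAmvLift r σ θ W (j : Amv p f σ →+* C))
    (hr : IsCoeffRing p r) (hG : IsUnramified p f G) {c : G} {e : ℕ}
    (hc : IsMult p f (r.comp σ) c e) {Θ : C →ₐ[R] C} (hΘ : Continuous Θ)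
    (hΘj : ∀ x, Θ (j (toAmv p f σ x)) = j (toAmv p f σ (scale p G R c x))) :
    IsContExt (toAmv p f σ) (scale p G R c) (actMv p f σ c) ∧
      ∀ x, j (actMv p f σ c x) = Θ (j x) := by
  obtain ⟨g, hg, hgj⟩ := h.exists_act hr hG hc hΘ hΘj
  have h1 : IsContExt (toAmv p f σ) (scale p G R c) (actMv p f σ c) := hg.contExt
  refine ⟨h1, fun x => ?_⟩
  rw [h.isContExt_unique hr hG h1 hg, hgj]

end

/-! ### The colimit and its completion -/

/-- A complete ring that contains `L` as a dense subring, with the induced topology, is the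
completion of `L`. -/
theorem exists_completion_algEquiv {R L B : Type*} [CommRing R] [CommRing L] [UniformSpace L]
    [IsUniformAddGroup L] [IsTopologicalRing L] [Algebra R L] [UniformContinuousConstSMul R L]
    [CommRing B] [TopologicalSpace B] [IsTopologicalRing B] [Algebra R B]
    {U : ℕ → AddSubgroup B} (hU : IsComplSeq U) (i : L →ₐ[R] B) (hi : IsInducing i)
    (hd : DenseRange i) :
    ∃ h : Completion L ≃ₐ[R] B, Continuous h ∧ Continuous h.symm ∧ ∀ x : L, h x = i x := by
  obtain ⟨Φ, hΦ, hΦi⟩ := hU.exists_completion_extension (i : L →+* B) hi.continuous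
  let _ := IsTopologicalAddGroup.rightUniformSpace B
  have : IsUniformAddGroup B := isUniformAddGroup_of_addCommGroup
  have hcompl := hU.completeSpace
  have hT2 := hU.t2Space
  let pkg : AbstractCompletion L :=
    { space := B
      coe := i
      uniformStruct := inferInstance
      complete := hcompl
      separation := inferInstance
      isUniformInducing := AddMonoidHom.isUniformInducing_of_isInducing (f := i) hi
      dense := hd }
  let e : Completion L ≃ᵤ B := Completion.cPkg.compareEquiv pkg
  have he : ∀ x : L, e x = i x := fun x => Completion.cPkg.compare_coe pkg x
  have heΦ : ∀ x, Φ x = e x := by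
    intro x
    refine Completion.induction_on x (isClosed_eq hΦ e.continuous) fun a => ?_
    rw [hΦi, he]
    rfl
  let Φ' : Completion L →ₐ[R] B :=
    { Φ with
      commutes' := fun c => by
        change Φ (algebraMap R (Completion L) c) = _
        rw [Completion.algebraMap_def, hΦi]
        exact i.commutes c }
  have hbij : Function.Bijective Φ' := by
    have : (Φ' : Completion L → B) = e := funext heΦ
    rw [this]
    exact e.bijective
  refine ⟨AlgEquiv.ofBijective Φ' hbij, hΦ, ?_, hΦi⟩
  have h1 : ((AlgEquiv.ofBijective Φ' hbij).symm : B → Completion L) = e.symm := by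
    funext y
    refine (AlgEquiv.ofBijective Φ' hbij).injective ?_
    rw [AlgEquiv.apply_symm_apply]
    exact ((heΦ _).trans (e.apply_symm_apply y)).symm
  rw [h1]
  exact e.symm.continuous

section

variable {p f : ℕ} [hp : Fact p.Prime] {G : Type*} [CommRing G] [IsDomain G]
  {F : Type*} [Field F] [CharP F p] {R : Type*} [CommRing R] {r : R →+* F} {σ : G →+* R}
  {C : Type*} [CommRing C] [TopologicalSpace C] [IsTopologicalRing C] [Algebra R C]

/-- An automorphism `Φ` of the lift `C` of `A_∞` that extends `φ_q`, multiplies the valuations by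
`q`, and for which the elements of `A_∞` are limits of elements `φ_q ^ (-N) a` with `a ∈ A`. -/
structure IsPhiLift (r : R →+* F) (σ : G →+* R) (θ : C →+* Ainf p f (r.comp σ))
    (W : ℕ → ℤ → AddSubgroup C) (j : Amv p f σ →ₐ[R] C) (Φ : C ≃ₐ[R] C) : Prop where
  isAmvLift : IsAmvLift r σ θ W (j : Amv p f σ →+* C)
  phiq : ∀ P, j (phiq p f σ P) = Φ (j P)
  mem : ∀ {n : ℕ} {k : ℤ} {x : C}, Φ x ∈ W n (p ^ f * k) ↔ x ∈ W n k
  dense : ∀ (z : Ainf p f (r.comp σ)) (k : ℤ), ∃ (N : ℕ) (P : Amv p f σ),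
    z - θ ((Φ⁻¹ ^ N) (j P)) ∈ ainfFil p f (r.comp σ) k

namespace IsPhiLift

variable {θ : C →+* Ainf p f (r.comp σ)} {W : ℕ → ℤ → AddSubgroup C} {j : Amv p f σ →ₐ[R] C}
  {Φ : C ≃ₐ[R] C}

theorem lift (h : IsPhiLift r σ θ W j Φ) : IsWittLift p (ainfFil p f (r.comp σ)) θ W :=
  h.isAmvLift.lift

theorem phiq_pow (h : IsPhiLift r σ θ W j Φ) (m : ℕ) (P : Amv p f σ) :
    j ((MvIwasawa.phiq p f σ ^ m) P) = (Φ ^ m) (j P) := by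
  induction m with
  | zero => simp
  | succ m ih =>
    rw [pow_succ', pow_succ', AlgHom.mul_apply, AlgEquiv.mul_apply, h.phiq, ih]

theorem mem_pow (h : IsPhiLift r σ θ W j Φ) (N : ℕ) {n : ℕ} {k : ℤ} {x : C} :
    (Φ ^ N) x ∈ W n ((p ^ f) ^ N * k) ↔ x ∈ W n k := by
  induction N with
  | zero => simp
  | succ N ih =>
    rw [pow_succ' Φ, AlgEquiv.mul_apply, pow_succ' ((p : ℤ) ^ f), mul_assoc, h.mem, ih]

theorem pow_inv_pow (Φ : C ≃ₐ[R] C) (N : ℕ) (x : C) : (Φ ^ N) ((Φ⁻¹ ^ N) x) = x := by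
  rw [← AlgEquiv.mul_apply, inv_pow, mul_inv_cancel, AlgEquiv.one_apply]

theorem inv_pow_pow (Φ : C ≃ₐ[R] C) (N : ℕ) (x : C) : (Φ⁻¹ ^ N) ((Φ ^ N) x) = x := by
  rw [← AlgEquiv.mul_apply, inv_pow, inv_mul_cancel, AlgEquiv.one_apply]

/-- The map `[P]_N ↦ Φ ^ (-N) (j P)` from the colimit. -/
def colimMap (h : IsPhiLift r σ θ W j Φ) : Colim p f σ →ₐ[R] C :=
  DirectLimit.Algebra.lift (fun _ : ℕ => Amv p f σ) (MvIwasawa.colimMap p f σ) C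
    (fun N => (Φ⁻¹ ^ N : C ≃ₐ[R] C).toAlgHom.comp j) fun N M hNM P => by
      change (Φ⁻¹ ^ M) (j ((MvIwasawa.phiq p f σ ^ (M - N)) P)) = (Φ⁻¹ ^ N) (j P)
      obtain ⟨d, rfl⟩ := Nat.exists_eq_add_of_le hNM
      rw [h.phiq_pow, Nat.add_sub_cancel_left, pow_add, AlgEquiv.mul_apply, inv_pow_pow]

theorem colimMap_toColim (h : IsPhiLift r σ θ W j Φ) (N : ℕ) (P : Amv p f σ) :
    h.colimMap (toColim p f σ N P) = (Φ⁻¹ ^ N) (j P) := rfl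

theorem exists_toColim (x : Colim p f σ) : ∃ N P, x = toColim p f σ N P := by
  induction x using DirectLimit.induction with
  | ih N P => exact ⟨N, P, rfl⟩

theorem pow_colimMap (h : IsPhiLift r σ θ W j Φ) (m N : ℕ) (P : Amv p f σ) :
    (Φ ^ (m + N)) (h.colimMap (toColim p f σ N P)) = j ((MvIwasawa.phiq p f σ ^ m) P) := by
  rw [h.colimMap_toColim, pow_add, AlgEquiv.mul_apply, pow_inv_pow, h.phiq_pow]

theorem colimMap_injective (h : IsPhiLift r σ θ W j Φ) (hr : IsCoeffRing p r)
    (hG : IsUnramified p f G) : Function.Injective h.colimMap := by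
  refine (injective_iff_map_eq_zero _).2 fun x hx => ?_
  obtain ⟨N, P, rfl⟩ := exists_toColim x
  have h1 := h.pow_colimMap 0 N P
  rw [hx, map_zero] at h1
  have h2 : P = 0 := h.isAmvLift.injective hr hG (by simpa using h1.symm)
  rw [h2, map_zero]

theorem one_lt_q (hG : IsUnramified p f G) : 1 < p ^ f :=
  Nat.one_lt_pow hG.pos.ne' hp.out.one_lt

theorem eventually_le_pow (hG : IsUnramified p f G) (N c : ℕ) :
    ∀ᶠ m : ℕ in atTop, c ≤ (p ^ f) ^ (m + N) := by
  filter_upwards [eventually_ge_atTop c] with m hm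
  exact (hm.trans (Nat.le_add_right m N)).trans (Nat.lt_pow_self (one_lt_q hG)).le

/-- Elements with large semi-valuation `w_n` have image of large valuation. The valuation of
`j (φ_q ^ m P)` is at least `v_n (φ_q ^ m P) - n`, and `Φ ^ (m + N)` multiplies the valuation of the
image by `q ^ (m + N)`; for large `m` the loss, divided by `q ^ (m + N)`, is less than `1`. -/
theorem mem_of_lt_w (h : IsPhiLift r σ θ W j Φ) (hG : IsUnramified p f G) {n : ℕ} {k : ℤ}
    {x : Colim p f σ} (hx : ((k : ℝ) : EReal) < w p f σ n x) : h.colimMap x ∈ W n (k - 1) := by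
  obtain ⟨N, P, rfl⟩ := exists_toColim x
  change _ < wLevel p f σ n N P at hx
  -- some `m` has both a large `v_n (φ_q ^ m P)` and `n ≤ q ^ (m + N)`
  obtain ⟨m, hm, hmn⟩ := ((eventually_lt_of_lt_liminf hx).and (eventually_le_pow hG N n)).exists
  have hpos : (0 : ℝ) < (p ^ f : ℝ) ^ (m + N) := by
    have := hp.out.pos
    positivity
  rw [EReal.lt_div_iff (EReal.coe_pos.2 hpos) (EReal.coe_ne_top _)] at hm
  unfold vmv at hm
  simp only [lt_iSup_iff] at hm
  obtain ⟨l, hl, hkl⟩ := hm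
  have h1 : k * ((p : ℤ) ^ f) ^ (m + N) < l := by exact_mod_cast hkl
  have h2 := h.isAmvLift.mem hl
  have h3 : (n : ℤ) ≤ ((p : ℤ) ^ f) ^ (m + N) := by exact_mod_cast hmn
  refine (h.mem_pow (m + N)).1 ?_
  rw [h.pow_colimMap]
  refine h.lift.anti le_rfl ?_ h2
  linarith

/-- The converse of `mem_of_lt_w`: the loss of valuation in passing from the image of `A_mv` back to
`A_mv` is bounded at each level, hence negligible after division by `q ^ (m + N)`. -/
theorem le_w_of_mem (h : IsPhiLift r σ θ W j Φ) (hr : IsCoeffRing p r) (hG : IsUnramified p f G)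
    {n : ℕ} {k : ℤ} {x : Colim p f σ} (hx : h.colimMap x ∈ W n k) :
    (((k - 1 : ℤ) : ℝ) : EReal) ≤ w p f σ n x := by
  obtain ⟨N, P, rfl⟩ := exists_toColim x
  change _ ≤ wLevel p f σ n N P
  obtain ⟨c, hc⟩ := h.isAmvLift.exists_mem_amvNhd hr hG n
  refine le_liminf_of_le (by isBoundedDefault) ?_
  filter_upwards [eventually_le_pow hG N c] with m hm
  have hpos : (0 : ℝ) < (p ^ f : ℝ) ^ (m + N) := by
    have := hp.out.pos
    positivity
  rw [EReal.le_div_iff_mul_le (EReal.coe_pos.2 hpos) (EReal.coe_ne_top _)]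
  have h1 := (h.mem_pow (m + N)).2 hx
  rw [h.pow_colimMap] at h1
  refine le_trans ?_ (le_iSup₂_of_le (f := fun (k : ℤ) (_ : (MvIwasawa.phiq p f σ ^ m) P ∈
    amvNhd p f σ n k) => ((k : ℝ) : EReal)) _ (hc _ _ h1) le_rfl)
  have h3 : (c : ℤ) ≤ ((p : ℤ) ^ f) ^ (m + N) := by exact_mod_cast hm
  have h2 : (k - 1) * ((p : ℤ) ^ f) ^ (m + N) ≤ (p ^ f) ^ (m + N) * k - c := by linarith
  exact_mod_cast h2

end IsPhiLift

theorem gauge_pos (p : ℕ) [Fact p.Prime] {a : EReal} (ha : a ≠ ⊤) : 0 < gauge p a := by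
  have hp : (0 : ℝ) < p := by exact_mod_cast (Fact.out : p.Prime).pos
  unfold gauge
  rw [if_neg ha]
  split_ifs
  · exact one_pos
  · positivity

theorem exists_gauge_lt (p : ℕ) [Fact p.Prime] {δ : ℝ} (hδ : 0 < δ) :
    ∃ k : ℤ, gauge p ((k : ℝ) : EReal) < δ := by
  have hp : (0 : ℝ) < p := by exact_mod_cast (Fact.out : p.Prime).pos
  have hp1 : (1 : ℝ) < p := by exact_mod_cast (Fact.out : p.Prime).one_lt
  obtain ⟨k, hk⟩ := exists_pow_lt_of_lt_one hδ (inv_lt_one_of_one_lt₀ hp1)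
  refine ⟨k, lt_of_le_of_lt ?_ hk⟩
  unfold gauge
  rw [if_neg (EReal.coe_ne_top _), if_neg (EReal.coe_ne_bot _), EReal.toReal_coe]
  have h1 : (p : ℝ) ^ (-(((k : ℕ) : ℤ) : ℝ)) = (p : ℝ)⁻¹ ^ k := by
    rw [Real.rpow_neg hp.le, Int.cast_natCast, Real.rpow_natCast, inv_pow]
  rw [h1]
  have h2 : (0 : ℝ) ≤ (p : ℝ)⁻¹ ^ k := by positivity
  exact div_le_self h2 (by linarith)

/-- Only finitely many terms of the series that defines the distance matter up to a given error. -/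
theorem colimDist_le {x : Colim p f σ} {N : ℕ} {δ : ℝ} (hδ : 0 ≤ δ)
    (h : ∀ n < N, gauge p (w p f σ (n + 1) x) ≤ δ) : colimDist p f σ x 0 ≤ δ + (1 / 2) ^ N := by
  have hδ' : Summable fun n : ℕ => (1 / 2 : ℝ) ^ (n + 1) :=
    (summable_nat_add_iff 1).2 (summable_geometric_of_lt_one (by norm_num) (by norm_num))
  have htsum : ∑' n : ℕ, (1 / 2 : ℝ) ^ (n + 1) = 1 := by
    simp only [pow_succ, tsum_mul_right, tsum_geometric_two]
    norm_num
  unfold colimDist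
  rw [sub_zero, ← (colimDist_summable p f σ x).sum_add_tsum_nat_add N]
  refine add_le_add ?_ ?_
  · calc _ ≤ ∑ n ∈ Finset.range N, (1 / 2 : ℝ) ^ (n + 1) * δ :=
          Finset.sum_le_sum fun n hn =>
            mul_le_mul_of_nonneg_left (h n (Finset.mem_range.1 hn)) (by positivity)
      _ = (∑ n ∈ Finset.range N, (1 / 2 : ℝ) ^ (n + 1)) * δ := (Finset.sum_mul ..).symm
      _ ≤ 1 * δ := by
          refine mul_le_mul_of_nonneg_right ?_ hδ
          exact (hδ'.sum_le_tsum _ fun n _ => by positivity).trans htsum.le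
      _ = δ := one_mul δ
  · calc _ ≤ ∑' n : ℕ, (1 / 2 : ℝ) ^ (n + N + 1) :=
          ((summable_nat_add_iff N).2 (colimDist_summable p f σ x)).tsum_le_tsum
            (fun n => mul_le_of_le_one_right (by positivity) (gauge_le_one p _))
            ((summable_nat_add_iff N).2 hδ')
      _ = ∑' n : ℕ, (1 / 2 : ℝ) ^ (n + 1) * (1 / 2) ^ N :=
          tsum_congr fun n => by rw [← pow_add]; congr 1; ring
      _ = (1 / 2) ^ N := by rw [tsum_mul_right, htsum, one_mul]

namespace IsPhiLift

variable {θ : C →+* Ainf p f (r.comp σ)} {W : ℕ → ℤ → AddSubgroup C} {j : Amv p f σ →ₐ[R] C}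
  {Φ : C ≃ₐ[R] C}

/-- Elements whose image is small are small for the distance. -/
theorem exists_dist_lt (h : IsPhiLift r σ θ W j Φ) (hr : IsCoeffRing p r)
    (hG : IsUnramified p f G) {ε : ℝ} (hε : 0 < ε) :
    ∃ (n : ℕ) (k : ℤ), ∀ x : Colim p f σ, h.colimMap x ∈ W n k → dist x 0 < ε := by
  obtain ⟨N, hN⟩ := exists_pow_lt_of_lt_one (half_pos hε) (by norm_num : (1 / 2 : ℝ) < 1)
  obtain ⟨k, hk⟩ := exists_gauge_lt p (half_pos hε)
  refine ⟨N, k + 1, fun x hx => ?_⟩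
  have h1 : colimDist p f σ x 0 ≤ gauge p ((k : ℝ) : EReal) + (1 / 2) ^ N := by
    refine colimDist_le (gauge_nonneg p _) fun n hn => gauge_anti p ?_
    have := h.le_w_of_mem hr hG (h.lift.anti hn le_rfl hx : _ ∈ W (n + 1) (k + 1))
    simpa using this
  change colimDist p f σ x 0 < ε
  linarith

/-- Elements that are small for the distance have small image. -/
theorem exists_mem_of_dist_lt (h : IsPhiLift r σ θ W j Φ) (hG : IsUnramified p f G) (n : ℕ)
    (k : ℤ) : ∃ ε > 0, ∀ x : Colim p f σ, dist x 0 < ε → h.colimMap x ∈ W n k := by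
  have hg := gauge_pos p (EReal.coe_ne_top ((k + 1 : ℤ) : ℝ))
  refine ⟨(1 / 2) ^ (n + 1) * gauge p (((k + 1 : ℤ) : ℝ) : EReal), by positivity, fun x hx => ?_⟩
  have h1 : (1 / 2 : ℝ) ^ (n + 1) * gauge p (w p f σ (n + 1) x) ≤ dist x 0 := by
    change _ ≤ colimDist p f σ x 0
    unfold colimDist
    rw [sub_zero]
    exact (colimDist_summable p f σ x).le_tsum n fun m _ =>
      mul_nonneg (by positivity) (gauge_nonneg p _)
  have h2 := lt_of_mul_lt_mul_left (h1.trans_lt hx) (by positivity)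
  have h3 : (((k + 1 : ℤ) : ℝ) : EReal) < w p f σ (n + 1) x := by
    by_contra hcon
    exact absurd (gauge_anti p (not_lt.1 hcon)) (not_le.2 h2)
  have h4 := h.mem_of_lt_w hG h3
  exact h.lift.anti n.le_succ (by omega) h4

/-- The distance on the colimit defines the topology induced by that of `C`. -/
theorem isInducing_colimMap (h : IsPhiLift r σ θ W j Φ) (hr : IsCoeffRing p r)
    (hG : IsUnramified p f G) : IsInducing h.colimMap := by
  have hcont : Continuous h.colimMap :=
    continuous_of_mem_subgroups h.lift.complSeq (h.colimMap : Colim p f σ →+* C).toAddMonoidHom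
      fun k => ⟨(W k k).comap (h.colimMap : Colim p f σ →+* C).toAddMonoidHom, by
        obtain ⟨ε, hε, hx⟩ := h.exists_mem_of_dist_lt hG k k
        exact Metric.mem_nhds_iff.2 ⟨ε, hε, fun x hxε => hx x hxε⟩, fun x hx => hx⟩
  refine isInducing_of_subgroups (φ := (h.colimMap : Colim p f σ →+* C).toAddMonoidHom)
    (V := fun i : ℕ × ℤ => (W i.1 i.2).comap (h.colimMap : Colim p f σ →+* C).toAddMonoidHom)
    hcont (fun s hs => ?_) fun i => ⟨W i.1 i.2, h.lift.mem_nhds _ _, fun x hx => hx⟩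
  obtain ⟨ε, hε, hs'⟩ := Metric.mem_nhds_iff.1 hs
  obtain ⟨n, k, hnk⟩ := h.exists_dist_lt hr hG hε
  exact ⟨(n, k), fun x hx => hs' (hnk x hx)⟩

/-- The range is dense: modulo `p` it is dense in `A_∞`, and one divides by `p` inductively. -/
theorem denseRange_colimMap (h : IsPhiLift r σ θ W j Φ) : DenseRange h.colimMap := by
  have key : ∀ (n : ℕ) (k : ℤ) (x : C), ∃ y, x - h.colimMap y ∈ W n k := by
    intro n k
    induction n with
    | zero => exact fun x => ⟨0, h.lift.mem_zero _ _⟩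
    | succ n ih =>
      intro x
      -- up to a small element `y`, `x` is congruent to `Φ ^ (-N) (j P)` modulo `p`
      obtain ⟨N, P, hP⟩ := h.dense (θ x) k
      obtain ⟨y, hy, hyW⟩ := h.lift.exists_lift hP
      obtain ⟨x', hx'⟩ := h.lift.exists_eq_p_mul (x := x - (Φ⁻¹ ^ N) (j P) - y) (by
        rw [map_sub, map_sub, hy, sub_self])
      obtain ⟨z, hz⟩ := ih x'
      refine ⟨toColim p f σ N P + p * z, ?_⟩
      rw [map_add, map_mul, map_natCast, h.colimMap_toColim]
      have h1 : x - ((Φ⁻¹ ^ N) (j P) + p * h.colimMap z) = y + p * (x' - h.colimMap z) := by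
        linear_combination hx'
      rw [h1]
      exact add_mem (hyW _) (h.lift.p_mul_mem.2 hz)
  intro x
  refine h.lift.mem_closure_iff.2 fun n k => ?_
  obtain ⟨y, hy⟩ := key n k x
  exact ⟨_, ⟨y, rfl⟩, hy⟩

theorem t2Space_colim (h : IsPhiLift r σ θ W j Φ) (hr : IsCoeffRing p r)
    (hG : IsUnramified p f G) : T2Space (Colim p f σ) :=
  have := h.lift.complSeq.t2Space
  T2Space.of_injective_continuous (h.colimMap_injective hr hG)
    (h.isInducing_colimMap hr hG).continuous

theorem isTopologicalRing_colim (h : IsPhiLift r σ θ W j Φ) (hr : IsCoeffRing p r)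
    (hG : IsUnramified p f G) : IsTopologicalRing (Colim p f σ) :=
  have := (h.isInducing_colimMap hr hG).continuousMul
  { }

end IsPhiLift

end

/-! ### The Witt vectors of `A_∞` -/

theorem isCoeffRing_witt (p : ℕ) [Fact p.Prime] (F : Type*) [Field F] [CharP F p] [Finite F] :
    IsCoeffRing p (WittVector.constantCoeff : WittVector p F →+* F) where
  complete := inferInstance
  surjective x := ⟨WittVector.teichmuller p x, by
    rw [WittVector.constantCoeff_apply, WittVector.teichmuller_coeff_zero]⟩
  ker c hc := (WittVector.mem_span_p_iff_coeff_zero_eq_zero c).2 hc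
  torsion_free c hc := (mul_eq_zero.1 hc).resolve_left (WittVector.p_nonzero p F)

theorem witt_map_map {p : ℕ} [Fact p.Prime] {A B C D : Type*} [CommRing A] [CommRing B]
    [CommRing C] [CommRing D] {a : B →+* D} {b : A →+* B} {c : C →+* D} {d : A →+* C}
    (h : ∀ x, a (b x) = c (d x)) (x : WittVector p A) :
    WittVector.map a (WittVector.map b x) = WittVector.map c (WittVector.map d x) := by
  refine WittVector.ext fun l => ?_
  simp only [WittVector.map_coeff, h]

section

variable {p f : ℕ} [hp : Fact p.Prime] {G : Type*} [CommRing G] [IsDomain G]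
  {F : Type*} [Field F] [CharP F p] {τ : G →+* F}

theorem IsUnramified.isPerfFil (hG : IsUnramified p f G) (τ : G →+* F) :
    ∃ u, IsPerfFil p (ainfFil p f τ) (toAinf p f τ (T p f τ ⟨0, hG.pos⟩)) u := by
  obtain ⟨u, hu, hu1⟩ := exists_toAinf_T_mul_eq_one (p := p) (τ := τ) ⟨0, hG.pos⟩
  exact ⟨u, { ainfFil_isComplFil p f τ with
    mem_of_pow := fun hx => hG.mem_ainfFil_of_pow τ hx
    t_mem := toAinf_T_mem _
    u_mem := hu
    t_mul_u := hu1 }⟩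

theorem IsUnramified.perfectRing_ainf (hG : IsUnramified p f G) (τ : G →+* F)
    [CharP (Ainf p f τ) p] : PerfectRing (Ainf p f τ) p where
  bijective_frobenius := hG.bijective_pow_ainf τ

variable (p f τ) in
/-- The map `W(F)⟦G⟧ → W(A_∞)` that sends group elements to their Teichmüller representatives. -/
def toWA : iwasawa p G (WittVector p F) →+* WittVector p (Ainf p f τ) :=
  (WittVector.map (R := iwasawa p G F) (S := Ainf p f τ) (toAinf p f τ).toRingHom).comp (wittMap p)

theorem toWA_coeff (x : iwasawa p G (WittVector p F)) (l : ℕ) :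
    (toWA p f τ x).coeff l = toAinf p f τ ((wittMap p x).coeff l) := rfl

theorem toWA_coeff_zero (x : iwasawa p G (WittVector p F)) :
    (toWA p f τ x).coeff 0 = toAinf p f τ (red p WittVector.constantCoeff x) := by
  rw [toWA_coeff, wittMap_coeff_zero]

theorem toWA_algebraMap (c : WittVector p F) :
    toWA p f τ (algebraMap _ _ c) = algebraMap _ (WittVector p (Ainf p f τ)) c := by
  refine WittVector.ext fun l => ?_
  rw [toWA_coeff, wittMap_algebraMap, WittVector.map_coeff]
  exact (toAinf p f τ).commutes _

theorem actW_coeff (c : G) (x : WittVector p (Ainf p f τ)) (l : ℕ) :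
    (actW p f τ c x).coeff l = actInf p f τ c (x.coeff l) := rfl

theorem IsMult.actW_toWA (hG : IsUnramified p f G) {c : G} {e : ℕ} (h : IsMult p f τ c e)
    (x : iwasawa p G (WittVector p F)) :
    actW p f τ c (toWA p f τ x) = toWA p f τ (scale p G (WittVector p F) c x) := by
  refine WittVector.ext fun l => ?_
  rw [actW_coeff, toWA_coeff, toWA_coeff, wittMap_scale, h.actInf_toAinf hG]
  rfl

section Act

variable [CharP (Ainf p f τ) p] {t u : Ainf p f τ}

theorem IsMult.actW_mem (hG : IsUnramified p f G) {c : G} {e : ℕ} (h : IsMult p f τ c e)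
    (hP : IsPerfFil p (ainfFil p f τ) t u) {n : ℕ} {k : ℤ} {x : WittVector p (Ainf p f τ)}
    (hx : x ∈ hP.wFil n k) : actW p f τ c x ∈ hP.wFil n (e * k) := by
  intro l hl
  rw [actW_coeff]
  have := h.actInf_mem hG (hx l hl)
  convert this using 2
  ring

theorem IsMult.continuous_actW (hG : IsUnramified p f G) {c : G} {e : ℕ} (h : IsMult p f τ c e)
    (hP : IsPerfFil p (ainfFil p f τ) t u) :
    @Continuous _ _ hP.weakTopology hP.weakTopology (actW p f τ c) := by
  let _ := hP.weakTopology
  have := hP.weakTopology_isTopologicalRing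
  refine continuous_of_mem_subgroups hP.wFil_isComplSeq
    (actW p f τ c : WittVector p (Ainf p f τ) →+* WittVector p (Ainf p f τ)).toAddMonoidHom
    fun k => ⟨hP.wFil k k, (hP.mem_nhds_weakTopology _).2 ⟨(k, k), subset_rfl⟩, fun x hx => ?_⟩
  refine hP.wFil_anti le_rfl ?_ (h.actW_mem hG hP hx)
  have := h.one_le
  exact_mod_cast Nat.le_mul_of_pos_left k this

end Act

/-- The endomorphisms of `A_∞` commute because they do so on the Iwasawa algebra. -/
theorem IsMult.actInf_comm (hG : IsUnramified p f G) {c c' : G} {e e' : ℕ} (h : IsMult p f τ c e)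
    (h' : IsMult p f τ c' e') (x : Ainf p f τ) :
    actInf p f τ c (actInf p f τ c' x) = actInf p f τ c' (actInf p f τ c x) := by
  have hc := (h.isContExt_actInf hG).1
  have hc' := (h'.isContExt_actInf hG).1
  have h3 := hG.ringHom_ainf_ext τ (φ := ((actInf p f τ c).comp (actInf p f τ c')).toRingHom)
    (ψ := ((actInf p f τ c').comp (actInf p f τ c)).toRingHom) (hc.comp hc') (hc'.comp hc)
    fun x => by
      change actInf p f τ c (actInf p f τ c' _) = actInf p f τ c' (actInf p f τ c _)
      rw [h.actInf_toAinf hG, h'.actInf_toAinf hG, h.actInf_toAinf hG, h'.actInf_toAinf hG,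
        ← scale_mul, ← scale_mul, mul_comm]
  exact DFunLike.congr_fun h3 x

theorem IsUnramified.actInf_q_pow [Finite F] (hG : IsUnramified p f G) (τ : G →+* F) :
    ∃ d : ℕ, ∀ (N : ℕ) x, (actInf p f τ ((p : G) ^ f) ^ ((d + 1) * N)) x =
      x ^ p ^ (f * (d + 1) * N) := by
  obtain ⟨d, hd⟩ := hG.exists_actInf_pow τ
  refine ⟨d, fun N => ?_⟩
  rw [pow_mul (actInf p f τ ((p : G) ^ f))]
  induction N with
  | zero => intro x; simp
  | succ N ih =>
    intro x
    rw [pow_succ', AlgHom.mul_apply, ih, hd, ← pow_mul, ← pow_add]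
    congr 2

/-- Bijectivity of `φ_q` on `A_∞`, since one of its powers is a power of the bijective Frobenius. -/
theorem IsUnramified.bijective_actInf_q [Finite F] (hG : IsUnramified p f G) (τ : G →+* F) :
    Function.Bijective (actInf p f τ ((p : G) ^ f)) := by
  obtain ⟨d, hd⟩ := hG.exists_actInf_pow τ
  have h1 : Function.Bijective (actInf p f τ ((p : G) ^ f) ^ (d + 1)) := by
    have h2 : ⇑(actInf p f τ ((p : G) ^ f) ^ (d + 1)) =
        (frobHom p F (Ainf p f τ))^[f * (d + 1)] := by
      funext x
      rw [hd, ← RingHom.coe_pow, frobHom_pow_apply]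
    rw [h2]
    exact (hG.bijective_pow_ainf τ).iterate _
  constructor
  · have := h1.1
    rw [pow_succ] at this
    exact Function.Injective.of_comp (f := actInf p f τ ((p : G) ^ f) ^ d) this
  · have := h1.2
    rw [pow_succ'] at this
    exact Function.Surjective.of_comp (g := actInf p f τ ((p : G) ^ f) ^ d) this

/-- The endomorphism `φ_q` of `A_∞` multiplies valuations by exactly `q`, since one of its powers is
a power of the Frobenius. -/
theorem IsUnramified.actInf_q_mem_iff [Finite F] (hG : IsUnramified p f G) (τ : G →+* F) {m : ℤ}
    {x : Ainf p f τ} :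
    actInf p f τ ((p : G) ^ f) x ∈ ainfFil p f τ (p ^ f * m) ↔ x ∈ ainfFil p f τ m := by
  have hq := hG.isMult_q τ
  constructor
  · intro hx
    obtain ⟨d, hd⟩ := hG.exists_actInf_pow τ
    -- the valuation of `φ_q ^ (d + 1) x` is large, and this element is `x ^ (q ^ (d + 1))`
    have key : ∀ N : ℕ, (actInf p f τ ((p : G) ^ f) ^ N) (actInf p f τ ((p : G) ^ f) x) ∈
        ainfFil p f τ (p ^ (f * (N + 1)) * m) := by
      intro N
      induction N with
      | zero => simpa using hx
      | succ N ih =>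
        rw [pow_succ', AlgHom.mul_apply]
        have := hq.actInf_mem hG ih
        convert this using 2
        push_cast
        ring
    refine hG.mem_ainfFil_of_pow_pow τ (f * (d + 1)) ?_
    rw [← hd, pow_succ]
    exact_mod_cast key d
  · intro hx
    exact_mod_cast hq.actInf_mem hG hx

end

/-! ### The embedding of `A_mv` into the Witt vectors of `A_∞` -/

section

variable {p f : ℕ} [hp : Fact p.Prime] {G : Type*} [CommRing G] [IsDomain G]
  {F : Type*} [Field F] [CharP F p] {σ : G →+* WittVector p F}
  [CharP (Ainf p f (WittVector.constantCoeff.comp σ)) p]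
  [PerfectRing (Ainf p f (WittVector.constantCoeff.comp σ)) p]
  {t u : Ainf p f (WittVector.constantCoeff.comp σ)}

/-- The image of `T_i` in the Witt vectors is a unit of valuation `1` for the filtration `zFil`. -/
theorem IsUnramified.toWA_T (hG : IsUnramified p f G)
    (hP : IsPerfFil p (ainfFil p f (WittVector.constantCoeff.comp σ)) t u) (i : Fin f) :
    (∀ n, toWA p f (WittVector.constantCoeff.comp σ) (T p f σ i) ∈ hP.zFil n 1) ∧
      ∃ y, toWA p f (WittVector.constantCoeff.comp σ) (T p f σ i) * y = 1 ∧
        ∀ n, y ∈ hP.zFil n (-1) := by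
  obtain ⟨c, hc, hc1⟩ := exists_toAinf_T_mul_eq_one (p := p)
    (τ := (WittVector.constantCoeff.comp σ : G →+* F)) i
  have h0 : (toWA p f (WittVector.constantCoeff.comp σ) (T p f σ i)).coeff 0 =
      toAinf p f (WittVector.constantCoeff.comp σ)
        (T p f (WittVector.constantCoeff.comp σ) i) := by
    rw [toWA_coeff_zero, red_T p _ hG]
  refine hP.exists_inv_of_coeff_zero (fun n l _ => ?_) (by rw [h0]; exact toAinf_T_mem i) hc
    (by rw [h0]; exact hc1)
  rw [mul_zero, toWA_coeff]
  exact toAinf_mem_zero _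

theorem toWA_mem_zFil (hP : IsPerfFil p (ainfFil p f (WittVector.constantCoeff.comp σ)) t u)
    (n : ℕ) (x : iwasawa p G (WittVector p F)) :
    toWA p f (WittVector.constantCoeff.comp σ) x ∈ hP.zFil n 0 := by
  refine hP.wFil_le_zFil n 0 fun l _ => ?_
  rw [mul_zero, toWA_coeff]
  exact toAinf_mem_zero _

/-- Extension of the Teichmüller map to the completed localization: at each level `n` it is
compatible with `zFil`, hence with `wFil` up to a shift by `n - 1`. -/
theorem IsUnramified.exists_isHatLift (hG : IsUnramified p f G)
    (hP : IsPerfFil p (ainfFil p f (WittVector.constantCoeff.comp σ)) t u) :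
    letI := hP.weakTopology
    ∃ J : Hat p f σ →+* WittVector p (Ainf p f (WittVector.constantCoeff.comp σ)),
      IsHatLift WittVector.constantCoeff σ WittVector.constantCoeff hP.wFil J ∧
        ∀ x, J (toHat p f σ x) = toWA p f (WittVector.constantCoeff.comp σ) x := by
  let _ := hP.weakTopology
  have := hP.weakTopology_isTopologicalRing
  have h1 : ∀ n : ℕ, ∃ φ : Loc p f σ →+* WittVector p (Ainf p f (WittVector.constantCoeff.comp σ)),
      (∀ x, φ (toLoc p f σ x) = toWA p f (WittVector.constantCoeff.comp σ) x) ∧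
        ∀ m, ∀ x ∈ locFil p f σ m, φ x ∈ hP.zFil n ((1 : ℕ) * m) := fun n =>
    exists_loc_extension_fil (hP.zFil_isRingFil n) _ 1 (toWA_mem_zFil hP n)
      (fun i => (hG.toWA_T hP i).1 n) fun i => by
        obtain ⟨y, hy, hy'⟩ := (hG.toWA_T hP i).2
        exact ⟨y, hy' n, hy⟩
  choose φ hφ hφ' using h1
  -- the extensions obtained for the different levels `n` agree on the Iwasawa algebra
  have h2 : ∀ n, φ n = φ 0 := fun n => ringHom_loc_ext fun x => by rw [hφ, hφ]
  have h3 : ∀ (n : ℕ) (m : ℤ), ∀ x ∈ locFil p f σ m, φ 0 x ∈ hP.wFil n (m - n + 1) := by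
    intro n m x hx
    have h4 := hφ' n m x hx
    rw [h2, Nat.cast_one, one_mul] at h4
    exact hP.zFil_le_wFil n m h4
  obtain ⟨J, hJ, hJ'⟩ := exists_hat_extension hP.wFil_isComplSeq (φ 0) fun k =>
    ⟨k + k - 1, fun x hx => hP.wFil_anti le_rfl (by omega) (h3 k _ x hx)⟩
  have h5 : ∀ x, J (toHat p f σ x) = toWA p f (WittVector.constantCoeff.comp σ) x :=
    fun x => (hJ' _).trans (hφ 0 x)
  refine ⟨J, ⟨hP.isWittLift, fun n m x hx => ?_, fun x => ?_⟩, h5⟩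
  · exact map_mem_of_locFil hJ (hP.isClosed_wFil n _) (fun y hy => by
      rw [hJ']
      exact h3 n m y hy) hx
  · rw [h5, WittVector.constantCoeff_apply, toWA_coeff_zero]

theorem IsUnramified.exists_isAmvLift (hG : IsUnramified p f G)
    (hP : IsPerfFil p (ainfFil p f (WittVector.constantCoeff.comp σ)) t u) :
    letI := hP.weakTopology
    ∃ j : Amv p f σ →ₐ[WittVector p F]
        WittVector p (Ainf p f (WittVector.constantCoeff.comp σ)),
      IsAmvLift WittVector.constantCoeff σ WittVector.constantCoeff hP.wFil
        (j : Amv p f σ →+* WittVector p (Ainf p f (WittVector.constantCoeff.comp σ))) ∧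
        ∀ x, j (toAmv p f σ x) = toWA p f (WittVector.constantCoeff.comp σ) x := by
  let _ := hP.weakTopology
  have := hP.weakTopology_isTopologicalRing
  obtain ⟨J, hJ, hJ'⟩ := hG.exists_isHatLift hP
  obtain ⟨j, hj, hj'⟩ := hJ.exists_isAmvLift
  have h1 : ∀ x, j (toAmv p f σ x) = toWA p f (WittVector.constantCoeff.comp σ) x :=
    fun x => (hj' _).trans (hJ' x)
  refine ⟨{ j with commutes' := fun c => ?_ }, hj, h1⟩
  have h2 := h1 (algebraMap (WittVector p F) _ c)
  rw [AlgHom.commutes, toWA_algebraMap] at h2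
  exact h2

variable [Finite F]

/-- The map `j` from `A_mv`, and the automorphism of `W(A_∞)` induced by `φ_q`, satisfy
`IsPhiLift`. -/
theorem IsUnramified.exists_isPhiLift (hG : IsUnramified p f G)
    (hP : IsPerfFil p (ainfFil p f (WittVector.constantCoeff.comp σ)) t u) :
    letI := hP.weakTopology
    ∃ (j : Amv p f σ →ₐ[WittVector p F]
        WittVector p (Ainf p f (WittVector.constantCoeff.comp σ)))
      (Φ : WittVector p (Ainf p f (WittVector.constantCoeff.comp σ)) ≃ₐ[WittVector p F]
        WittVector p (Ainf p f (WittVector.constantCoeff.comp σ))),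
      IsPhiLift WittVector.constantCoeff σ WittVector.constantCoeff hP.wFil j Φ ∧
        (∀ x, j (toAmv p f σ x) = toWA p f (WittVector.constantCoeff.comp σ) x) ∧
        ∀ x, Φ x = actW p f (WittVector.constantCoeff.comp σ) ((p : G) ^ f) x := by
  let _ := hP.weakTopology
  have := hP.weakTopology_isTopologicalRing
  have hr := isCoeffRing_witt p F
  have hq := hG.isMult_q (WittVector.constantCoeff.comp σ : G →+* F)
  obtain ⟨j, hj, hjx⟩ := hG.exists_isAmvLift hP
  have hbij := hG.bijective_actInf_q (WittVector.constantCoeff.comp σ : G →+* F)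
  let Φ := AlgEquiv.ofBijective (actW p f (WittVector.constantCoeff.comp σ) ((p : G) ^ f))
    ⟨WittVector.map_injective _ hbij.1, WittVector.map_surjective _ hbij.2⟩
  have hΦ : ∀ x, Φ x = actW p f (WittVector.constantCoeff.comp σ) ((p : G) ^ f) x := fun _ => rfl
  have hΦj : ∀ P, j (phiq p f σ P) = Φ (j P) := fun P =>
    (hj.isContExt_actMv hr hG hq (hq.continuous_actW hG hP) fun x => by
      rw [hjx, hjx, hq.actW_toWA hG]).2 P
  refine ⟨j, Φ, ⟨hj, hΦj, fun {n k x} => ?_, fun z k => ?_⟩, hjx, hΦ⟩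
  · refine forall₂_congr fun l _ => ?_
    rw [hΦ, actW_coeff, mul_left_comm]
    exact hG.actInf_q_mem_iff _
  -- up to a small error, `z` is the `p ^ M`-th root of some `x ∈ A`; a suitable power of `φ_q` is
  -- the Frobenius to the power `M + e`, so that `z` becomes the image of the lift of `x ^ (p ^ e)`
  · obtain ⟨y, hy⟩ := exists_sub_perfToAinf_mem z k
    obtain ⟨M, x, rfl⟩ := exists_toPerf_eq y
    obtain ⟨d, hd⟩ := hG.actInf_q_pow (WittVector.constantCoeff.comp σ : G →+* F)
    have hle : M ≤ f * (d + 1) * M := Nat.le_mul_of_pos_left M (Nat.mul_pos hG.pos d.succ_pos)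
    obtain ⟨e, he⟩ := Nat.exists_eq_add_of_le hle
    obtain ⟨m, hm⟩ := (hatFil_isRingFil p f (WittVector.constantCoeff.comp σ)).exists_mem
      (x ^ p ^ e)
    obtain ⟨a, -, ha⟩ := hr.exists_redHat_eq hG σ hm
    refine ⟨(d + 1) * M, hatToAmv p f σ a, ?_⟩
    have h1 : WittVector.constantCoeff ((Φ⁻¹ ^ ((d + 1) * M)) (j (hatToAmv p f σ a))) =
        perfToAinf p f _ (toPerf p f _ M x) := by
      have hinj : Function.Injective
          (actInf p f (WittVector.constantCoeff.comp σ : G →+* F) ((p : G) ^ f) ^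
            ((d + 1) * M)) := by
        rw [AlgHom.coe_pow]
        exact hbij.1.iterate _
      have hco : ∀ (N : ℕ) w, WittVector.constantCoeff ((Φ ^ N) w) =
          (actInf p f (WittVector.constantCoeff.comp σ : G →+* F) ((p : G) ^ f) ^ N)
            (WittVector.constantCoeff w) := by
        intro N
        induction N with
        | zero => intro w; simp
        | succ N ih =>
          intro w
          rw [pow_succ', pow_succ', AlgEquiv.mul_apply, AlgHom.mul_apply, ← ih, hΦ]
          rfl
      refine hinj ?_
      rw [← hco, IsPhiLift.pow_inv_pow, hd, ← map_pow, ← map_pow, he, pow_add, pow_mul,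
        pow_right_comm]
      refine (hj.res_hat hG a).trans ?_
      rw [ha, hatToAinf_eq]
      congr 1
      have := toPerf_pow p f (WittVector.constantCoeff.comp σ) 0 M (x ^ p ^ e)
      rw [zero_add] at this
      exact this.symm
    rw [h1]
    exact hy

end

/-! ### The completion of the colimit -/

section

variable {p f : ℕ} [hp : Fact p.Prime] {G : Type*} [CommRing G] [IsDomain G]
  {F : Type*} [Field F] [CharP F p]

theorem IsUnramified.exists_isMult (hG : IsUnramified p f G) (τ : G →+* F) {c : G}
    (hc : c ∈ insert ((p : G) ^ f) {a | IsUnit a}) : ∃ e, IsMult p f τ c e := by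
  rcases hc with rfl | hc
  · exact ⟨_, hG.isMult_q τ⟩
  · exact ⟨1, hG.isMult_unit τ hc⟩

/-- The assertions on `A_mv`, the colimit and the completion for a ring `G` with the properties of
the ring of integers of an unramified extension. -/
theorem IsUnramified.exists_completion_equiv [Finite F] (hG : IsUnramified p f G)
    (σ : G →+* WittVector p F) :
    (∀ c ∈ insert ((p : G) ^ f) {a : G | IsUnit a},
      IsContExt (toAmv p f σ) (scale p G (WittVector p F) c) (actMv p f σ c) ∧
        ∀ g, IsContExt (toAmv p f σ) (scale p G (WittVector p F) c) g → g = actMv p f σ c) ∧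
    T2Space (Colim p f σ) ∧ ∃ _ : IsTopologicalRing (Colim p f σ),
    ∃ h : Completion (Colim p f σ) ≃ₐ[WittVector p F]
        WittVector p (Ainf p f (WittVector.constantCoeff.comp σ)),
      (∀ c ∈ insert ((p : G) ^ f) {a : G | IsUnit a},
        ∃ g : Completion (Colim p f σ) →ₐ[WittVector p F] Completion (Colim p f σ),
          Continuous g ∧
          (∀ N (P : Amv p f σ), g (toColim p f σ N P : Colim p f σ) =
            (toColim p f σ N (actMv p f σ c P) : Colim p f σ)) ∧
          ∀ x, h (g x) = actW p f (WittVector.constantCoeff.comp σ) c (h x)) ∧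
      ∃ j : Amv p f σ →ₐ[WittVector p F]
          WittVector p (Ainf p f (WittVector.constantCoeff.comp σ)),
        (∀ P, j P = h (toColim p f σ 0 P : Colim p f σ)) ∧ Function.Injective j ∧
        ∀ c ∈ insert ((p : G) ^ f) {a : G | IsUnit a}, ∀ P,
          j (actMv p f σ c P) = actW p f (WittVector.constantCoeff.comp σ) c (j P) := by
  have hchar := hG.charP_ainf (WittVector.constantCoeff.comp σ : G →+* F)
  have hperf := hG.perfectRing_ainf (WittVector.constantCoeff.comp σ : G →+* F)
  obtain ⟨u, hP⟩ := hG.isPerfFil (WittVector.constantCoeff.comp σ : G →+* F)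
  let _ := hP.weakTopology
  have := hP.weakTopology_isTopologicalRing
  have hr := isCoeffRing_witt p F
  obtain ⟨j, Φ, hΦ, hjx, hΦx⟩ := hG.exists_isPhiLift hP
  have hact : ∀ c ∈ insert ((p : G) ^ f) {a : G | IsUnit a},
      Continuous (actW p f (WittVector.constantCoeff.comp σ) c) ∧
      IsContExt (toAmv p f σ) (scale p G (WittVector p F) c) (actMv p f σ c) ∧
      (∀ P, j (actMv p f σ c P) = actW p f (WittVector.constantCoeff.comp σ) c (j P)) ∧
      ∀ x, actW p f (WittVector.constantCoeff.comp σ) c (Φ x) =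
        Φ (actW p f (WittVector.constantCoeff.comp σ) c x) := by
    intro c hc
    obtain ⟨e, he⟩ := hG.exists_isMult (WittVector.constantCoeff.comp σ : G →+* F) hc
    have hcont := he.continuous_actW hG hP
    have h1 := hΦ.isAmvLift.isContExt_actMv hr hG he hcont fun x => by
      rw [hjx, hjx, he.actW_toWA hG]
    refine ⟨hcont, h1.1, h1.2, fun x => ?_⟩
    rw [hΦx, hΦx]
    exact witt_map_map (he.actInf_comm hG (hG.isMult_q _)) x
  have hring := hΦ.isTopologicalRing_colim hr hG
  obtain ⟨h, hcont, hcont', hh⟩ := exists_completion_algEquiv hΦ.lift.complSeq hΦ.colimMap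
    (hΦ.isInducing_colimMap hr hG) hΦ.denseRange_colimMap
  refine ⟨fun c hc => ⟨(hact c hc).2.1, fun g hg => hΦ.isAmvLift.isContExt_unique hr hG hg
    (hact c hc).2.1⟩, hΦ.t2Space_colim hr hG, hring, h, fun c hc => ?_, j, fun P => ?_,
    hΦ.isAmvLift.injective hr hG, fun c hc => (hact c hc).2.2.1⟩
  -- the endomorphism of the completion is that of `W(A_∞)` transported along `h`; it commutes with
  -- `Φ`
  · have hpow : ∀ N x, actW p f (WittVector.constantCoeff.comp σ) c ((Φ⁻¹ ^ N) x) =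
        (Φ⁻¹ ^ N) (actW p f (WittVector.constantCoeff.comp σ) c x) := by
      intro N
      have h1 : ∀ x, actW p f (WittVector.constantCoeff.comp σ) c ((Φ ^ N) x) =
          (Φ ^ N) (actW p f (WittVector.constantCoeff.comp σ) c x) := by
        induction N with
        | zero => exact fun x => rfl
        | succ N ih =>
          intro x
          rw [pow_succ', AlgEquiv.mul_apply, (hact c hc).2.2.2, ih]
          rfl
      intro x
      refine (Φ ^ N).injective ?_
      rw [← h1, IsPhiLift.pow_inv_pow, IsPhiLift.pow_inv_pow]
    let g : Completion (Colim p f σ) →ₐ[WittVector p F] Completion (Colim p f σ) :=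
      h.symm.toAlgHom.comp
        ((actW p f (WittVector.constantCoeff.comp σ) c).comp h.toAlgHom)
    have hgc : Continuous g := hcont'.comp ((hact c hc).1.comp hcont)
    refine ⟨g, hgc, fun N P => ?_, fun x => h.apply_symm_apply _⟩
    refine h.injective ((h.apply_symm_apply _).trans ?_)
    change actW p f (WittVector.constantCoeff.comp σ) c (h _) = _
    rw [hh, hh, hΦ.colimMap_toColim, hΦ.colimMap_toColim, hpow, (hact c hc).2.2.1]
  · rw [hh, hΦ.colimMap_toColim]
    rfl

end

/-! ### Base change and local fields -/

open TensorProduct in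
/-- A domain over the discrete valuation ring `W(F)` in which `p` is not zero is torsion free, hence
flat. -/
theorem map_id_injective_of_witt {p : ℕ} [Fact p.Prime] {F O A B : Type*} [Field F] [CharP F p]
    [PerfectRing F p] [CommRing O] [IsDomain O] [Algebra (WittVector p F) O] (hO : (p : O) ≠ 0)
    [CommRing A] [CommRing B] [Algebra (WittVector p F) A] [Algebra (WittVector p F) B]
    {j : A →ₐ[WittVector p F] B} (hj : Function.Injective j) :
    Function.Injective (Algebra.TensorProduct.map (AlgHom.id O O) j :
      O ⊗[WittVector p F] A →ₐ[O] O ⊗[WittVector p F] B) := by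
  have hinj : Function.Injective (algebraMap (WittVector p F) O) := by
    refine (injective_iff_map_eq_zero _).2 fun x hx => ?_
    by_contra hx0
    obtain ⟨n, u, hu⟩ := WittVector.exists_eq_pow_p_mul' x hx0
    rw [hu, map_mul, map_pow, map_natCast] at hx
    exact (mul_ne_zero (pow_ne_zero n hO) (u.isUnit.map _).ne_zero) hx
  have : FaithfulSMul (WittVector p F) O := (faithfulSMul_iff_algebraMap_injective _ _).2 hinj
  have : Module.Flat (WittVector p F) O := inferInstance
  exact Module.Flat.lTensor_preserves_injective_linearMap j.toLinearMap hj

open TensorProduct in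
theorem map_id_comm {R O A B : Type*} [CommRing R] [CommRing O] [Algebra R O] [CommRing A]
    [CommRing B] [Algebra R A] [Algebra R B] {j : A →ₐ[R] B} {a : A →ₐ[R] A} {b : B →ₐ[R] B}
    (h : ∀ x, j (a x) = b (j x)) (x : O ⊗[R] A) :
    Algebra.TensorProduct.map (AlgHom.id O O) j (Algebra.TensorProduct.map (AlgHom.id O O) a x) =
      Algebra.TensorProduct.map (AlgHom.id O O) b
        (Algebra.TensorProduct.map (AlgHom.id O O) j x) := by
  induction x using TensorProduct.induction_on with
  | zero => simp only [map_zero]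
  | add x y hx hy => simp only [map_add, hx, hy]
  | tmul c d => simp only [Algebra.TensorProduct.map_tmul, h]

section

open ValuativeRel

theorem isAdicComplete_integers (K : Type*) [Field K] [ValuativeRel K] [TopologicalSpace K]
    [IsNonarchimedeanLocalField K] : IsAdicComplete 𝓂[K] 𝒪[K] := by
  let _ := IsTopologicalAddGroup.rightUniformSpace K
  have : IsUniformAddGroup K := isUniformAddGroup_of_addCommGroup
  infer_instance

/-- The ring of integers of a local field in which `p` is a uniformizer has the properties required
of `G`. -/
theorem isUnramified_integers (p : ℕ) [Fact p.Prime] (K : Type*) [Field K] [ValuativeRel K]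
    [TopologicalSpace K] [IsNonarchimedeanLocalField K] (hK : Irreducible (p : 𝒪[K])) (f : ℕ)
    (hf : Nat.card 𝓀[K] = p ^ f) : IsUnramified p f 𝒪[K] := by
  have hmax : 𝓂[K] = Ideal.span {(p : 𝒪[K])} := hK.maximalIdeal_eq
  have hp0 : Ideal.span {(p : 𝒪[K])} ≠ ⊥ := by
    rw [Ne, Ideal.span_singleton_eq_bot]
    exact hK.ne_zero
  have hcard : Nat.card (𝒪[K] ⧸ Ideal.span {(p : 𝒪[K])}) = p ^ f := by
    rw [← hmax]
    exact hf
  have hmaximal : (Ideal.span {(p : 𝒪[K])}).IsMaximal := hmax ▸ inferInstance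
  have hpos : 0 < f := by
    rcases Nat.eq_zero_or_pos f with rfl | h
    · have h1 : 1 < Nat.card 𝓀[K] := Finite.one_lt_card
      rw [hf] at h1
      simp at h1
    · exact h
  refine ⟨hpos, fun n => ?_, hmaximal, fun g hg => ?_⟩
  · have := hmaximal.isPrime
    rw [← Ideal.span_singleton_pow, mul_comm, pow_mul, ← hcard]
    exact cardQuot_pow_of_prime hp0
  · have := isAdicComplete_integers K
    rw [hmax] at this
    let _ : Field (𝒪[K] ⧸ Ideal.span {(p : 𝒪[K])}) := Ideal.Quotient.field _
    have hfin : Finite (𝒪[K] ⧸ Ideal.span {(p : 𝒪[K])}) :=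
      Nat.finite_of_card_ne_zero (by rw [hcard]; exact pow_ne_zero _ (Fact.out : p.Prime).ne_zero)
    let _ := Fintype.ofFinite (𝒪[K] ⧸ Ideal.span {(p : 𝒪[K])})
    have hq : 1 < p ^ f := Nat.one_lt_pow hpos.ne' (Fact.out : p.Prime).one_lt
    have hg0 : Ideal.Quotient.mk (Ideal.span {(p : 𝒪[K])}) g ≠ 0 := fun h =>
      hg (Ideal.Quotient.eq_zero_iff_mem.1 h)
    have hpq : ((p ^ f : ℕ) : 𝒪[K] ⧸ Ideal.span {(p : 𝒪[K])}) = 0 := by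
      rw [Nat.cast_pow, ← map_natCast (Ideal.Quotient.mk (Ideal.span {(p : 𝒪[K])})),
        Ideal.Quotient.eq_zero_iff_mem.2 (Ideal.mem_span_singleton_self _), zero_pow hpos.ne']
    -- the lemma of Hensel for `X ^ (q - 1) - 1`, whose derivative `(q - 1) X ^ (q - 2)` is a unit
    -- at `g`
    obtain ⟨a, ha, hag⟩ := HenselianRing.is_henselian (I := Ideal.span {(p : 𝒪[K])})
      (Polynomial.X ^ (p ^ f - 1) - 1) (Polynomial.monic_X_pow_sub_C 1 (by omega)) g
      (by
        rw [← Ideal.Quotient.eq_zero_iff_mem]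
        simp only [Polynomial.eval_sub, Polynomial.eval_pow, Polynomial.eval_X,
          Polynomial.eval_one, map_sub, map_pow, map_one]
        rw [← hcard, Nat.card_eq_fintype_card, FiniteField.pow_card_sub_one_eq_one _ hg0, sub_self])
      (by
        simp only [Polynomial.derivative_sub, Polynomial.derivative_X_pow,
          Polynomial.derivative_one, sub_zero, Polynomial.eval_mul, Polynomial.eval_pow,
          Polynomial.eval_X, Polynomial.eval_C, map_mul, map_pow]
        refine IsUnit.mul ?_ ((isUnit_iff_ne_zero.2 hg0).pow _)
        rw [Nat.cast_sub hq.le, map_sub, map_natCast, hpq, zero_sub]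
        simp)
    have ha1 : a ^ (p ^ f - 1) = 1 := by
      simpa [Polynomial.IsRoot, sub_eq_zero] using ha
    have : NeZero (p ^ f - 1) := ⟨by omega⟩
    exact ⟨rootsOfUnity.mkOfPowEq a ha1, by simpa using hag⟩

end

end MvIwasawa

end

theorem mainTheorem11
    -- `K` is a finite unramified extension of `ℚ_p` with residue field of cardinality `p ^ f`
    (p : ℕ) [Fact p.Prime]
    (K : Type*) [Field K] [ValuativeRel K] [TopologicalSpace K] [IsNonarchimedeanLocalField K]
    [Algebra ℚ_[p] K] [FiniteDimensional ℚ_[p] K] [ValuativeExtension ℚ_[p] K]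
    (hK : Irreducible (p : 𝒪[K])) (f : ℕ) (hf : Nat.card 𝓀[K] = p ^ f)
    -- `E` is a finite extension of `K` with residue field `𝔽 = 𝓀[E]`
    (E : Type*) [Field E] [ValuativeRel E] [TopologicalSpace E] [IsNonarchimedeanLocalField E]
    [Algebra K E] [FiniteDimensional K E] [ValuativeExtension K E] [CharP 𝓀[E] p]
    -- the embeddings `W(𝔽) → 𝒪_E` and `σ₀ : 𝒪_K → W(𝔽)`
    [Algebra (WittVector p 𝓀[E]) 𝒪[E]] (σ : 𝒪[K] →+* WittVector p 𝓀[E]) :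
    let σF : 𝒪[K] →+* 𝓀[E] := WittVector.constantCoeff.comp σ
    let W := WittVector p 𝓀[E]
    let A := Amv p f σ
    let X := Colim p f σ
    let WA := WittVector p (Ainf p f σF)
    -- the multipliers `q = p ^ f` (which induces `φ_q`) and the units of `𝒪_K`
    let M : Set 𝒪[K] := insert ((p : 𝒪[K]) ^ f) {a | IsUnit a}
    -- the actions on `A_mv` and `A_∞` are well defined
    (∀ c ∈ M, IsContExt (toAmv p f σ) (scale p 𝒪[K] W c) (actMv p f σ c) ∧
      ∀ g, IsContExt (toAmv p f σ) (scale p 𝒪[K] W c) g → g = actMv p f σ c) ∧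
    (∀ c ∈ M, IsContExt (toAinf p f σF) (scale p 𝒪[K] 𝓀[E] c) (actInf p f σF c) ∧
      ∀ g, IsContExt (toAinf p f σF) (scale p 𝒪[K] 𝓀[E] c) g → g = actInf p f σF c) ∧
    -- the colimit is a Hausdorff topological ring, so that its completion is a ring
    T2Space X ∧ ∃ _ : IsTopologicalRing X,
    -- the isomorphism
    ∃ h : Completion X ≃ₐ[W] WA,
      (∀ c ∈ M, ∃ g : Completion X →ₐ[W] Completion X, Continuous g ∧
        (∀ N (P : A), g (toColim p f σ N P : X) = (toColim p f σ N (actMv p f σ c P) : X)) ∧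
        ∀ x, h (g x) = actW p f σF c (h x)) ∧
      -- the induced injections
      ∃ j : A →ₐ[W] WA, (∀ P, j P = h (toColim p f σ 0 P : X)) ∧
        Function.Injective j ∧
        (∀ c ∈ M, ∀ P, j (actMv p f σ c P) = actW p f σF c (j P)) ∧
        Function.Injective (Algebra.TensorProduct.map (AlgHom.id 𝒪[E] 𝒪[E]) j) ∧
        (∀ c ∈ M, ∀ P : 𝒪[E] ⊗[W] A,
          Algebra.TensorProduct.map (AlgHom.id 𝒪[E] 𝒪[E]) j
              (Algebra.TensorProduct.map (AlgHom.id 𝒪[E] 𝒪[E]) (actMv p f σ c) P) =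
            Algebra.TensorProduct.map (AlgHom.id 𝒪[E] 𝒪[E]) (actW p f σF c)
              (Algebra.TensorProduct.map (AlgHom.id 𝒪[E] 𝒪[E]) j P)) := by
  intro σF W A X WA M
  have hG := isUnramified_integers p K hK f hf
  have hpK : (p : K) ≠ 0 := fun h => hK.ne_zero (Subtype.val_injective h)
  have hpE' : (p : E) ≠ 0 := fun h => hpK ((algebraMap K E).injective (by
    rw [map_natCast, map_zero, h]))
  have hpE : (p : 𝒪[E]) ≠ 0 := fun h => hpE' (congrArg Subtype.val h)
  obtain ⟨hMv, hT2, hring, h, hg, j, hjh, hinj, hact⟩ := hG.exists_completion_equiv σ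
  refine ⟨hMv, fun c hc => ?_, hT2, hring, h, hg, j, hjh, hinj, hact,
    map_id_injective_of_witt hpE hinj, fun c hc => map_id_comm (hact c hc)⟩
  obtain ⟨e, he⟩ := hG.exists_isMult σF hc
  have h1 := he.isContExt_actInf hG
  exact ⟨h1, fun g hg => hG.isContExt_ainf_unique hg h1⟩
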